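/- Let $V\subseteq H\equiv H^*\subseteq V^*$ be a Gelfand triple: $H$ is a real separable Hilbert space identified with its dual by the Riesz isomorphism, $V$ is a real reflexive Banach space continuously and densely embedded in $H$, and $\langle\cdot,\cdot\rangle_V$ is the pairing of $V^*$ with $V$, so that $\langle u,v\rangle_V=\langle u,v\rangle_H$ for $u\in H$, $v\in V$. Assume that the embedding $V\subseteq H$ is compact. Let $T>0$ and let $A:[0,T]\times V\to V^*$ be such that $t\mapsto A(t,u(t))$ is measurable on $[0,T]$ for every $u\in L^1([0,T];V)$. Let $\alpha>1$, $\beta\ge 0$, and suppose that there are constants $\delta>0$ and $C\in\mathbb R$, a nonnegative $f\in L^1([0,T];\mathbb R)$, and measurable functions $\rho,\eta:V\to[0,\infty)$ that are bounded on bounded subsets of $V$, such that for all $t\in[0,T]$ and $v,v_1,v_2\in V$: (H1) (hemicontinuity) the map $s\mapsto\langle A(t,v_1+sv_2),v\rangle_V$ is continuous on $\mathbb R$; (H2) (local monotonicity) $\langle A(t,v_1)-A(t,v_2),v_1-v_2\rangle_V\le\bigl(C+\rho(v_1)+\eta(v_2)\bigr)\|v_1-v_2\|_H^2$; (H3) (coercivity)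 $2\langle A(t,v),v\rangle_V\le-\delta\|v\|_V^\alpha+C\|v\|_H^2+f(t)$; (H4) (growth) $\|A(t,v)\|_{V^*}\le\bigl(f(t)^{\frac{\alpha-1}{\alpha}}+C\|v\|_V^{\alpha-1}\bigr)\bigl(1+\|v\|_H^\beta\bigr)$. Let $u_0\in H$ and $b\in L^{\frac{\alpha}{\alpha-1}}([0,T];V^*)$. A solution of $$u'(t)=A(t,u(t))+b(t),\quad 0<t<T,\qquad u(0)=u_0, \tag{1}$$ is a $u\in L^\alpha([0,T];V)\cap C([0,T];H)$ with $u(0)=u_0$ whose generalized ($V^*$-valued distributional) derivative $u'$ on $(0,T)$ is the integrable function $A(\cdot,u(\cdot))+b$. Then (1) has a solution $u\in L^\alpha([0,T];V)\cap C([0,T];H)$ with $u'\in L^{\frac{\alpha}{\alpha-1}}([0,T];V^*)$ and $$\langle u(t),v\rangle_H=\langle u_0,v\rangle_H+\int_0^t\langle A(s,u(s))+b(s),v\rangle_V\,ds,\qquad t\in[0,T],\ v\in V.$$ Moreover, if there are constants $C'\in\mathbb R$ and $\gamma\ge0$ such that $$\rho(v)+\eta(v)\le C'\,(1+\|v\|_V^\alpha)(1+\|v\|_H^\gamma),\qquad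 v\in V,$$ then the solution of (1) is unique. -/

import Mathlib

open Set MeasureTheory
open scoped ContDiff

namespace LocallyMonotone

/-- A real Banach space is reflexive if its canonical embedding into the bidual is onto. -/
def IsReflexiveSpace (V : Type*) [NormedAddCommGroup V] [NormedSpace ℝ V] : Prop :=
  Function.Surjective (NormedSpace.inclusionInDoubleDual ℝ V)

/-- `ι : V → H` is the (continuous, dense) embedding of a Gelfand triple `V ⊆ H ≡ H* ⊆ V*`
with `V` reflexive. -/
structure IsGelfandTriple {V H : Type*} [NormedAddCommGroup V] [NormedSpace ℝ V]
    [NormedAddCommGroup H] [InnerProductSpace ℝ H] (ι : V →L[ℝ] H) : Prop where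
  reflexive : IsReflexiveSpace V
  injective : Function.Injective ι
  denseRange : DenseRange ι

/-- The inclusion `H ≡ H* ⊆ V*`: the element `h` of `H` acts on `V` as `v ↦ ⟨h, ι v⟩_H`. -/
noncomputable def toDual {V H : Type*} [NormedAddCommGroup V] [NormedSpace ℝ V]
    [NormedAddCommGroup H] [InnerProductSpace ℝ H] (ι : V →L[ℝ] H) (h : H) : StrongDual ℝ V :=
  (innerSL ℝ h).comp ι

/-- Lebesgue measure on `[0,T]`. -/
noncomputable def timeMeasure (T : ℝ) : Measure ℝ := volume.restrict (Icc 0 T)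

/-- `w` is the generalized derivative of `g` on `(0,T)`, both being integrable functions on `(0,T)`
with values in a Banach space: `∫ φ' g = - ∫ φ w` for all `φ ∈ C_c^∞(0,T)`. -/
def HasGeneralizedDeriv {E : Type*} [NormedAddCommGroup E] [NormedSpace ℝ E]
    (T : ℝ) (g w : ℝ → E) : Prop :=
  IntegrableOn g (Ioo 0 T) ∧ IntegrableOn w (Ioo 0 T) ∧
    ∀ φ : ℝ → ℝ, ContDiff ℝ ∞ φ → HasCompactSupport φ → tsupport φ ⊆ Ioo 0 T →
      ∫ t in Ioo 0 T, deriv φ t • g t = - ∫ t in Ioo 0 T, φ t • w t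

section Operator

variable {V H : Type*} [NormedAddCommGroup V] [NormedSpace ℝ V]
  [NormedAddCommGroup H] [InnerProductSpace ℝ H]

/-- Measurability of `A : [0,T] × V → V*`: `t ↦ A(t,u(t))` is (Lebesgue, strongly) measurable on
`[0,T]` for every `u ∈ L¹([0,T];V)`. -/
def IsMeasurableOperator (T : ℝ) (A : ℝ → V → StrongDual ℝ V) : Prop :=
  ∀ u : ℝ → V, MemLp u 1 (timeMeasure T) →
    AEStronglyMeasurable (fun t => A t (u t)) (timeMeasure T)

/-- Hemicontinuity. -/
def Hemicontinuous (T : ℝ) (A : ℝ → V → StrongDual ℝ V) : Prop :=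
  ∀ t ∈ Icc 0 T, ∀ v₁ v₂ v : V, Continuous fun s : ℝ => A t (v₁ + s • v₂) v

/-- Local monotonicity with constant `C` and functions `ρ, η`. -/
def LocalMonotonicity (ι : V →L[ℝ] H) (T C : ℝ) (ρ η : V → ℝ)
    (A : ℝ → V → StrongDual ℝ V) : Prop :=
  ∀ t ∈ Icc 0 T, ∀ v₁ v₂ : V,
    (A t v₁ - A t v₂) (v₁ - v₂) ≤ (C + ρ v₁ + η v₂) * ‖ι (v₁ - v₂)‖ ^ 2

/-- The functions allowed in the local monotonicity condition: nonnegative, Borel measurable, and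
bounded on bounded subsets of `V`. -/
structure IsAdmissibleWeight [MeasurableSpace V] (ρ : V → ℝ) : Prop where
  nonneg : ∀ v, 0 ≤ ρ v
  measurable : Measurable ρ
  locallyBounded : ∀ R : ℝ, ∃ M : ℝ, ∀ v : V, ‖v‖ ≤ R → ρ v ≤ M

/-- Coercivity. -/
def Coercivity (ι : V →L[ℝ] H) (T α δ C : ℝ) (f : ℝ → ℝ)
    (A : ℝ → V → StrongDual ℝ V) : Prop :=
  ∀ t ∈ Icc 0 T, ∀ v : V, 2 * A t v v ≤ -δ * ‖v‖ ^ α + C * ‖ι v‖ ^ 2 + f t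

/-- Growth. -/
def Growth (ι : V →L[ℝ] H) (T α β C : ℝ) (f : ℝ → ℝ)
    (A : ℝ → V → StrongDual ℝ V) : Prop :=
  ∀ t ∈ Icc 0 T, ∀ v : V,
    ‖A t v‖ ≤ (f t ^ ((α - 1) / α) + C * ‖v‖ ^ (α - 1)) * (1 + ‖ι v‖ ^ β)

/-- A solution of `u' = A(t,u) + b` on `(0,T)`, `u(0) = u₀`, in `L^α([0,T];V) ∩ C([0,T];H)`.
The one element `u` of the intersection is given by two representatives: the continuous
`H`-valued function `u`, and a `V`-valued function `v` equal to it almost everywhere. -/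
structure IsSolution (ι : V →L[ℝ] H) (T α : ℝ) (A : ℝ → V → StrongDual ℝ V)
    (b : ℝ → StrongDual ℝ V) (u₀ : H) (u : ℝ → H) (v : ℝ → V) : Prop where
  memLp : MemLp v (ENNReal.ofReal α) (timeMeasure T)
  continuousOn : ContinuousOn u (Icc 0 T)
  ae_eq : ∀ᵐ t ∂(timeMeasure T), ι (v t) = u t
  equation : HasGeneralizedDeriv T (fun t => toDual ι (u t)) (fun t => A t (v t) + b t)
  initial : u 0 = u₀

end Operator

end LocallyMonotone

/-! ### Duals of normed spaces: density, pointwise limits, separability -/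

open Filter Topology

/-! The forcing `b` is absorbed into `A` at the price of new data, so the equation reads u' =
A(t,u). Let q = α/(α-1).

Existence combines compactness with pseudomonotonicity. Along a V-bounded, weakly convergent
sequence the weights in (H2) stay bounded while the squared H-distance to the limit tends to 0,
since the embedding is compact. Hence at each fixed t the operator A(t,·) behaves on such sequences
like a monotone one: the energy pairing is asymptotically nonpositive (`eventually_apply_sub_le`),
and Minty's argument applies (`tendsto_apply_of_tendsto_apply_sub`).

Approximations x_n take values in finite-dimensional subspaces exhausting V. The Galerkin equation
is not solved exactly: an explicit Euler scheme is used, with a step so small that the squared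
increments are negligible. Coercivity bounds x_n in L^∞(H) and L^α(V), and growth bounds A(x_n) in
L^q(V*). Only the primitives ∫₀ᵗ⟨A(x_n),z⟩ are sent to a limit, for all t and z along one
subsequence, by equicontinuity. This gives x_n(t) ⇀ u(t) in H at every t, and Fatou with reflexivity
supplies the V-valued representative v in L^α (`exists_memLp_of_weak_limit`).

The limit is identified through ξ_n = ⟨A(x_n), x_n - v⟩. The energy inequality
`eventually_integral_apply_le`, proved by testing with Steklov averages of v, gives limsup
∫⟨A(x_n),v⟩ ≤ (‖u(T)‖² - ‖u₀‖²)/2. With the discrete energy inequality and weak lower semicontinuity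
of the norm at T, liminf ∫ξ_n ≥ 0. Pointwise in t, limsup ξ_n ≤ 0 with an integrable majorant. So
ξ_n → 0 in L¹ (`tendsto_integral_abs_pairing`), Minty's argument applies at almost every t along a
subsequence, and A(x_n) is dominated by an integrable function plus a multiple of |ξ_n|.

The same energy inequality, for u and for its time reversal, is an energy equality. It yields
continuity in H and, with Grönwall's lemma for the difference of two solutions, uniqueness. A du
Bois-Reymond argument (`HasGeneralizedDeriv.eq_add_integral`) turns the generalized derivative into
the integrated equation. -/

theorem Submodule.dense_of_forall_dual_eq_zero {F : Type*} [NormedAddCommGroup F] [NormedSpace ℝ F]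
    (S : Submodule ℝ F) (h : ∀ Φ : StrongDual ℝ F, (∀ x ∈ S, Φ x = 0) → Φ = 0) :
    Dense (S : Set F) := by
  intro x
  by_contra hx
  obtain ⟨Φ, u, hu, hux⟩ := geometric_hahn_banach_closed_point
    (S.topologicalClosure.convex) S.isClosed_topologicalClosure
    (show x ∉ (S.topologicalClosure : Set F) from hx)
  have hzero : ∀ a ∈ S, Φ a = 0 := by
    intro a ha
    by_contra hne
    have h1 := hu ((u / Φ a) • a) (S.le_topologicalClosure (S.smul_mem _ ha))
    rw [map_smul, smul_eq_mul, div_mul_cancel₀ _ hne] at h1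
    exact lt_irrefl _ h1
  have h0 := hu 0 (Submodule.zero_mem _)
  rw [h Φ hzero] at hux h0
  simp at hux h0
  linarith

/-- The uniform bound spreads convergence from `D` to every vector. It serves where weak compactness
would be the usual tool: in V**, in H, and for primitives in V*. -/
theorem StrongDual.exists_tendsto_of_dense {E : Type*} [NormedAddCommGroup E] [NormedSpace ℝ E]
    {ℓ : ℕ → StrongDual ℝ E} {R : ℝ} (hR : ∀ n, ‖ℓ n‖ ≤ R) {D : Set E} (hD : Dense D)
    (hlim : ∀ d ∈ D, ∃ c : ℝ, Tendsto (fun n => ℓ n d) atTop (𝓝 c)) :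
    ∃ Λ : StrongDual ℝ E, ‖Λ‖ ≤ R ∧ ∀ e, Tendsto (fun n => ℓ n e) atTop (𝓝 (Λ e)) := by
  have hR0 : 0 ≤ R := (norm_nonneg _).trans (hR 0)
  have hcauchy : ∀ e, ∃ c : ℝ, Tendsto (fun n => ℓ n e) atTop (𝓝 c) := by
    intro e
    apply cauchySeq_tendsto_of_complete
    rw [Metric.cauchySeq_iff]
    intro ε hε
    have hR1 : 0 < R + 1 := by linarith
    obtain ⟨d, hd, hde⟩ := hD.exists_dist_lt e (show 0 < ε / (4 * (R + 1)) by positivity)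
    obtain ⟨c, hc⟩ := hlim d hd
    obtain ⟨N, hN⟩ := Metric.cauchySeq_iff.1 hc.cauchySeq (ε / 2) (by linarith)
    refine ⟨N, fun m hm n hn => ?_⟩
    have h1 := hN m hm n hn
    have hb : ∀ k, |ℓ k (e - d)| ≤ ε / 4 := by
      intro k
      calc |ℓ k (e - d)| ≤ ‖ℓ k‖ * ‖e - d‖ := (ℓ k).le_opNorm _
        _ ≤ (R + 1) * (ε / (4 * (R + 1))) := by
            apply mul_le_mul ((hR k).trans (by linarith)) _ (norm_nonneg _) hR1.le
            rw [← dist_eq_norm]; exact hde.le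
        _ = ε / 4 := by field_simp
    have hm' := abs_le.1 (hb m)
    have hn' := abs_le.1 (hb n)
    rw [map_sub] at hm' hn'
    rw [Real.dist_eq] at h1 ⊢
    rw [abs_lt] at h1 ⊢
    constructor <;> linarith [h1.1, h1.2, hm'.1, hm'.2, hn'.1, hn'.2]
  choose g hg using hcauchy
  have hbdd : Bornology.IsBounded (range ℓ) := by
    rw [isBounded_iff_forall_norm_le]
    exact ⟨R, by rintro _ ⟨n, rfl⟩; exact hR n⟩
  have hgt : Tendsto (fun n x => ℓ n x) atTop (𝓝 g) := tendsto_pi_nhds.2 hg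
  refine ⟨ContinuousLinearMap.ofTendstoOfBoundedRange g ℓ hgt hbdd, ?_, hg⟩
  refine ContinuousLinearMap.opNorm_le_bound _ hR0 fun e => ?_
  exact le_of_tendsto (hg e).norm (Eventually.of_forall fun n => (ℓ n).le_of_opNorm_le (hR n) e)

/-- Almost norming vectors of a dense sequence of functionals span a dense subspace: if Φ vanishes
on all of them, then ‖Φ‖ ≤ 3‖Φ - ℓ_n‖ for every n. -/
theorem StrongDual.separableSpace_of_dual (V : Type*) [NormedAddCommGroup V] [NormedSpace ℝ V]
    [TopologicalSpace.SeparableSpace (StrongDual ℝ V)] : TopologicalSpace.SeparableSpace V := by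
  set ℓ := TopologicalSpace.denseSeq (StrongDual ℝ V)
  have hx : ∀ n, ∃ x : V, ‖x‖ ≤ 1 ∧ ‖ℓ n‖ / 2 ≤ ‖ℓ n x‖ := by
    intro n
    rcases eq_or_ne (ℓ n) 0 with h0 | h0
    · exact ⟨0, by simp, by simp [h0]⟩
    · obtain ⟨x, hx1, hx2⟩ := (ℓ n).exists_lt_apply_of_lt_opNorm
        (show ‖ℓ n‖ / 2 < ‖ℓ n‖ by have := norm_pos_iff.2 h0; linarith)
      exact ⟨x, hx1.le, hx2.le⟩
  choose x hx1 hx2 using hx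
  have hd : Dense ((Submodule.span ℝ (range x) : Submodule ℝ V) : Set V) := by
    apply Submodule.dense_of_forall_dual_eq_zero
    intro Φ hΦ
    have hΦx : ∀ n, Φ (x n) = 0 := fun n => hΦ _ (Submodule.subset_span (mem_range_self n))
    by_contra hne
    have hpos := norm_pos_iff.2 hne
    obtain ⟨n, hn⟩ := (TopologicalSpace.denseRange_denseSeq (StrongDual ℝ V)).exists_dist_lt Φ
      (show 0 < ‖Φ‖ / 4 by linarith)
    rw [dist_eq_norm] at hn
    have h1 : ‖ℓ n (x n)‖ ≤ ‖Φ - ℓ n‖ := by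
      have := (Φ - ℓ n).le_opNorm (x n)
      rw [sub_apply, hΦx, zero_sub, norm_neg] at this
      exact this.trans (mul_le_of_le_one_right (norm_nonneg _) (hx1 n))
    have h2 : ‖Φ‖ ≤ ‖Φ - ℓ n‖ + ‖ℓ n‖ := by simpa using norm_add_le (Φ - ℓ n) (ℓ n)
    have h3 := hx2 n
    change ‖Φ - ℓ n‖ < _ at hn
    linarith
  have hsep : TopologicalSpace.IsSeparable
      ((Submodule.span ℝ (range x) : Submodule ℝ V) : Set V) :=
    (countable_range x).isSeparable.span
  have := hsep.closure
  rw [hd.closure_eq] at this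
  exact TopologicalSpace.isSeparable_univ_iff.1 this

/-! ### The Gelfand triple -/

namespace LocallyMonotone

section Triple

variable {V H : Type*} [NormedAddCommGroup V] [NormedSpace ℝ V]
  [NormedAddCommGroup H] [InnerProductSpace ℝ H] {ι : V →L[ℝ] H}

@[simp] theorem toDual_apply (ι : V →L[ℝ] H) (h : H) (v : V) :
    toDual ι h v = inner ℝ h (ι v) := rfl

/-- The inclusion `H ⊆ V*` as a continuous linear map. -/
noncomputable def toDualCLM (ι : V →L[ℝ] H) : H →L[ℝ] StrongDual ℝ V :=
  LinearMap.mkContinuous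
    { toFun := toDual ι
      map_add' := fun x y => by ext v; simp [inner_add_left]
      map_smul' := fun c x => by ext v; simp [inner_smul_left] } ‖ι‖ fun h => by
    refine ContinuousLinearMap.opNorm_le_bound _ (by positivity) fun v => ?_
    calc ‖(toDual ι h) v‖ ≤ ‖h‖ * ‖ι v‖ := norm_inner_le_norm _ _
      _ ≤ ‖h‖ * (‖ι‖ * ‖v‖) := by gcongr; exact ι.le_opNorm v
      _ = ‖ι‖ * ‖h‖ * ‖v‖ := by ring

@[simp] theorem toDualCLM_apply (ι : V →L[ℝ] H) (h : H) : toDualCLM ι h = toDual ι h := rfl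

/-- By reflexivity a functional on V* that annihilates H is evaluation at some x in V; applied to
the element ι x of H it gives ‖ι x‖² = 0. -/
theorem IsGelfandTriple.denseRange_toDual (hι : IsGelfandTriple ι) :
    DenseRange (toDualCLM ι) := by
  have := Submodule.dense_of_forall_dual_eq_zero (LinearMap.range (toDualCLM ι).toLinearMap) ?_
  · exact this
  intro Φ hΦ
  obtain ⟨x, rfl⟩ := hι.reflexive Φ
  have h0 : ι x = 0 := by
    have := hΦ (toDualCLM ι (ι x)) ⟨_, rfl⟩
    rw [NormedSpace.dual_def] at this
    simpa using this
  rw [hι.injective (h0.trans (map_zero ι).symm), map_zero]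

theorem IsGelfandTriple.separableSpace_dual [TopologicalSpace.SeparableSpace H]
    (hι : IsGelfandTriple ι) : TopologicalSpace.SeparableSpace (StrongDual ℝ V) :=
  hι.denseRange_toDual.separableSpace (toDualCLM ι).continuous

/-- Separability passes from H to V*, where H is dense, and from V* to its predual V. -/
theorem IsGelfandTriple.separableSpace [TopologicalSpace.SeparableSpace H]
    (hι : IsGelfandTriple ι) : TopologicalSpace.SeparableSpace V :=
  have := hι.separableSpace_dual
  StrongDual.separableSpace_of_dual V

/-- A bounded sequence of `V` whose image converges weakly in `H` converges weakly in `V`. -/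
theorem IsGelfandTriple.exists_weak_limit (hι : IsGelfandTriple ι) {x : ℕ → V} {R : ℝ}
    (hR : ∀ n, ‖x n‖ ≤ R) {y : H}
    (hy : ∀ h, Tendsto (fun n => inner ℝ (ι (x n)) h) atTop (𝓝 (inner ℝ y h))) :
    ∃ x₀ : V, ι x₀ = y ∧ ‖x₀‖ ≤ R ∧
      ∀ ℓ : StrongDual ℝ V, Tendsto (fun n => ℓ (x n)) atTop (𝓝 (ℓ x₀)) := by
  -- The x_n are read as functionals on V*; they converge on the dense image of H, and the limit in
  -- V** is a point of V by reflexivity.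
  obtain ⟨Λ, hΛ, hlim⟩ := StrongDual.exists_tendsto_of_dense
    (ℓ := fun n => NormedSpace.inclusionInDoubleDual ℝ V (x n)) (R := R)
    (fun n => (NormedSpace.double_dual_bound ℝ V (x n)).trans (hR n))
    (D := range (toDualCLM ι)) hι.denseRange_toDual (by
      rintro _ ⟨h, rfl⟩
      refine ⟨inner ℝ y h, ?_⟩
      simpa [NormedSpace.dual_def, real_inner_comm] using hy h)
  obtain ⟨x₀, rfl⟩ := hι.reflexive Λ
  have hx0 : ∀ ℓ : StrongDual ℝ V, Tendsto (fun n => ℓ (x n)) atTop (𝓝 (ℓ x₀)) := by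
    simpa [NormedSpace.dual_def] using hlim
  refine ⟨x₀, ?_, ?_, hx0⟩
  · refine ext_inner_right ℝ fun h => ?_
    refine tendsto_nhds_unique ?_ (hy h)
    have := hx0 (toDualCLM ι h)
    simpa [real_inner_comm] using this
  · have : ‖NormedSpace.inclusionInDoubleDualLi ℝ (E := V) x₀‖ ≤ R := hΛ
    rwa [LinearIsometry.norm_map] at this

/-- For a compact embedding, the image sequence converges strongly. -/
theorem tendsto_of_compact (hcompact : IsCompactOperator ι) {x : ℕ → V} {R : ℝ}
    (hR : ∀ n, ‖x n‖ ≤ R) {y : H}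
    (hy : ∀ h, Tendsto (fun n => inner ℝ (ι (x n)) h) atTop (𝓝 (inner ℝ y h))) :
    Tendsto (fun n => ι (x n)) atTop (𝓝 y) := by
  refine tendsto_of_subseq_tendsto fun ns hns => ?_
  have hK := hcompact.isCompact_closure_image_closedBall (f := ι.toLinearMap) R
  obtain ⟨a, -, φ, hφ, ha⟩ := hK.tendsto_subseq (x := fun n => ι (x (ns n))) fun n =>
    subset_closure ⟨x (ns n), by simpa using hR (ns n), rfl⟩
  refine ⟨φ, ?_⟩
  suffices a = y by rw [← this]; exact ha
  refine ext_inner_right ℝ fun h => ?_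
  exact tendsto_nhds_unique (ha.inner tendsto_const_nhds)
    ((hy h).comp (hns.comp hφ.tendsto_atTop))

/-- The Galerkin projection `V* → S` onto a finite-dimensional subspace `S` of `V`. -/
theorem exists_galerkin_projection (hinj : Function.Injective ι) (S : Submodule ℝ V)
    [FiniteDimensional ℝ S] :
    ∃ P : StrongDual ℝ V →L[ℝ] V, (∀ w, P w ∈ S) ∧
      ∀ w, ∀ z ∈ S, inner ℝ (ι (P w)) (ι z) = w z := by
  -- B is the H-inner product on S. It is injective because ι is, hence bijective by dimension, and
  -- P sends w to the Riesz representative of its restriction to S.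
  let B : S →ₗ[ℝ] StrongDual ℝ S :=
    { toFun := fun x => (toDual ι (ι x)).comp S.subtypeL
      map_add' := fun x y => by ext v; simp [inner_add_left]
      map_smul' := fun c x => by ext v; simp [inner_smul_left] }
  have hB : Function.Injective B := by
    rw [injective_iff_map_eq_zero]
    intro x hx
    have : B x x = 0 := by rw [hx]; rfl
    have h0 : ι x = 0 := (inner_self_eq_zero (𝕜 := ℝ)).1 this
    exact Subtype.ext (hinj (h0.trans (map_zero ι).symm))
  have hdim : Module.finrank ℝ S = Module.finrank ℝ (StrongDual ℝ S) := by
    rw [← (LinearMap.toContinuousLinearMap (𝕜 := ℝ) (E := S) (F' := ℝ)).finrank_eq]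
    exact (Subspace.dual_finrank_eq).symm
  have : FiniteDimensional ℝ (StrongDual ℝ S) :=
    (LinearMap.toContinuousLinearMap (𝕜 := ℝ) (E := S) (F' := ℝ)).finiteDimensional
  let e := LinearMap.linearEquivOfInjective B hB hdim
  let P : StrongDual ℝ V →L[ℝ] V := S.subtypeL.comp
    ((LinearMap.toContinuousLinearMap e.symm.toLinearMap).comp
      ((ContinuousLinearMap.compL ℝ S V ℝ).flip S.subtypeL))
  refine ⟨P, fun w => Subtype.coe_prop _, fun w z hz => ?_⟩
  have h1 : B (e.symm (w.comp S.subtypeL)) = w.comp S.subtypeL := e.apply_symm_apply _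
  exact DFunLike.congr_fun h1 (⟨z, hz⟩ : S)

end Triple

end LocallyMonotone

open scoped ENNReal

/-! ### Steklov averages -/

section Steklov

variable {E F : Type*} [NormedAddCommGroup E] [NormedAddCommGroup F]

theorem eLpNorm_ofReal_eq_lintegral {α : Type*} [MeasurableSpace α] {μ : Measure α} {q : ℝ}
    (hq : 0 < q) (f : α → E) :
    eLpNorm f (ENNReal.ofReal q) μ = (∫⁻ x, ‖f x‖ₑ ^ q ∂μ) ^ (1 / q) := by
  rw [eLpNorm_eq_lintegral_rpow_enorm_toReal (by simpa using hq) ENNReal.ofReal_ne_top,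
    ENNReal.toReal_ofReal hq.le]

theorem lintegral_enorm_mul_enorm_le {α : Type*} [MeasurableSpace α] {μ : Measure α} {p q : ℝ}
    (hpq : p.HolderConjugate q) {f : α → E} {g : α → F} (hf : AEStronglyMeasurable f μ)
    (hg : AEStronglyMeasurable g μ) :
    ∫⁻ x, ‖f x‖ₑ * ‖g x‖ₑ ∂μ ≤
      eLpNorm f (ENNReal.ofReal q) μ * eLpNorm g (ENNReal.ofReal p) μ := by
  rw [eLpNorm_ofReal_eq_lintegral hpq.symm.pos, eLpNorm_ofReal_eq_lintegral hpq.pos]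
  exact ENNReal.lintegral_mul_le_Lp_mul_Lq μ hpq.symm hf.enorm hg.enorm

theorem lintegral_Ioc_sub_eq (g : ℝ → ℝ≥0∞) (s h : ℝ) :
    ∫⁻ t in Ioc (s - h) s, g t = ∫⁻ r in Ico 0 h, g (s - r) := by
  rw [← lintegral_indicator measurableSet_Ioc, ← lintegral_indicator measurableSet_Ico,
    ← lintegral_sub_left_eq_self _ s]
  congr 1
  ext r
  by_cases hr : r ∈ Ico 0 h
  · rw [indicator_of_mem hr, indicator_of_mem]
    constructor <;> linarith [hr.1, hr.2]
  · rw [indicator_of_notMem hr, indicator_of_notMem]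
    rintro ⟨h1, h2⟩
    exact hr ⟨by linarith, by linarith⟩

/-- Substitute t = s - r, exchange the integrals, and apply Hölder for each shift r in [0,h). After
division by h, averaging does not increase the Hölder bound. -/
theorem lintegral_enorm_mul_lintegral_Ioc_le {p q : ℝ} (hpq : p.HolderConjugate q)
    {f : ℝ → E} {g : ℝ → F} (hf : AEStronglyMeasurable f) (hg : AEStronglyMeasurable g)
    (h : ℝ) :
    ∫⁻ s, ‖f s‖ₑ * ∫⁻ t in Ioc (s - h) s, ‖g t‖ₑ ≤
      ENNReal.ofReal h *
        (eLpNorm f (ENNReal.ofReal q) volume * eLpNorm g (ENNReal.ofReal p) volume) := by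
  have hgm : AEMeasurable (fun z : ℝ × ℝ => ‖g (z.1 - z.2)‖ₑ)
      (volume.prod (volume.restrict (Ico 0 h))) := by
    have : AEStronglyMeasurable (g ∘ fun z : ℝ × ℝ => z.1 - z.2)
        (volume.prod (volume.restrict (Ico 0 h))) :=
      hg.comp_quasiMeasurePreserving (quasiMeasurePreserving_sub _ _)
    exact this.enorm
  have hfm : AEMeasurable (fun z : ℝ × ℝ => ‖f z.1‖ₑ)
      (volume.prod (volume.restrict (Ico 0 h))) := hf.enorm.comp_fst
  calc ∫⁻ s, ‖f s‖ₑ * ∫⁻ t in Ioc (s - h) s, ‖g t‖ₑ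
      = ∫⁻ s, ∫⁻ r in Ico 0 h, ‖f s‖ₑ * ‖g (s - r)‖ₑ := by
        refine lintegral_congr fun s => ?_
        rw [lintegral_Ioc_sub_eq, lintegral_const_mul' _ _ enorm_ne_top]
    _ = ∫⁻ r in Ico 0 h, ∫⁻ s, ‖f s‖ₑ * ‖g (s - r)‖ₑ :=
        lintegral_lintegral_swap (hfm.mul hgm)
    _ ≤ ∫⁻ r in Ico 0 h,
          eLpNorm f (ENNReal.ofReal q) volume * eLpNorm g (ENNReal.ofReal p) volume := by
        refine lintegral_mono fun r => ?_
        have hmp : MeasurePreserving (fun s : ℝ => s - r) volume volume :=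
          measurePreserving_sub_right volume r
        have := lintegral_enorm_mul_enorm_le hpq hf (hg.comp_measurePreserving hmp)
        rwa [eLpNorm_comp_measurePreserving hg hmp] at this
    _ = _ := by
        rw [lintegral_const, Measure.restrict_apply_univ, Real.volume_Ico, sub_zero, mul_comm]

variable [NormedSpace ℝ E]

theorem integrable_apply_of_memLp {α : Type*} [MeasurableSpace α] {μ : Measure α} {p q : ℝ}
    (hpq : p.HolderConjugate q) {w : α → StrongDual ℝ E} {v : α → E}
    (hw : MemLp w (ENNReal.ofReal q) μ) (hv : MemLp v (ENNReal.ofReal p) μ) :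
    Integrable (fun x => w x (v x)) μ := by
  refine ⟨(ContinuousLinearMap.id ℝ (StrongDual ℝ E)).aestronglyMeasurable_comp₂ hw.1 hv.1, ?_⟩
  refine lt_of_le_of_lt ?_ (ENNReal.mul_lt_top hw.2 hv.2)
  refine le_trans (lintegral_mono fun x => ?_) (lintegral_enorm_mul_enorm_le hpq hw.1 hv.1)
  exact (w x).le_opENorm (v x)

/-- This integrability licenses Fubini on the strip s - h < t ≤ s; plain integrability of both
factors is enough because the variables are separate. -/
theorem integrable_prod_apply_indicator {w : ℝ → StrongDual ℝ E} {v : ℝ → E} (hw : Integrable w)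
    (hv : Integrable v) (h : ℝ) :
    Integrable (fun z : ℝ × ℝ =>
      {z : ℝ × ℝ | z.1 - h < z.2 ∧ z.2 ≤ z.1}.indicator (fun z => w z.1 (v z.2)) z)
      (volume.prod volume) := by
  refine Integrable.indicator ?_ ?_
  · refine Integrable.op_fst_snd (op := fun (a : StrongDual ℝ E) (b : E) => a b) ?_
      ⟨1, fun x y => by rw [one_mul]; exact x.le_opNorm y⟩ hw hv
    exact isBoundedBilinearMap_apply.continuous
  · exact (measurableSet_lt (measurable_fst.sub_const h) measurable_snd).inter
      (measurableSet_le measurable_snd measurable_fst)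

variable [CompleteSpace E]

theorem integral_indicator_eq_apply_integral_Ioc {w : ℝ → StrongDual ℝ E} {v : ℝ → E}
    (hv : Integrable v) (h s : ℝ) :
    ∫ t, {z : ℝ × ℝ | z.1 - h < z.2 ∧ z.2 ≤ z.1}.indicator (fun z => w z.1 (v z.2)) (s, t) =
      w s (∫ t in Ioc (s - h) s, v t) := by
  rw [← (w s).integral_comp_comm hv.integrableOn, ← integral_indicator measurableSet_Ioc]
  congr 1

theorem integrable_apply_integral_Ioc {w : ℝ → StrongDual ℝ E} {v : ℝ → E} (hw : Integrable w)
    (hv : Integrable v) (h : ℝ) :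
    Integrable fun s => w s (∫ t in Ioc (s - h) s, v t) := by
  refine (integrable_prod_apply_indicator hw hv h).integral_prod_left.congr ?_
  exact Eventually.of_forall fun s => integral_indicator_eq_apply_integral_Ioc hv h s

omit [CompleteSpace E] in
theorem integral_indicator_eq_integral_Ico (w : ℝ → StrongDual ℝ E) (v : ℝ → E) (h t : ℝ) :
    ∫ s, {z : ℝ × ℝ | z.1 - h < z.2 ∧ z.2 ≤ z.1}.indicator (fun z => w z.1 (v z.2)) (s, t) =
      ∫ s in Ico t (t + h), w s (v t) := by
  rw [← integral_indicator measurableSet_Ico]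
  congr 1
  ext s
  by_cases hs : s ∈ Ico t (t + h)
  · rw [indicator_of_mem hs, indicator_of_mem]
    constructor
    · change s - h < t; linarith [hs.2]
    · exact hs.1
  · rw [indicator_of_notMem hs, indicator_of_notMem]
    rintro ⟨h1, h2⟩
    change s - h < t at h1
    exact hs ⟨h2, by linarith⟩

omit [CompleteSpace E] in
theorem integrable_integral_Ico_apply {w : ℝ → StrongDual ℝ E} {v : ℝ → E} (hw : Integrable w)
    (hv : Integrable v) (h : ℝ) :
    Integrable fun t => ∫ s in Ico t (t + h), w s (v t) := by
  refine (integrable_prod_apply_indicator hw hv h).integral_prod_right.congr ?_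
  exact Eventually.of_forall fun t => integral_indicator_eq_integral_Ico w v h t

/-- Averaging v backwards is dual to averaging w forwards. The average is thereby moved onto w,
whose primitive is the quantity under control. -/
theorem integral_apply_integral_Ioc {w : ℝ → StrongDual ℝ E} {v : ℝ → E} (hw : Integrable w)
    (hv : Integrable v) (h : ℝ) :
    ∫ s, w s (∫ t in Ioc (s - h) s, v t) = ∫ t, ∫ s in Ico t (t + h), w s (v t) := by
  simp_rw [← integral_indicator_eq_apply_integral_Ioc (w := w) hv h]
  rw [integral_integral_swap (integrable_prod_apply_indicator hw hv h)]
  simp_rw [← integral_indicator_eq_integral_Ico w v h]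

/-- Steklov averages approximate `v` in `L^p`, tested against a bounded family of `L^q`. -/
theorem exists_forall_integral_sub_steklov_le {p q : ℝ} (hpq : p.HolderConjugate q) {v : ℝ → E}
    (hv : MemLp v (ENNReal.ofReal p)) (hv1 : Integrable v) {M M₁ : ℝ≥0∞} (hM : M ≠ ⊤)
    (hM₁ : M₁ ≠ ⊤) {ε : ℝ} (hε : 0 < ε) :
    ∃ h₀ > 0, ∀ h, 0 < h → h < h₀ → ∀ w : ℝ → StrongDual ℝ E, AEStronglyMeasurable w →
      eLpNorm w (ENNReal.ofReal q) volume ≤ M → ∫⁻ s, ‖w s‖ₑ ≤ M₁ →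
      |(∫ s, w s (v s)) - h⁻¹ * ∫ s, w s (∫ t in Ioc (s - h) s, v t)| ≤ ε := by
  -- Three errors arise: v - φ itself and its average, each costing M η, and the oscillation of φ,
  -- costing M₁ η.
  obtain ⟨η, hη, hηM⟩ : ∃ η : ℝ, 0 < η ∧
      2 * (M * ENNReal.ofReal η) + M₁ * ENNReal.ofReal η ≤ ENNReal.ofReal ε := by
    obtain ⟨m, hm, rfl⟩ : ∃ m : ℝ, 0 ≤ m ∧ M = ENNReal.ofReal m :=
      ⟨M.toReal, ENNReal.toReal_nonneg, (ENNReal.ofReal_toReal hM).symm⟩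
    obtain ⟨m₁, hm₁, rfl⟩ : ∃ m : ℝ, 0 ≤ m ∧ M₁ = ENNReal.ofReal m :=
      ⟨M₁.toReal, ENNReal.toReal_nonneg, (ENNReal.ofReal_toReal hM₁).symm⟩
    refine ⟨ε / (2 * m + m₁ + 1), by positivity, ?_⟩
    set η := ε / (2 * m + m₁ + 1) with hηdef
    have hη0 : 0 < η := by positivity
    rw [show (2 : ℝ≥0∞) = ENNReal.ofReal 2 by simp]
    rw [← ENNReal.ofReal_mul (by positivity), ← ENNReal.ofReal_mul (by positivity),
      ← ENNReal.ofReal_mul (by positivity), ← ENNReal.ofReal_add (by positivity) (by positivity)]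
    apply ENNReal.ofReal_le_ofReal
    have : η * (2 * m + m₁ + 1) = ε := by
      rw [hηdef]; field_simp
    nlinarith
  -- The threshold h₀ is the modulus of uniform continuity of φ, so it depends on the family of w
  -- only through M and M₁.
  obtain ⟨φ, hφc, hφv, hφ, hφp⟩ := hv.exists_hasCompactSupport_eLpNorm_sub_le
    ENNReal.ofReal_ne_top (ε := ENNReal.ofReal η) (by simpa using hη)
  obtain ⟨h₀, hh₀, huc⟩ := Metric.uniformContinuous_iff.1
    (hφc.uniformContinuous_of_continuous hφ) η hη
  refine ⟨h₀, hh₀, fun h hh hhh₀ w hw hwM hwM₁ => ?_⟩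
  have hw1 : Integrable w := ⟨hw, hwM₁.trans_lt hM₁.lt_top⟩
  have hwq : MemLp w (ENNReal.ofReal q) := ⟨hw, hwM.trans_lt hM.lt_top⟩
  have hφi : Integrable φ := hφ.integrable_of_hasCompactSupport hφc
  have hkey : ∀ s, ‖v s - h⁻¹ • ∫ t in Ioc (s - h) s, v t‖ₑ ≤
      ‖(v - φ) s‖ₑ + (ENNReal.ofReal η +
        ENNReal.ofReal h⁻¹ * ∫⁻ t in Ioc (s - h) s, ‖(v - φ) t‖ₑ) := by
    intro s
    have hcard : (volume (Ioc (s - h) s)) = ENNReal.ofReal h := by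
      rw [Real.volume_Ioc]; congr 1; ring
    have e1 : v s - h⁻¹ • ∫ t in Ioc (s - h) s, v t = (v - φ) s +
        (h⁻¹ • (∫ t in Ioc (s - h) s, (φ s - φ t)) -
          h⁻¹ • ∫ t in Ioc (s - h) s, (v - φ) t) := by
      have : ∫ t in Ioc (s - h) s, (v - φ) t =
          (∫ t in Ioc (s - h) s, v t) - ∫ t in Ioc (s - h) s, φ t :=
        integral_sub hv1.integrableOn hφi.integrableOn
      have hconst : IntegrableOn (fun _ : ℝ => φ s) (Ioc (s - h) s) :=
        integrableOn_const (by simp)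
      rw [this, integral_sub hconst hφi.integrableOn]
      rw [setIntegral_const, measureReal_def, hcard, ENNReal.toReal_ofReal hh.le, smul_sub,
        smul_sub, smul_smul, inv_mul_cancel₀ hh.ne', one_smul, Pi.sub_apply]
      abel
    rw [e1]
    refine (enorm_add_le _ _).trans (add_le_add le_rfl ((enorm_sub_le).trans (add_le_add ?_ ?_)))
    · rw [enorm_smul, Real.enorm_eq_ofReal (by positivity)]
      calc ENNReal.ofReal h⁻¹ * ‖∫ t in Ioc (s - h) s, (φ s - φ t)‖ₑ
          ≤ ENNReal.ofReal h⁻¹ * ∫⁻ t in Ioc (s - h) s, ENNReal.ofReal η := by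
            gcongr
            refine (enorm_integral_le_lintegral_enorm _).trans ?_
            refine setLIntegral_mono measurable_const fun t ht => ?_
            rw [← ofReal_norm, ← dist_eq_norm]
            apply ENNReal.ofReal_le_ofReal (huc _).le
            rw [Real.dist_eq, abs_lt]
            constructor <;> linarith [ht.1, ht.2]
        _ = ENNReal.ofReal η := by
            rw [setLIntegral_const, hcard, mul_comm, mul_assoc, ← ENNReal.ofReal_mul hh.le,
              mul_inv_cancel₀ hh.ne', ENNReal.ofReal_one, mul_one]
    · rw [enorm_smul, Real.enorm_eq_ofReal (by positivity)]
      gcongr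
      exact enorm_integral_le_lintegral_enorm _
  have hi1 : Integrable fun s => w s (v s) := integrable_apply_of_memLp hpq hwq hv
  have hi2 := (integrable_apply_integral_Ioc hw1 hv1 h).const_mul h⁻¹
  have e2 : (∫ s, w s (v s)) - h⁻¹ * ∫ s, w s (∫ t in Ioc (s - h) s, v t) =
      ∫ s, w s (v s - h⁻¹ • ∫ t in Ioc (s - h) s, v t) := by
    rw [← integral_const_mul, ← integral_sub hi1 hi2]
    congr 1
    ext s
    rw [map_sub, map_smul, smul_eq_mul]
  rw [e2, ← Real.norm_eq_abs, ← ENNReal.ofReal_le_ofReal_iff hε.le, ofReal_norm]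
  refine (enorm_integral_le_lintegral_enorm _).trans (le_trans ?_ hηM)
  have hvφ : AEStronglyMeasurable (v - φ) := hv.1.sub hφ.aestronglyMeasurable
  calc ∫⁻ s, ‖w s (v s - h⁻¹ • ∫ t in Ioc (s - h) s, v t)‖ₑ
      ≤ ∫⁻ s, (‖w s‖ₑ * ‖(v - φ) s‖ₑ + (‖w s‖ₑ * ENNReal.ofReal η +
        ENNReal.ofReal h⁻¹ * (‖w s‖ₑ * ∫⁻ t in Ioc (s - h) s, ‖(v - φ) t‖ₑ))) := by
        refine lintegral_mono fun s => ?_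
        refine ((w s).le_opENorm _).trans ?_
        refine (mul_le_mul_right (hkey s) _).trans (le_of_eq ?_)
        ring
    _ = (∫⁻ s, ‖w s‖ₑ * ‖(v - φ) s‖ₑ) + ((∫⁻ s, ‖w s‖ₑ * ENNReal.ofReal η) +
        ENNReal.ofReal h⁻¹ * ∫⁻ s, (‖w s‖ₑ * ∫⁻ t in Ioc (s - h) s, ‖(v - φ) t‖ₑ)) := by
        have hm : AEMeasurable fun s => ‖w s‖ₑ * ‖(v - φ) s‖ₑ := hw.enorm.mul hvφ.enorm
        rw [lintegral_add_left' hm, lintegral_add_left' (hw.enorm.mul_const _), lintegral_const_mul' _ _ ENNReal.ofReal_ne_top]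
    _ ≤ M * ENNReal.ofReal η + (M₁ * ENNReal.ofReal η + ENNReal.ofReal h⁻¹ *
        (ENNReal.ofReal h * (M * ENNReal.ofReal η))) := by
        refine add_le_add ?_ (add_le_add ?_ ?_)
        · exact (lintegral_enorm_mul_enorm_le hpq hw hvφ).trans (mul_le_mul' hwM hφv)
        · rw [lintegral_mul_const' _ _ ENNReal.ofReal_ne_top]
          gcongr
        · gcongr
          refine (lintegral_enorm_mul_lintegral_Ioc_le hpq hw hvφ h).trans ?_
          gcongr
    _ = 2 * (M * ENNReal.ofReal η) + M₁ * ENNReal.ofReal η := by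
        rw [← mul_assoc (ENNReal.ofReal h⁻¹), ← ENNReal.ofReal_mul (by positivity),
          inv_mul_cancel₀ hh.ne', ENNReal.ofReal_one, one_mul]
        ring

end Steklov

/-! ### Integration over [0,T] -/

namespace LocallyMonotone

instance (T : ℝ) : IsFiniteMeasure (timeMeasure T) := by
  unfold timeMeasure; infer_instance

theorem timeMeasure_eq_Ioc (T : ℝ) : timeMeasure T = volume.restrict (Ioc 0 T) :=
  Measure.restrict_congr_set Ioc_ae_eq_Icc.symm

theorem integral_timeMeasure {G : Type*} [NormedAddCommGroup G] [NormedSpace ℝ G] {T : ℝ}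
    (hT : 0 ≤ T) (f : ℝ → G) : ∫ t, f t ∂timeMeasure T = ∫ t in (0 : ℝ)..T, f t := by
  rw [timeMeasure_eq_Ioc, intervalIntegral.integral_of_le hT]

theorem intervalIntegrable_of_timeMeasure {G : Type*} [NormedAddCommGroup G] {T : ℝ}
    {f : ℝ → G} (hf : Integrable f (timeMeasure T)) {s t : ℝ} (hs : s ∈ Icc 0 T)
    (ht : t ∈ Icc 0 T) : IntervalIntegrable f volume s t := by
  have hf' : IntegrableOn f (Icc 0 T) := hf
  rw [intervalIntegrable_iff]
  exact hf'.mono_set (uIoc_subset_uIcc.trans (uIcc_subset_Icc hs ht))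

theorem integrable_indicator_Icc {F : Type*} [NormedAddCommGroup F] {T : ℝ} {g : ℝ → F}
    (hg : Integrable g (timeMeasure T)) : Integrable ((Icc 0 T).indicator g) :=
  (integrable_indicator_iff measurableSet_Icc).2 hg

theorem eLpNorm_indicator_Icc {F : Type*} [NormedAddCommGroup F] (T : ℝ) (g : ℝ → F)
    (q : ℝ≥0∞) : eLpNorm ((Icc 0 T).indicator g) q volume = eLpNorm g q (timeMeasure T) :=
  eLpNorm_indicator_eq_eLpNorm_restrict measurableSet_Icc

theorem lintegral_enorm_indicator_Icc {F : Type*} [NormedAddCommGroup F] (T : ℝ) (g : ℝ → F) :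
    ∫⁻ s, ‖(Icc 0 T).indicator g s‖ₑ = ∫⁻ s, ‖g s‖ₑ ∂timeMeasure T := by
  simp_rw [enorm_indicator_eq_indicator_enorm]
  exact lintegral_indicator measurableSet_Icc _

/-! ### The energy inequality for weak limits -/

section Energy

variable {V H : Type*} [NormedAddCommGroup V] [NormedSpace ℝ V]
  [NormedAddCommGroup H] [InnerProductSpace ℝ H] {ι : V →L[ℝ] H}

theorem lintegral_enorm_Ioc_le {E : Type*} [NormedAddCommGroup E] {p q T : ℝ}
    (hpq : p.HolderConjugate q) {w : ℝ → E}
    (hw : AEStronglyMeasurable w (timeMeasure T)) {M : ℝ≥0∞}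
    (hM : eLpNorm w (ENNReal.ofReal q) (timeMeasure T) ≤ M) {s t : ℝ} (hs : 0 ≤ s) (ht : t ≤ T) :
    ∫⁻ x in Ioc s t, ‖w x‖ₑ ≤ M * ENNReal.ofReal (t - s) ^ (1 / p) := by
  have hle : volume.restrict (Ioc s t) ≤ timeMeasure T :=
    Measure.restrict_mono
      (show Ioc s t ⊆ Icc 0 T from fun x hx => ⟨hs.trans hx.1.le, hx.2.trans ht⟩) le_rfl
  have h1 := lintegral_enorm_mul_enorm_le (g := fun _ : ℝ => (1 : ℝ)) hpq
    (hw.mono_measure hle) aestronglyMeasurable_const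
  simp only [enorm_one, mul_one] at h1
  refine h1.trans (mul_le_mul' ((eLpNorm_mono_measure w hle).trans hM) (le_of_eq ?_))
  rw [eLpNorm_ofReal_eq_lintegral hpq.pos]
  simp

/-- Hölder against the constant 1. This is the equicontinuity in time of primitives of an
L^q-bounded family. -/
theorem norm_integral_apply_le {p q T : ℝ}
    (hpq : p.HolderConjugate q) {w : ℝ → StrongDual ℝ V}
    (hw : AEStronglyMeasurable w (timeMeasure T)) {M : ℝ≥0∞} (hMtop : M ≠ ⊤)
    (hM : eLpNorm w (ENNReal.ofReal q) (timeMeasure T) ≤ M) {s t : ℝ} (hs : 0 ≤ s) (hst : s ≤ t)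
    (ht : t ≤ T) (z : V) :
    |∫ x in s..t, w x z| ≤ ‖z‖ * (M.toReal * (t - s) ^ (1 / p)) := by
  have h1 := lintegral_enorm_Ioc_le hpq hw hM hs ht
  have hts : 0 ≤ t - s := sub_nonneg.2 hst
  rw [intervalIntegral.integral_of_le hst, ← Real.norm_eq_abs]
  rw [← ENNReal.ofReal_le_ofReal_iff (by positivity), ofReal_norm]
  calc ‖∫ x in Ioc s t, w x z‖ₑ ≤ ∫⁻ x in Ioc s t, ‖w x z‖ₑ := enorm_integral_le_lintegral_enorm _
    _ ≤ ∫⁻ x in Ioc s t, ‖w x‖ₑ * ‖z‖ₑ := lintegral_mono fun x => (w x).le_opENorm z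
    _ = (∫⁻ x in Ioc s t, ‖w x‖ₑ) * ‖z‖ₑ := lintegral_mul_const' _ _ enorm_ne_top
    _ ≤ (M * ENNReal.ofReal (t - s) ^ (1 / p)) * ‖z‖ₑ := by gcongr
    _ = _ := by
      rw [ENNReal.ofReal_mul (norm_nonneg _), ENNReal.ofReal_mul ENNReal.toReal_nonneg,
        ENNReal.ofReal_toReal hMtop, ofReal_norm, mul_comm,
        ENNReal.ofReal_rpow_of_nonneg hts (by have := hpq.pos; positivity)]

theorem integrable_of_eLpNorm_le {E : Type*} [NormedAddCommGroup E] {q T : ℝ} (hq : 1 ≤ q)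
    {w : ℝ → E} (hw : MemLp w (ENNReal.ofReal q) (timeMeasure T)) :
    Integrable w (timeMeasure T) :=
  hw.integrable (by simpa using hq)

/-- Hölder continuity in time of weak limits of primitives. -/
theorem abs_inner_sub_le {p q T : ℝ} (hpq : p.HolderConjugate q) {w : ℕ → ℝ → StrongDual ℝ V}
    {M : ℝ≥0∞} (hMtop : M ≠ ⊤) (hw : ∀ n, AEStronglyMeasurable (w n) (timeMeasure T))
    (hM : ∀ n, eLpNorm (w n) (ENNReal.ofReal q) (timeMeasure T) ≤ M) {u : ℝ → H}
    (hconv : ∀ t ∈ Icc 0 T, ∀ z, Tendsto (fun n => ∫ s in (0 : ℝ)..t, w n s z) atTop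
      (𝓝 (inner ℝ (u t - u 0) (ι z)))) {s t : ℝ} (hs : 0 ≤ s) (hst : s ≤ t)
    (ht : t ≤ T) (z : V) :
    |inner ℝ (u t - u s) (ι z)| ≤ ‖z‖ * (M.toReal * (t - s) ^ (1 / p)) := by
  have hs' : s ∈ Icc 0 T := ⟨hs, hst.trans ht⟩
  have ht' : t ∈ Icc 0 T := ⟨hs.trans hst, ht⟩
  have h1 := ((hconv t ht' z).sub (hconv s hs' z)).abs
  rw [← inner_sub_left, sub_sub_sub_cancel_right] at h1
  refine le_of_tendsto h1 (Eventually.of_forall fun n => ?_)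
  have hi : Integrable (fun s => w n s z) (timeMeasure T) :=
    ((integrable_of_eLpNorm_le hpq.symm.lt.le ⟨hw n, (hM n).trans_lt hMtop.lt_top⟩).apply_continuousLinearMap z)
  have h0 : (0 : ℝ) ∈ Icc 0 T := ⟨le_rfl, ht'.1.trans ht⟩
  rw [intervalIntegral.integral_interval_sub_left (intervalIntegrable_of_timeMeasure hi h0 ht')
    (intervalIntegrable_of_timeMeasure hi h0 hs')]
  exact norm_integral_apply_le hpq (hw n) hMtop (hM n) hs hst ht z

theorem tendsto_holder_modulus {p : ℝ} (hp : 0 < p) (a M s : ℝ) :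
    Tendsto (fun t => a * (M * |t - s| ^ (1 / p))) (𝓝 s) (𝓝 0) := by
  have h1 : ContinuousAt (fun t : ℝ => a * (M * |t - s| ^ (1 / p))) s := by
    refine continuousAt_const.mul (continuousAt_const.mul ?_)
    exact ContinuousAt.rpow_const (by fun_prop) (Or.inr (by positivity))
  have h2 := h1.tendsto
  simpa [Real.zero_rpow (inv_ne_zero hp.ne')] using h2

/-- Convexity of ‖·‖²/2: an increment paired with its starting point is at most the increment of the
energy. -/
theorem inner_sub_le_half (x y : H) : inner ℝ (y - x) x ≤ (‖y‖ ^ 2 - ‖x‖ ^ 2) / 2 := by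
  have h := norm_sub_sq_real y x
  have h2 := sq_nonneg ‖y - x‖
  rw [inner_sub_left, real_inner_self_eq_norm_sq]
  linarith

set_option maxHeartbeats 1000000 in
/-- The energy inequality, for a sequence of right-hand sides whose primitives converge weakly. -/
theorem eventually_integral_apply_le [CompleteSpace V] {p q T R : ℝ} (hpq : p.HolderConjugate q)
    (hT : 0 < T) {v : ℝ → V} (hv : MemLp v (ENNReal.ofReal p) (timeMeasure T))
    {w : ℕ → ℝ → StrongDual ℝ V} {M : ℝ≥0∞} (hMtop : M ≠ ⊤)
    (hw : ∀ n, AEStronglyMeasurable (w n) (timeMeasure T))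
    (hM : ∀ n, eLpNorm (w n) (ENNReal.ofReal q) (timeMeasure T) ≤ M) {u : ℝ → H}
    (hconv : ∀ t ∈ Icc 0 T, ∀ z, Tendsto (fun n => ∫ s in (0 : ℝ)..t, w n s z) atTop
      (𝓝 (inner ℝ (u t - u 0) (ι z))))
    (hR : ∀ t ∈ Icc 0 T, ‖u t‖ ≤ R) (huv : ∀ᵐ t ∂timeMeasure T, ι (v t) = u t)
    (hd : DenseRange ι) {ε : ℝ} (hε : 0 < ε) :
    ∀ᶠ n in atTop, ∫ t, w n t (v t) ∂timeMeasure T ≤ (‖u T‖ ^ 2 - ‖u 0‖ ^ 2) / 2 + ε := by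
  have hT0 : (0 : ℝ) ∈ Icc 0 T := ⟨le_rfl, hT.le⟩
  have hTT : T ∈ Icc 0 T := ⟨hT.le, le_rfl⟩
  -- lower semicontinuity of the norm at time zero
  obtain ⟨h₂, hh₂, hlsc⟩ : ∃ h₂ > 0, ∀ t, 0 ≤ t → t ≤ T → t < h₂ →
      ‖u 0‖ ^ 2 - ε ≤ ‖u t‖ ^ 2 := by
    obtain ⟨z, hz⟩ := hd.exists_dist_lt (u 0) (show 0 < √(ε / 2) by positivity)
    obtain ⟨h₂, hh₂, hmod⟩ := Metric.tendsto_nhds_nhds.1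
      (tendsto_holder_modulus hpq.pos ‖z‖ M.toReal 0) (ε / 4) (by linarith)
    refine ⟨h₂, hh₂, fun t ht htT hth => ?_⟩
    have h1 := hmod (show dist t 0 < h₂ by rwa [Real.dist_eq, sub_zero, abs_of_nonneg ht])
    have h2 := abs_inner_sub_le hpq hMtop hw hM hconv le_rfl ht htT z
    rw [Real.dist_eq, sub_zero, sub_zero, abs_of_nonneg ht] at h1
    rw [sub_zero] at h2
    have h3 := (h2.trans (le_abs_self _)).trans_lt h1
    have h4 := (abs_lt.1 h3).1
    have h5 : ‖u 0 - ι z‖ ^ 2 ≤ ε / 2 := by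
      rw [dist_eq_norm] at hz
      calc ‖u 0 - ι z‖ ^ 2 ≤ √(ε / 2) ^ 2 := by gcongr
        _ = ε / 2 := Real.sq_sqrt (by positivity)
    have h6 := norm_sub_sq_real (u 0) (ι z)
    have h7 := norm_sub_sq_real (u t) (ι z)
    have h8 := sq_nonneg ‖u t - ι z‖
    rw [inner_sub_left] at h4
    linarith
  -- Extension by zero lets the averages run past the ends of [0,T].
  set W : ℕ → ℝ → StrongDual ℝ V := fun n => (Icc 0 T).indicator (w n) with hWdef
  set v' : ℝ → V := (Icc 0 T).indicator v with hv'def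
  have hv'p : MemLp v' (ENNReal.ofReal p) volume :=
    (memLp_indicator_iff_restrict measurableSet_Icc).2 hv
  have hv1 : Integrable v (timeMeasure T) := integrable_of_eLpNorm_le hpq.lt.le hv
  have hv'1 : Integrable v' := (integrable_indicator_iff measurableSet_Icc).2 hv1
  have hwmem : ∀ n, MemLp (w n) (ENNReal.ofReal q) (timeMeasure T) :=
    fun n => ⟨hw n, (hM n).trans_lt hMtop.lt_top⟩
  have hw1 : ∀ n, Integrable (w n) (timeMeasure T) :=
    fun n => integrable_of_eLpNorm_le hpq.symm.lt.le (hwmem n)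
  have hW1 : ∀ n, Integrable (W n) := fun n => integrable_indicator_Icc (hw1 n)
  have hWM : ∀ n, eLpNorm (W n) (ENNReal.ofReal q) volume ≤ M := fun n =>
    (eLpNorm_indicator_Icc T (w n) _).trans_le (hM n)
  set M₁ : ℝ≥0∞ := M * ENNReal.ofReal (T - 0) ^ (1 / p) with hM₁def
  have hM₁ : M₁ ≠ ⊤ := ENNReal.mul_ne_top hMtop
    (ENNReal.rpow_ne_top_of_nonneg (by have := hpq.pos; positivity) ENNReal.ofReal_ne_top)
  have hWM₁ : ∀ n, ∫⁻ s, ‖W n s‖ₑ ≤ M₁ := fun n => by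
    have := lintegral_enorm_Ioc_le hpq (hw n) (hM n) le_rfl le_rfl
    rw [← timeMeasure_eq_Ioc] at this
    exact (lintegral_enorm_indicator_Icc T (w n)).trans_le this
  -- The threshold h₁ is uniform in n, so h can be fixed before n tends to infinity.
  obtain ⟨h₁, hh₁, hstek⟩ := exists_forall_integral_sub_steklov_le hpq hv'p hv'1 hMtop hM₁
    (show 0 < ε / 4 by linarith)
  obtain ⟨h, hh, hhh₁, hhh₂, hhT⟩ : ∃ h, 0 < h ∧ h < h₁ ∧ h < h₂ ∧ h < T := by
    have hm : 0 < min h₁ (min h₂ T) := lt_min hh₁ (lt_min hh₂ hT)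
    refine ⟨min h₁ (min h₂ T) / 2, by positivity, ?_, ?_, ?_⟩
    · linarith [min_le_left h₁ (min h₂ T)]
    · linarith [min_le_right h₁ (min h₂ T), min_le_left h₂ T]
    · linarith [min_le_right h₁ (min h₂ T), min_le_right h₂ T]
  -- G is the pointwise limit of the forward integrals of w_n over [t, t+h); the cut at T appears
  -- because W vanishes beyond T.
  set G : ℝ → ℝ := fun t => inner ℝ (u (min (t + h) T) - u t) (ι (v t)) with hGdef
  have hτ : ∀ t ∈ Icc 0 T, min (t + h) T ∈ Icc 0 T := fun t ht =>
    ⟨le_min (by linarith [ht.1]) hT.le, min_le_right _ _⟩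
  have hinner : ∀ n, ∀ t ∈ Icc 0 T, ∫ s in Ico t (t + h), W n s (v' t) =
      (∫ s in (0 : ℝ)..min (t + h) T, w n s (v t)) - ∫ s in (0 : ℝ)..t, w n s (v t) := by
    intro n t ht
    have hi : Integrable (fun s => w n s (v t)) (timeMeasure T) :=
      (hw1 n).apply_continuousLinearMap _
    rw [intervalIntegral.integral_interval_sub_left
      (intervalIntegrable_of_timeMeasure hi hT0 (hτ t ht))
      (intervalIntegrable_of_timeMeasure hi hT0 ht),
      intervalIntegral.integral_of_le (le_min (by linarith) ht.2), hv'def, indicator_of_mem ht]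
    have e1 : ∀ s, W n s (v t) = (Icc 0 T).indicator (fun s => w n s (v t)) s := by
      intro s
      by_cases hs : s ∈ Icc 0 T
      · simp [hWdef, hs]
      · simp [hWdef, indicator_of_notMem hs]
    simp_rw [e1]
    rw [setIntegral_indicator measurableSet_Icc, ← integral_Icc_eq_integral_Ioc]
    refine setIntegral_congr_set ?_
    have e2 : Ico t (t + h) ∩ Iic T ⊆ Ico t (t + h) ∩ Icc 0 T := fun x hx =>
      ⟨hx.1, ht.1.trans hx.1.1, hx.2⟩
    have e3 : Ico t (t + h) ∩ Icc 0 T = Ico t (t + h) ∩ Iic T :=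
      Subset.antisymm (fun x hx => ⟨hx.1, hx.2.2⟩) e2
    have e4 : Icc t (min (t + h) T) = Icc t (t + h) ∩ Iic T := by
      ext x; simp [and_assoc]
    rw [e3, e4]
    exact Ico_ae_eq_Icc.inter (ae_eq_refl _)
  have hlim : ∀ t, Tendsto (fun n => ∫ s in Ico t (t + h), W n s (v' t)) atTop
      (𝓝 ((Icc 0 T).indicator G t)) := by
    intro t
    by_cases ht : t ∈ Icc 0 T
    · simp_rw [hinner _ t ht, indicator_of_mem ht]
      have := (hconv _ (hτ t ht) (v t)).sub (hconv t ht (v t))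
      rwa [← inner_sub_left, sub_sub_sub_cancel_right] at this
    · simp [hv'def, indicator_of_notMem ht]
  have hbound : ∀ n t, ‖∫ s in Ico t (t + h), W n s (v' t)‖ ≤ M₁.toReal * ‖v' t‖ := by
    intro n t
    rw [← ENNReal.ofReal_le_ofReal_iff (by positivity), ofReal_norm]
    calc ‖∫ s in Ico t (t + h), W n s (v' t)‖ₑ ≤ ∫⁻ s in Ico t (t + h), ‖W n s (v' t)‖ₑ :=
          enorm_integral_le_lintegral_enorm _
      _ ≤ ∫⁻ s, ‖W n s (v' t)‖ₑ := setLIntegral_le_lintegral _ _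
      _ ≤ ∫⁻ s, ‖W n s‖ₑ * ‖v' t‖ₑ := lintegral_mono fun s => (W n s).le_opENorm _
      _ = (∫⁻ s, ‖W n s‖ₑ) * ‖v' t‖ₑ := lintegral_mul_const' _ _ enorm_ne_top
      _ ≤ M₁ * ‖v' t‖ₑ := by gcongr; exact hWM₁ n
      _ = _ := by rw [ENNReal.ofReal_mul ENNReal.toReal_nonneg, ENNReal.ofReal_toReal hM₁,
                    ofReal_norm]
  have hdct : Tendsto (fun n => ∫ s, W n s (∫ t in Ioc (s - h) s, v' t)) atTop
      (𝓝 (∫ t, (Icc 0 T).indicator G t)) := by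
    simp_rw [integral_apply_integral_Ioc (hW1 _) hv'1]
    exact tendsto_integral_of_dominated_convergence (fun t => M₁.toReal * ‖v' t‖)
      (fun n => (integrable_integral_Ico_apply (hW1 n) hv'1 h).1) (hv'1.norm.const_mul _)
      (fun n => Eventually.of_forall (hbound n)) (Eventually.of_forall hlim)
  have hGint : Integrable ((Icc 0 T).indicator G) := by
    refine (hv'1.norm.const_mul M₁.toReal).mono' ?_ (Eventually.of_forall fun t => ?_)
    · exact aestronglyMeasurable_of_tendsto_ae atTop
        (fun n => (integrable_integral_Ico_apply (hW1 n) hv'1 h).1) (Eventually.of_forall hlim)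
    · exact le_of_tendsto (hlim t).norm (Eventually.of_forall fun n => hbound n t)
  -- the squared norm
  set N : ℝ → ℝ := fun t => ‖u (min t T)‖ ^ 2 with hNdef
  -- Nothing is assumed about the measurability of u; it comes from the representative ι ∘ v.
  have hNint : IntervalIntegrable N volume 0 T := by
    rw [intervalIntegrable_iff_integrableOn_Ioc_of_le hT.le]
    have hm : AEStronglyMeasurable (fun t => ‖ι (v t)‖ ^ 2) (timeMeasure T) :=
      (ι.continuous.comp_aestronglyMeasurable hv.1).norm.pow 2
    have hEq : (fun t => ‖ι (v t)‖ ^ 2) =ᵐ[timeMeasure T] N := by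
      have hmem : ∀ᵐ t ∂timeMeasure T, t ∈ Icc 0 T := ae_restrict_mem measurableSet_Icc
      filter_upwards [huv, hmem] with t ht htm
      simp only [hNdef, ht, min_eq_left htm.2]
    have hbd : ∀ t ∈ Icc 0 T, ‖N t‖ ≤ R ^ 2 := by
      intro t ht
      simp only [hNdef, min_eq_left ht.2, norm_pow, norm_norm]
      exact pow_le_pow_left₀ (norm_nonneg _) (hR t ht) 2
    have : Integrable N (timeMeasure T) :=
      Integrable.of_bound (hm.congr hEq) (R ^ 2)
        ((ae_restrict_mem measurableSet_Icc).mono hbd)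
    rwa [timeMeasure_eq_Ioc] at this
  have hNT : EqOn (fun _ => ‖u T‖ ^ 2) N (uIoc T (T + h)) := by
    intro t ht
    rw [uIoc_of_le (by linarith)] at ht
    simp only [hNdef, min_eq_right ht.1.le]
  have hNint' : IntervalIntegrable N volume T (T + h) :=
    (intervalIntegrable_const (c := ‖u T‖ ^ 2)).congr hNT
  have hN0h : IntervalIntegrable N volume 0 h :=
    hNint.mono_set (by rw [uIcc_of_le hh.le, uIcc_of_le hT.le]; exact Icc_subset_Icc_right hhT.le)
  have hNhT : IntervalIntegrable N volume h (T + h) := hN0h.symm.trans (hNint.trans hNint')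
  -- The integral of N(t+h) - N(t) telescopes to the two boundary layers of width h; N is frozen at
  -- ‖u T‖² past T, and the layer at 0 is bounded below by `hlsc`.
  have hNshift : ∫ t in (0 : ℝ)..T, N (t + h) =
      (∫ t in (0 : ℝ)..T, N t) + h * ‖u T‖ ^ 2 - ∫ t in (0 : ℝ)..h, N t := by
    rw [intervalIntegral.integral_comp_add_right (fun t => N t) h, zero_add]
    have e1 := intervalIntegral.integral_add_adjacent_intervals hN0h hNhT
    have e2 := intervalIntegral.integral_add_adjacent_intervals hNint hNint'
    have e3 : ∫ t in T..(T + h), N t = h * ‖u T‖ ^ 2 := by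
      rw [← intervalIntegral.integral_congr_ae (Eventually.of_forall hNT)]
      simp
    linarith
  have hNh : h * (‖u 0‖ ^ 2 - ε) ≤ ∫ t in (0 : ℝ)..h, N t := by
    have := intervalIntegral.integral_mono_on (f := fun _ => ‖u 0‖ ^ 2 - ε) hh.le
      intervalIntegrable_const hN0h fun t ht => by
        have htT : t ≤ T := ht.2.trans hhT.le
        simp only [hNdef, min_eq_left htT]
        exact hlsc t ht.1 htT (ht.2.trans_lt hhh₂)
    rwa [intervalIntegral.integral_const, sub_zero, smul_eq_mul] at this
  have hNsh : IntervalIntegrable (fun t => N (t + h)) volume 0 T := by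
    have := hNhT.comp_add_right h
    simpa using this
  have hGle : ∫ t, (Icc 0 T).indicator G t ≤ h * ((‖u T‖ ^ 2 - ‖u 0‖ ^ 2 + ε) / 2) := by
    have e1 : ∫ t in (0 : ℝ)..T, (N (t + h) - N t) / 2 =
        ((∫ t in (0 : ℝ)..T, N (t + h)) - ∫ t in (0 : ℝ)..T, N t) / 2 := by
      rw [intervalIntegral.integral_div, intervalIntegral.integral_sub hNsh hNint]
    have hGint' : IntegrableOn G (Icc 0 T) := (integrable_indicator_iff measurableSet_Icc).1 hGint
    have e2 : ∫ t, (Icc 0 T).indicator G t ≤ ∫ t in (0 : ℝ)..T, (N (t + h) - N t) / 2 := by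
      rw [integral_indicator measurableSet_Icc, ← integral_timeMeasure hT.le]
      refine integral_mono_ae hGint' ?_ ?_
      · have := (hNsh.sub hNint).div_const 2
        rw [intervalIntegrable_iff_integrableOn_Ioc_of_le hT.le] at this
        have e : Integrable (fun t => (N (t + h) - N t) / 2) (timeMeasure T) := by
          rw [timeMeasure_eq_Ioc]; exact this
        exact e
      · have hmem : ∀ᵐ t ∂timeMeasure T, t ∈ Icc 0 T := ae_restrict_mem measurableSet_Icc
        filter_upwards [huv, hmem] with t ht htm
        simp only [hGdef, hNdef, ht, min_eq_left htm.2]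
        exact inner_sub_le_half _ _
    rw [hNshift] at e1
    nlinarith
  -- The total error ε is ε/2 from the layer at 0, ε/4 from the limit in n, and ε/4 from the Steklov
  -- averages.
  have hev := hdct.eventually (gt_mem_nhds
    (show ∫ t, (Icc 0 T).indicator G t < h * ((‖u T‖ ^ 2 - ‖u 0‖ ^ 2 + ε) / 2 + ε / 4) by
      have : 0 < h * (ε / 4) := by positivity
      rw [mul_add]; linarith))
  filter_upwards [hev] with n hn
  have h1 := (abs_le.1 (hstek h hh hhh₁ (W n) (hW1 n).1 (hWM n) (hWM₁ n))).2
  have h2 : h⁻¹ * ∫ s, W n s (∫ t in Ioc (s - h) s, v' t) ≤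
      (‖u T‖ ^ 2 - ‖u 0‖ ^ 2 + ε) / 2 + ε / 4 := by
    rw [inv_mul_le_iff₀ hh]; exact hn.le
  have h3 : ∫ s, W n s (v' s) = ∫ t, w n t (v t) ∂timeMeasure T := by
    rw [timeMeasure, ← integral_indicator measurableSet_Icc]
    congr 1
    ext s
    by_cases hs : s ∈ Icc 0 T
    · simp [hWdef, hv'def, hs]
    · simp [hWdef, hv'def, indicator_of_notMem hs]
  rw [h3] at h1
  linarith

end Energy

end LocallyMonotone

/-! ### Energy equality and strong continuity in H -/

namespace LocallyMonotone

theorem continuousOn_integral_timeMeasure {E : Type*} [NormedAddCommGroup E] [NormedSpace ℝ E]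
    {T : ℝ} {w : ℝ → E} (hw : Integrable w (timeMeasure T)) :
    ContinuousOn (fun t => ∫ s in (0 : ℝ)..t, w s) (Icc 0 T) := by
  have hwI : IntegrableOn w (Icc 0 T) := hw
  refine (intervalIntegral.continuousOn_primitive_Icc hwI).congr fun t ht => ?_
  simp only [intervalIntegral.integral_of_le ht.1, integral_Icc_eq_integral_Ioc]

section EnergyEquality

variable {V H : Type*} [NormedAddCommGroup V] [NormedSpace ℝ V]
  [NormedAddCommGroup H] [InnerProductSpace ℝ H] {ι : V →L[ℝ] H}

/-- `u` is a weak primitive of `w` on `[0,T]` and is represented by the `V`-valued function `v`. -/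
structure IsWeakPrimitive (ι : V →L[ℝ] H) (p q T R : ℝ) (v : ℝ → V) (w : ℝ → StrongDual ℝ V)
    (u : ℝ → H) : Prop where
  memLp_left : MemLp v (ENNReal.ofReal p) (timeMeasure T)
  memLp_right : MemLp w (ENNReal.ofReal q) (timeMeasure T)
  integral_eq : ∀ t ∈ Icc 0 T, ∀ z, ∫ s in (0 : ℝ)..t, w s z = inner ℝ (u t - u 0) (ι z)
  norm_le : ∀ t ∈ Icc 0 T, ‖u t‖ ≤ R
  ae_eq : ∀ᵐ t ∂timeMeasure T, ι (v t) = u t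

theorem timeMeasure_mono {s t : ℝ} (hst : s ≤ t) : timeMeasure s ≤ timeMeasure t :=
  Measure.restrict_mono (Icc_subset_Icc_right hst) le_rfl

theorem measurePreserving_reverse (T : ℝ) :
    MeasurePreserving (fun t => T - t) (timeMeasure T) (timeMeasure T) := by
  have h := (Measure.measurePreserving_sub_left volume T).restrict_preimage
    (s := Icc 0 T) measurableSet_Icc
  have hpre : (fun t => T - t) ⁻¹' Icc 0 T = Icc 0 T := by
    ext t; simp only [mem_preimage, mem_Icc]; constructor <;> rintro ⟨h1, h2⟩ <;>
      constructor <;> linarith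
  rwa [hpre] at h

namespace IsWeakPrimitive

variable {p q T R : ℝ} {v : ℝ → V} {w : ℝ → StrongDual ℝ V} {u : ℝ → H}

theorem mono (h : IsWeakPrimitive ι p q T R v w u) {t : ℝ} (ht : t ≤ T) :
    IsWeakPrimitive ι p q t R v w u where
  memLp_left := h.memLp_left.mono_measure (timeMeasure_mono ht)
  memLp_right := h.memLp_right.mono_measure (timeMeasure_mono ht)
  integral_eq s hs := h.integral_eq s ⟨hs.1, hs.2.trans ht⟩
  norm_le s hs := h.norm_le s ⟨hs.1, hs.2.trans ht⟩
  ae_eq := ae_mono (timeMeasure_mono ht) h.ae_eq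

theorem integrable_right (h : IsWeakPrimitive ι p q T R v w u) (hpq : p.HolderConjugate q) :
    Integrable w (timeMeasure T) :=
  integrable_of_eLpNorm_le hpq.symm.lt.le h.memLp_right

theorem integrable_apply (h : IsWeakPrimitive ι p q T R v w u) (hpq : p.HolderConjugate q) :
    Integrable (fun t => w t (v t)) (timeMeasure T) :=
  integrable_apply_of_memLp hpq h.memLp_right h.memLp_left

/-- Reversing time changes the sign of w and exchanges the endpoints, so the energy inequality for
the reversed path is the opposite inequality. -/
theorem reverse (h : IsWeakPrimitive ι p q T R v w u) (hpq : p.HolderConjugate q) :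
    IsWeakPrimitive ι p q T R (fun t => v (T - t)) (fun t => -w (T - t)) (fun t => u (T - t)) where
  memLp_left := h.memLp_left.comp_measurePreserving (measurePreserving_reverse T)
  memLp_right := (h.memLp_right.comp_measurePreserving (measurePreserving_reverse T)).neg
  integral_eq t ht z := by
    have hT : 0 ≤ T := ht.1.trans ht.2
    have hi : Integrable (fun s => w s z) (timeMeasure T) :=
      (h.integrable_right hpq).apply_continuousLinearMap z
    have h0 : (0 : ℝ) ∈ Icc 0 T := ⟨le_rfl, hT⟩
    have hTT : T ∈ Icc 0 T := ⟨hT, le_rfl⟩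
    have htt : T - t ∈ Icc 0 T := ⟨by linarith [ht.2], by linarith [ht.1]⟩
    have e1 := h.integral_eq _ htt z
    have e2 := h.integral_eq _ hTT z
    have e3 := intervalIntegral.integral_interval_sub_left
      (intervalIntegrable_of_timeMeasure hi h0 hTT) (intervalIntegrable_of_timeMeasure hi h0 htt)
    simp only [neg_apply, intervalIntegral.integral_neg,
      intervalIntegral.integral_comp_sub_left (fun s => w s z) T, sub_zero]
    rw [← e3, e1, e2, ← inner_sub_left, ← inner_neg_left]
    congr 1
    abel
  norm_le t ht := h.norm_le _ ⟨by linarith [ht.2], by linarith [ht.1]⟩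
  ae_eq := (measurePreserving_reverse T).quasiMeasurePreserving.ae h.ae_eq

variable [CompleteSpace V]

theorem integral_apply_le (h : IsWeakPrimitive ι p q T R v w u) (hpq : p.HolderConjugate q)
    (hd : DenseRange ι) (hT : 0 < T) :
    ∫ t, w t (v t) ∂timeMeasure T ≤ (‖u T‖ ^ 2 - ‖u 0‖ ^ 2) / 2 := by
  refine le_of_forall_pos_le_add fun ε hε => ?_
  have := eventually_integral_apply_le hpq hT h.memLp_left (w := fun _ => w)
    h.memLp_right.2.ne (fun _ => h.memLp_right.1) (fun _ => le_rfl)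
    (fun t ht z => by rw [h.integral_eq t ht z]; exact tendsto_const_nhds)
    h.norm_le h.ae_eq hd hε
  exact (this.exists).choose_spec

theorem energy_eq (h : IsWeakPrimitive ι p q T R v w u) (hpq : p.HolderConjugate q)
    (hd : DenseRange ι) {t : ℝ} (ht : t ∈ Icc 0 T) :
    ‖u t‖ ^ 2 = ‖u 0‖ ^ 2 + 2 * ∫ s in (0 : ℝ)..t, w s (v s) := by
  rcases ht.1.eq_or_lt with rfl | ht0
  · simp
  have h' := h.mono ht.2
  have h1 := h'.integral_apply_le hpq hd ht0
  have h2 := (h'.reverse hpq).integral_apply_le hpq hd ht0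
  rw [integral_timeMeasure ht.1] at h1 h2
  simp only [neg_apply, intervalIntegral.integral_neg, sub_self, sub_zero,
    intervalIntegral.integral_comp_sub_left (fun s => w s (v s)) t] at h2
  linarith

/-- Testing against V gives weak continuity, since V is dense and u is bounded; the energy equality
gives continuity of the norm. Together they give strong continuity. -/
theorem continuousOn (h : IsWeakPrimitive ι p q T R v w u) (hpq : p.HolderConjugate q)
    (hd : DenseRange ι) : ContinuousOn u (Icc 0 T) := by
  intro s hs
  have hN : ContinuousOn (fun t => ‖u t‖ ^ 2) (Icc 0 T) := by
    have := ((continuousOn_integral_timeMeasure (h.integrable_apply hpq)).const_mul 2).const_add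
      (‖u 0‖ ^ 2)
    exact this.congr fun t ht => h.energy_eq hpq hd ht
  have hR0 : 0 ≤ R := (norm_nonneg _).trans (h.norm_le s hs)
  rw [ContinuousWithinAt, tendsto_iff_norm_sub_tendsto_zero]
  have key : Tendsto (fun t => ‖u t - u s‖ ^ 2) (𝓝[Icc 0 T] s) (𝓝 0) := by
    rw [Metric.tendsto_nhds]
    intro ε hε
    -- Since ‖u t - u s‖ ≤ 2R, replacing u s by ι z costs at most ε/8 in the inner product.
    obtain ⟨z, hz⟩ := hd.exists_dist_lt (u s) (show 0 < ε / (16 * (R + 1)) by positivity)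
    have h1 := (hN s hs).eventually (Metric.ball_mem_nhds _ (show 0 < ε / 4 by linarith))
    have h2 := ((tendsto_holder_modulus hpq.pos ‖z‖
      (eLpNorm w (ENNReal.ofReal q) (timeMeasure T)).toReal s).mono_left
        (nhdsWithin_le_nhds (s := Icc 0 T))).eventually (gt_mem_nhds (show 0 < ε / 8 by linarith))
    filter_upwards [h1, h2, self_mem_nhdsWithin] with t ht1 ht2 htm
    have h3 : |inner ℝ (u t - u s) (ι z)| < ε / 8 := by
      refine lt_of_le_of_lt ?_ ht2
      have hconv := fun t (ht : t ∈ Icc 0 T) z => show Tendsto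
        (fun _ : ℕ => ∫ s in (0 : ℝ)..t, w s z) atTop (𝓝 (inner ℝ (u t - u 0) (ι z))) by
          rw [h.integral_eq t ht z]; exact tendsto_const_nhds
      rcases le_total s t with hst | hst
      · rw [abs_of_nonneg (sub_nonneg.2 hst)]
        exact abs_inner_sub_le hpq h.memLp_right.2.ne (fun _ => h.memLp_right.1)
          (fun _ => le_rfl) hconv hs.1 hst htm.2 z
      · rw [abs_sub_comm t s, abs_of_nonneg (sub_nonneg.2 hst), ← neg_sub (u s) (u t),
          inner_neg_left, abs_neg]
        exact abs_inner_sub_le hpq h.memLp_right.2.ne (fun _ => h.memLp_right.1)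
          (fun _ => le_rfl) hconv htm.1 hst hs.2 z
    have h4 : |inner ℝ (u t - u s) (u s - ι z)| ≤ ε / 8 := by
      calc |inner ℝ (u t - u s) (u s - ι z)| ≤ ‖u t - u s‖ * ‖u s - ι z‖ :=
            abs_real_inner_le_norm _ _
        _ ≤ (2 * (R + 1)) * (ε / (16 * (R + 1))) := by
            apply mul_le_mul _ _ (norm_nonneg _) (by positivity)
            · refine (norm_sub_le _ _).trans ?_
              linarith [h.norm_le t htm, h.norm_le s hs]
            · rw [← dist_eq_norm]; exact hz.le
        _ = ε / 8 := by field_simp; norm_num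
    have h5 : ‖u t - u s‖ ^ 2 =
        (‖u t‖ ^ 2 - ‖u s‖ ^ 2) - 2 * inner ℝ (u t - u s) (u s) := by
      rw [norm_sub_sq_real, inner_sub_left, real_inner_self_eq_norm_sq]; ring
    have h6 : inner ℝ (u t - u s) (u s) =
        inner ℝ (u t - u s) (ι z) + inner ℝ (u t - u s) (u s - ι z) := by
      rw [← inner_add_right]; simp
    rw [Real.dist_eq] at ht1
    rw [Real.dist_eq, sub_zero, abs_of_nonneg (by positivity), h5, h6]
    have a1 := abs_lt.1 ht1
    have a2 := abs_lt.1 h3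
    have a3 := abs_le.1 h4
    linarith [a1.2, a2.1, a3.1]
  have := key.sqrt
  simpa using this

end IsWeakPrimitive

end EnergyEquality

/-! ### Generalized derivatives and primitives -/

section GeneralizedDeriv

variable {E : Type*} [NormedAddCommGroup E] [NormedSpace ℝ E] [CompleteSpace E]

/-- Fubini on the triangle s ≤ t replaces differentiation of the primitive. Since that primitive
vanishes at 0, only φ(T) = 0 is needed. -/
theorem integral_deriv_smul_primitive {T : ℝ} (hT : 0 < T) {w : ℝ → E}
    (hw : Integrable w (timeMeasure T)) {φ : ℝ → ℝ} (hφ : ContDiff ℝ ∞ φ) (hφT : φ T = 0) :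
    ∫ t in (0 : ℝ)..T, deriv φ t • ∫ s in (0 : ℝ)..t, w s = -∫ t in (0 : ℝ)..T, φ t • w t := by
  have hdφ : Continuous (deriv φ) := hφ.continuous_deriv (by simp)
  have hdi : Integrable (deriv φ) (timeMeasure T) :=
    hdφ.continuousOn.integrableOn_compact isCompact_Icc
  have hK : Integrable (fun z : ℝ × ℝ =>
      {z : ℝ × ℝ | z.2 ≤ z.1}.indicator (fun z => deriv φ z.1 • w z.2) z)
      ((timeMeasure T).prod (timeMeasure T)) := by
    refine Integrable.indicator ?_ (measurableSet_le measurable_snd measurable_fst)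
    refine Integrable.op_fst_snd (op := fun (a : ℝ) (b : E) => a • b) (by fun_prop)
      ⟨1, fun x y => by rw [one_mul, norm_smul]⟩ hdi hw
  have hswap := integral_integral_swap (f := fun t s =>
    {z : ℝ × ℝ | z.2 ≤ z.1}.indicator (fun z => deriv φ z.1 • w z.2) (t, s)) hK
  have hmem : ∀ᵐ t ∂timeMeasure T, t ∈ Icc 0 T := ae_restrict_mem measurableSet_Icc
  have h1 : ∀ t ∈ Icc 0 T, ∫ s, {z : ℝ × ℝ | z.2 ≤ z.1}.indicator
      (fun z => deriv φ z.1 • w z.2) (t, s) ∂timeMeasure T =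
      deriv φ t • ∫ s in (0 : ℝ)..t, w s := by
    intro t ht
    have e : ∀ s, {z : ℝ × ℝ | z.2 ≤ z.1}.indicator (fun z => deriv φ z.1 • w z.2) (t, s) =
        (Iic t).indicator (fun s => deriv φ t • w s) s := fun s => rfl
    simp_rw [e]
    rw [integral_indicator measurableSet_Iic, integral_smul, intervalIntegral.integral_of_le ht.1,
      timeMeasure_eq_Ioc, Measure.restrict_restrict measurableSet_Iic, inter_comm, Ioc_inter_Iic,
      min_eq_right ht.2]
  have h2 : ∀ s ∈ Icc 0 T, ∫ t, {z : ℝ × ℝ | z.2 ≤ z.1}.indicator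
      (fun z => deriv φ z.1 • w z.2) (t, s) ∂timeMeasure T = -(φ s • w s) := by
    intro s hs
    have e : ∀ t, {z : ℝ × ℝ | z.2 ≤ z.1}.indicator (fun z => deriv φ z.1 • w z.2) (t, s) =
        (Ici s).indicator (fun t => deriv φ t • w s) t := fun s => rfl
    simp_rw [e]
    rw [integral_indicator measurableSet_Ici, integral_smul_const, timeMeasure,
      Measure.restrict_restrict measurableSet_Ici, inter_comm, ← Ici_inter_Iic, inter_right_comm,
      Ici_inter_Ici, Ici_inter_Iic, max_eq_right hs.1, integral_Icc_eq_integral_Ioc,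
      ← intervalIntegral.integral_of_le hs.2, intervalIntegral.integral_deriv_eq_sub
        (fun x _ => (hφ.differentiable (by simp)).differentiableAt)
        (hdφ.intervalIntegrable _ _), hφT, zero_sub, neg_smul]
  rw [← integral_timeMeasure hT.le, ← integral_timeMeasure hT.le, ← integral_neg]
  rw [← integral_congr_ae (hmem.mono h1), hswap, integral_congr_ae (hmem.mono h2)]

omit [CompleteSpace E] in
theorem intervalIntegral_eq_Ioo {T : ℝ} (hT : 0 ≤ T) (f : ℝ → E) :
    ∫ t in (0 : ℝ)..T, f t = ∫ t in Ioo 0 T, f t := by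
  rw [intervalIntegral.integral_of_le hT, integral_Ioc_eq_integral_Ioo]

theorem hasGeneralizedDeriv_of_integral_eq {T : ℝ} (hT : 0 < T) {g w : ℝ → E}
    (hw : Integrable w (timeMeasure T)) (hg : ∀ t ∈ Icc 0 T, g t = g 0 + ∫ s in (0 : ℝ)..t, w s) :
    HasGeneralizedDeriv T g w := by
  have hwI : IntegrableOn w (Icc 0 T) := hw
  have hP := continuousOn_integral_timeMeasure hw
  have hgc : ContinuousOn g (Icc 0 T) := (hP.const_add (g 0)).congr hg
  have hgI : IntegrableOn g (Icc 0 T) := hgc.integrableOn_compact isCompact_Icc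
  refine ⟨hgI.mono_set Ioo_subset_Icc_self, hwI.mono_set Ioo_subset_Icc_self, fun φ hφ _ hsupp => ?_⟩
  have hφ0 : φ 0 = 0 := image_eq_zero_of_notMem_tsupport fun h => (hsupp h).1.false
  have hφT : φ T = 0 := image_eq_zero_of_notMem_tsupport fun h => (hsupp h).2.false
  have hdφ : Continuous (deriv φ) := hφ.continuous_deriv (by simp)
  rw [← intervalIntegral_eq_Ioo hT.le, ← intervalIntegral_eq_Ioo hT.le,
    ← integral_deriv_smul_primitive hT hw hφ hφT]
  have e : ∫ t in (0 : ℝ)..T, deriv φ t • g t =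
      ∫ t in (0 : ℝ)..T, (deriv φ t • g 0 + deriv φ t • ∫ s in (0 : ℝ)..t, w s) := by
    refine intervalIntegral.integral_congr fun t ht => ?_
    rw [uIcc_of_le hT.le] at ht
    simp only [hg t ht, smul_add]
  have i1 : IntervalIntegrable (fun t => deriv φ t • g 0) volume 0 T :=
    (hdφ.smul continuous_const).intervalIntegrable _ _
  have i2 : IntervalIntegrable (fun t => deriv φ t • ∫ s in (0 : ℝ)..t, w s) volume 0 T :=
    ContinuousOn.intervalIntegrable_of_Icc hT.le (hdφ.continuousOn.smul hP)
  rw [e, intervalIntegral.integral_add i1 i2,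
    intervalIntegral.integral_smul_const, intervalIntegral.integral_deriv_eq_sub
        (fun x _ => (hφ.differentiable (by simp)).differentiableAt)
        (hdφ.intervalIntegrable _ _), hφ0, hφT, sub_zero, zero_smul, zero_add]

/-- The primitive from the left end of the support vanishes to the right of the support because the
total integral is zero. -/
theorem exists_primitive_tsupport_subset {T : ℝ} (hT : 0 < T) {χ : ℝ → ℝ} (hχ : ContDiff ℝ ∞ χ)
    (hc : HasCompactSupport χ) (hsupp : tsupport χ ⊆ Ioo 0 T) (hint : ∫ t, χ t = 0) :
    ∃ φ : ℝ → ℝ, ContDiff ℝ ∞ φ ∧ HasCompactSupport φ ∧ tsupport φ ⊆ Ioo 0 T ∧ deriv φ = χ := by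
  obtain ⟨a, b, ha, hab, hb, hK⟩ : ∃ a b, 0 < a ∧ a ≤ b ∧ b < T ∧ tsupport χ ⊆ Icc a b := by
    -- The point T/2 is added only to make the compact set nonempty.
    have hKc : IsCompact (insert (T / 2) (tsupport χ)) := hc.isCompact.insert _
    have hsub : insert (T / 2) (tsupport χ) ⊆ Ioo 0 T :=
      insert_subset ⟨by linarith, by linarith⟩ hsupp
    obtain ⟨a, haK, ha⟩ := hKc.exists_isLeast (insert_nonempty _ _)
    obtain ⟨b, hbK, hb⟩ := hKc.exists_isGreatest (insert_nonempty _ _)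
    exact ⟨a, b, (hsub haK).1, ha hbK, (hsub hbK).2,
      fun x hx => ⟨ha (mem_insert_of_mem _ hx), hb (mem_insert_of_mem _ hx)⟩⟩
  have hz : ∀ x, x ∉ Icc a b → χ x = 0 := fun x hx =>
    image_eq_zero_of_notMem_tsupport fun h => hx (hK h)
  have hχc := hχ.continuous
  set φ : ℝ → ℝ := fun x => ∫ t in a..x, χ t with hφdef
  have hderiv : ∀ x, HasDerivAt φ (χ x) x := fun x =>
    intervalIntegral.integral_hasDerivAt_right (hχc.intervalIntegrable _ _)
      hχc.aestronglyMeasurable.stronglyMeasurableAtFilter hχc.continuousAt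
  have hd : deriv φ = χ := funext fun x => (hderiv x).deriv
  have htot : ∫ t in a..b, χ t = 0 := by
    rw [intervalIntegral.integral_of_le hab, ← integral_Icc_eq_integral_Ioc, ← hint]
    exact setIntegral_eq_integral_of_forall_compl_eq_zero hz
  have hφz : ∀ x, x ∉ Icc a b → φ x = 0 := by
    intro x hx
    rcases lt_or_ge x a with h | h
    · rw [hφdef]
      refine (intervalIntegral.integral_congr (g := fun _ => (0 : ℝ)) fun t ht => ?_).trans
        (by simp)
      rw [uIcc_of_ge h.le] at ht
      rcases ht.2.eq_or_lt with rfl | h'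
      -- The endpoint a belongs to the interval, so `hz` does not cover it; continuity of χ from the
      -- left does.
      · have : Tendsto χ (𝓝[<] t) (𝓝 0) :=
          tendsto_const_nhds.congr' (by
            filter_upwards [self_mem_nhdsWithin] with y hy
            exact (hz y fun hh => (not_le.2 hy) hh.1).symm)
        exact tendsto_nhds_unique (hχc.continuousAt.tendsto.mono_left nhdsWithin_le_nhds) this
      · exact hz t fun hh => (not_le.2 h') hh.1
    · have hbx : b < x := by
        by_contra hh; exact hx ⟨h, not_lt.1 hh⟩
      change ∫ t in a..x, χ t = 0
      rw [← intervalIntegral.integral_add_adjacent_intervals (hχc.intervalIntegrable a b)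
        (hχc.intervalIntegrable b x), htot, zero_add, intervalIntegral.integral_of_le hbx.le]
      refine (setIntegral_congr_fun measurableSet_Ioc (g := fun _ => (0 : ℝ)) fun t ht => ?_).trans
        (by simp)
      exact hz t fun hh => (not_le.2 ht.1) hh.2
  have hts : tsupport φ ⊆ Icc a b :=
    closure_minimal (fun x hx => by by_contra h; exact hx (hφz x h)) isClosed_Icc
  refine ⟨φ, ?_, ?_, hts.trans fun x hx => ⟨ha.trans_le hx.1, hx.2.trans_lt hb⟩, hd⟩
  · rw [contDiff_infty_iff_deriv]
    exact ⟨fun x => (hderiv x).differentiableAt, hd ▸ hχ⟩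
  · exact HasCompactSupport.of_support_subset_isCompact isCompact_Icc
      ((subset_tsupport φ).trans hts)

/-- The du Bois-Reymond lemma: g minus the primitive of w annihilates all derivatives of test
functions, so it is almost everywhere constant, and everywhere on [0,T] by continuity. -/
theorem HasGeneralizedDeriv.eq_add_integral {T : ℝ} (hT : 0 < T) {g w : ℝ → E}
    (h : HasGeneralizedDeriv T g w) (hg : ContinuousOn g (Icc 0 T)) :
    ∀ t ∈ Icc 0 T, g t = g 0 + ∫ s in (0 : ℝ)..t, w s := by
  have hwI : IntegrableOn w (Icc 0 T) := by
    have := h.2.1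
    rwa [IntegrableOn, ← Measure.restrict_congr_set Ioo_ae_eq_Icc.symm] at this
  set P : ℝ → E := fun t => ∫ s in (0 : ℝ)..t, w s with hPdef
  have hPc : ContinuousOn P (Icc 0 T) := continuousOn_integral_timeMeasure hwI
  have hP : HasGeneralizedDeriv T P w :=
    hasGeneralizedDeriv_of_integral_eq hT hwI fun t _ => by simp [hPdef]
  set D : ℝ → E := fun t => g t - P t with hDdef
  have hDc : ContinuousOn D (Icc 0 T) := hg.sub hPc
  have hDI : IntegrableOn D (Ioo 0 T) := h.1.sub hP.1
  have hmul : ∀ ψ : ℝ → ℝ, Continuous ψ → ∀ G : ℝ → E, ContinuousOn G (Icc 0 T) →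
      IntegrableOn (fun t => ψ t • G t) (Ioo 0 T) := fun ψ hψ G hG =>
    ((hψ.continuousOn.smul hG).integrableOn_compact isCompact_Icc).mono_set Ioo_subset_Icc_self
  have hzero : ∀ φ : ℝ → ℝ, ContDiff ℝ ∞ φ → HasCompactSupport φ → tsupport φ ⊆ Ioo 0 T →
      ∫ t in Ioo 0 T, deriv φ t • D t = 0 := by
    intro φ hφ hφc hφs
    have hdφ : Continuous (deriv φ) := hφ.continuous_deriv (by simp)
    have e1 := h.2.2 φ hφ hφc hφs
    have e2 := hP.2.2 φ hφ hφc hφs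
    simp_rw [hDdef, smul_sub]
    rw [integral_sub (hmul _ hdφ _ hg) (hmul _ hdφ _ hPc), e1, e2, sub_self]
  let B : ContDiffBump (T / 2) := ⟨T / 8, T / 4, by linarith, by linarith⟩
  set ψ₀ : ℝ → ℝ := B.normed volume with hψ₀
  have hψ₀d : ContDiff ℝ ∞ ψ₀ := B.contDiff_normed
  have hψ₀c : HasCompactSupport ψ₀ := B.hasCompactSupport_normed
  have hψ₀s : tsupport ψ₀ ⊆ Ioo 0 T := by
    rw [hψ₀, B.tsupport_normed_eq, Real.closedBall_eq_Icc]
    intro x hx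
    change x ∈ Icc (T / 2 - T / 4) (T / 2 + T / 4) at hx
    exact ⟨by linarith [hx.1], by linarith [hx.2]⟩
  have hψ₀i : ∫ t, ψ₀ t = 1 := B.integral_normed
  set c : E := ∫ t in Ioo 0 T, ψ₀ t • D t with hc
  have hae : ∀ᵐ t, t ∈ Ioo 0 T → D t - c = 0 := by
    refine isOpen_Ioo.ae_eq_zero_of_integral_contDiff_smul_eq_zero (f := fun t => D t - c) ?_ ?_
    · exact (hDI.sub (integrableOn_const (by simp))).locallyIntegrableOn
    intro ψ hψ hψc hψs
    set I := ∫ t, ψ t with hI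
    have hψI : ∫ t in Ioo 0 T, ψ t = I :=
      setIntegral_eq_integral_of_forall_compl_eq_zero fun x hx =>
        image_eq_zero_of_notMem_tsupport fun hh => hx (hψs hh)
    -- Subtracting I ψ₀ makes the mean zero, so χ is the derivative of a test function and D
    -- annihilates it.
    set χ : ℝ → ℝ := fun t => ψ t - I * ψ₀ t with hχ
    have hχd : ContDiff ℝ ∞ χ := hψ.sub (contDiff_const.mul hψ₀d)
    have hχsub : tsupport χ ⊆ tsupport ψ ∪ tsupport ψ₀ := by
      refine closure_minimal (fun x hx => ?_)
        ((isClosed_tsupport _).union (isClosed_tsupport _))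
      by_contra hh
      rw [mem_union, not_or] at hh
      apply hx
      simp [hχ, image_eq_zero_of_notMem_tsupport hh.1, image_eq_zero_of_notMem_tsupport hh.2]
    have hχc : HasCompactSupport χ :=
      (hψc.isCompact.union hψ₀c.isCompact).of_isClosed_subset (isClosed_tsupport _) hχsub
    have hχi : ∫ t, χ t = 0 := by
      rw [hχ, integral_sub (hψ.continuous.integrable_of_hasCompactSupport hψc)
        ((hψ₀d.continuous.integrable_of_hasCompactSupport hψ₀c).const_mul _),
        integral_const_mul, hψ₀i, mul_one, sub_self]
    obtain ⟨φ, hφ, hφc, hφs, hφd⟩ := exists_primitive_tsupport_subset hT hχd hχc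
      (hχsub.trans (union_subset hψs hψ₀s)) hχi
    have h0 := hzero φ hφ hφc hφs
    rw [hφd] at h0
    have e1 : ∫ t in Ioo 0 T, χ t • D t =
        (∫ t in Ioo 0 T, ψ t • D t) - I • c := by
      simp_rw [hχ, sub_smul, mul_smul]
      have i1 : IntegrableOn (fun t => I • ψ₀ t • D t) (Ioo 0 T) :=
        (hmul _ hψ₀d.continuous _ hDc).smul I
      rw [integral_sub (hmul _ hψ.continuous _ hDc) i1, integral_smul]
    have e2 : ∫ t in Ioo 0 T, ψ t • (D t - c) = (∫ t in Ioo 0 T, ψ t • D t) - I • c := by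
      simp_rw [smul_sub]
      rw [integral_sub (hmul _ hψ.continuous _ hDc)
        (hmul _ hψ.continuous _ continuousOn_const), integral_smul_const, hψI]
    rw [← setIntegral_eq_integral_of_forall_compl_eq_zero (s := Ioo 0 T), e2, ← e1, h0]
    intro x hx
    rw [image_eq_zero_of_notMem_tsupport fun hh => hx (hψs hh), zero_smul]
  have hconst : EqOn D (fun _ => c) (Icc 0 T) := by
    refine Measure.eqOn_Icc_of_ae_eq volume hT.ne ?_ hDc continuousOn_const
    rw [← Measure.restrict_congr_set (Ioo_ae_eq_Icc (μ := volume))]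
    exact (ae_restrict_iff' measurableSet_Ioo).2 (hae.mono fun t ht htm => sub_eq_zero.1 (ht htm))
  intro t ht
  have e1 := hconst ht
  have e2 := hconst (show (0 : ℝ) ∈ Icc 0 T from ⟨le_rfl, hT.le⟩)
  simp only [hDdef, hPdef, intervalIntegral.integral_same, sub_zero] at e1 e2
  rw [e2, ← e1]
  simp

end GeneralizedDeriv

/-! ### Grönwall's lemma -/

section Gronwall

theorem exists_pos_forall_integral_lt {T : ℝ} {m : ℝ → ℝ} (hm : Integrable m (timeMeasure T))
    {ε : ℝ} (hε : 0 < ε) :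
    ∃ η > 0, ∀ s ∈ Icc 0 T, ∀ t ∈ Icc 0 T, |t - s| < η → |∫ x in s..t, m x| < ε := by
  have hc := continuousOn_integral_timeMeasure hm
  obtain ⟨η, hη, h⟩ := Metric.uniformContinuousOn_iff.1
    (isCompact_Icc.uniformContinuousOn_of_continuous hc) ε hε
  refine ⟨η, hη, fun s hs t ht hst => ?_⟩
  have h0 : (0 : ℝ) ∈ Icc 0 T := ⟨le_rfl, hs.1.trans hs.2⟩
  have := h t ht s hs hst
  rwa [Real.dist_eq, intervalIntegral.integral_interval_sub_left
    (intervalIntegrable_of_timeMeasure hm h0 ht)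
    (intervalIntegrable_of_timeMeasure hm h0 hs)] at this

/-- Grönwall's lemma with an integrable kernel and zero initial value. -/
theorem eq_zero_of_le_integral_mul {T : ℝ} {y κ : ℝ → ℝ} (hy : ContinuousOn y (Icc 0 T))
    (hy0 : ∀ t ∈ Icc 0 T, 0 ≤ y t) (hκ : Integrable κ (timeMeasure T))
    (hκ0 : ∀ᵐ t ∂timeMeasure T, 0 ≤ κ t)
    (hle : ∀ t ∈ Icc 0 T, y t ≤ ∫ s in (0 : ℝ)..t, κ s * y s) : ∀ t ∈ Icc 0 T, y t = 0 := by
  -- On a step of length η/2 the kernel has integral below 1/2. If y vanishes before the step, its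
  -- maximum there is at most half of itself, so it is zero; induction over steps covers [0,T].
  obtain ⟨η, hη, hsmall⟩ := exists_pos_forall_integral_lt hκ (show (0 : ℝ) < 1 / 2 by norm_num)
  have hκy : Integrable (fun t => κ t * y t) (timeMeasure T) := by
    have hκI : IntegrableOn κ (Icc 0 T) := hκ
    exact hκI.mul_continuousOn hy isCompact_Icc
  have key : ∀ n : ℕ, ∀ t ∈ Icc 0 T, t ≤ n * (η / 2) → y t = 0 := by
    intro n
    induction n with
    | zero =>
      intro t ht htn
      have ht0 : t = 0 := le_antisymm (by simpa using htn) ht.1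
      subst ht0
      exact le_antisymm (by simpa using hle 0 ht) (hy0 0 ht)
    | succ n ih =>
      intro t ht htn
      set b := min ((n + 1 : ℕ) * (η / 2)) T with hb
      have hb0 : 0 ≤ b := le_min (by positivity) (ht.1.trans ht.2)
      have hsub : Icc 0 b ⊆ Icc 0 T := Icc_subset_Icc_right (min_le_right _ _)
      obtain ⟨x, hx, hmax⟩ := isCompact_Icc.exists_isMaxOn (nonempty_Icc.2 hb0) (hy.mono hsub)
      have hxT := hsub hx
      suffices hyx : y x ≤ 0 from
        le_antisymm ((hmax ⟨ht.1, le_min htn ht.2⟩).trans hyx) (hy0 t ht)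
      rcases le_or_gt x (n * (η / 2)) with hxn | hxn
      · exact (ih x hxT hxn).le
      have hs : (n * (η / 2) : ℝ) ∈ Icc 0 T := ⟨by positivity, hxn.le.trans hxT.2⟩
      have h0 : (0 : ℝ) ∈ Icc 0 T := ⟨le_rfl, ht.1.trans ht.2⟩
      have hx1 : x ≤ (n + 1 : ℕ) * (η / 2) := hx.2.trans (min_le_left _ _)
      have hκs := hsmall _ hs x hxT (by
        rw [abs_of_pos (sub_pos.2 hxn)]; push_cast at hx1; linarith)
      have e1 := intervalIntegral.integral_add_adjacent_intervals
        (intervalIntegrable_of_timeMeasure hκy h0 hs) (intervalIntegrable_of_timeMeasure hκy hs hxT)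
      have e2 : ∫ s in (0 : ℝ)..(n * (η / 2)), κ s * y s = 0 := by
        rw [intervalIntegral.integral_congr (g := fun _ => (0 : ℝ))]
        · simp
        intro s hs'
        rw [uIcc_of_le hs.1] at hs'
        simp [ih s ⟨hs'.1, hs'.2.trans hs.2⟩ hs'.2]
      have e3 : ∫ s in (n * (η / 2) : ℝ)..x, κ s * y s ≤
          ∫ s in (n * (η / 2) : ℝ)..x, κ s * y x := by
        refine intervalIntegral.integral_mono_ae_restrict hxn.le
          (intervalIntegrable_of_timeMeasure hκy hs hxT)
          ((intervalIntegrable_of_timeMeasure hκ hs hxT).mul_const _) ?_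
        have hle' : volume.restrict (Icc (n * (η / 2) : ℝ) x) ≤ timeMeasure T :=
          Measure.restrict_mono
            (show Icc (n * (η / 2) : ℝ) x ⊆ Icc 0 T from Icc_subset_Icc hs.1 hxT.2) le_rfl
        filter_upwards [ae_mono hle' hκ0, ae_restrict_mem measurableSet_Icc] with s hs1 hs2
        exact mul_le_mul_of_nonneg_left (hmax ⟨hs.1.trans hs2.1, hs2.2.trans hx.2⟩) hs1
      rw [intervalIntegral.integral_mul_const] at e3
      have h1 := hle x hxT
      have h2 := (abs_lt.1 hκs).2
      have h3 := hy0 x hxT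
      nlinarith
  intro t ht
  obtain ⟨n, hn⟩ := exists_nat_ge (t / (η / 2))
  exact key n t ht (by rwa [div_le_iff₀ (by positivity)] at hn)

end Gronwall

end LocallyMonotone

/-! ### Growth estimates and uniqueness -/

namespace LocallyMonotone

variable {V H : Type*} [NormedAddCommGroup V] [NormedSpace ℝ V]
  [MeasurableSpace V]
  [NormedAddCommGroup H] [InnerProductSpace ℝ H] {ι : V →L[ℝ] H}

/-- The standing assumptions on the operator, with a forcing term absorbed into it. -/
structure IsEvolutionOperator (ι : V →L[ℝ] H) (T α β δ K : ℝ) (f g : ℝ → ℝ) (ρ η : V → ℝ)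
    (A : ℝ → V → StrongDual ℝ V) : Prop where
  one_lt : 1 < α
  nonneg_exponent : 0 ≤ β
  pos : 0 < δ
  nonneg : 0 ≤ K
  integrable : Integrable f (timeMeasure T)
  memLp : MemLp g (ENNReal.ofReal (α / (α - 1))) (timeMeasure T)
  weight_left : IsAdmissibleWeight ρ
  weight_right : IsAdmissibleWeight η
  measurable : IsMeasurableOperator T A
  hemicontinuous : Hemicontinuous T A
  monotone : LocalMonotonicity ι T K ρ η A
  coercive : Coercivity ι T α δ K f A
  growth : ∀ t ∈ Icc 0 T, ∀ v : V, ‖A t v‖ ≤ (g t + K * ‖v‖ ^ (α - 1)) * (1 + ‖ι v‖ ^ β)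

theorem exists_young {p q : ℝ} (hpq : p.HolderConjugate q) {ε : ℝ} (hε : 0 < ε) :
    ∃ c : ℝ, 0 ≤ c ∧ ∀ x y : ℝ, 0 ≤ x → 0 ≤ y → x * y ≤ ε * x ^ p + c * y ^ q := by
  have hp := hpq.pos
  have hq := hpq.symm.pos
  -- Chosen so that l^p / p = ε when Young's inequality is applied to l x and y / l.
  set l := (p * ε) ^ (1 / p) with hl
  have hl0 : 0 < l := by positivity
  have hlp : l ^ p = p * ε := by
    rw [hl, ← Real.rpow_mul (by positivity), one_div, inv_mul_cancel₀ hp.ne', Real.rpow_one]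
  refine ⟨(1 / l) ^ q / q, by positivity, fun x y hx hy => ?_⟩
  have h := Real.young_inequality_of_nonneg (mul_nonneg hl0.le hx)
    (mul_nonneg (one_div_nonneg.2 hl0.le) hy) hpq
  rw [Real.mul_rpow hl0.le hx, Real.mul_rpow (by positivity) hy, hlp] at h
  calc x * y = l * x * (1 / l * y) := by field_simp
    _ ≤ _ := h
    _ = _ := by field_simp

omit [MeasurableSpace V] in
theorem IsWeakPrimitive.sub {p q T R₁ R₂ : ℝ} {v₁ v₂ : ℝ → V} {w₁ w₂ : ℝ → StrongDual ℝ V}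
    {u₁ u₂ : ℝ → H} (h₁ : IsWeakPrimitive ι p q T R₁ v₁ w₁ u₁)
    (h₂ : IsWeakPrimitive ι p q T R₂ v₂ w₂ u₂) (hpq : p.HolderConjugate q) :
    IsWeakPrimitive ι p q T (R₁ + R₂) (fun t => v₁ t - v₂ t) (fun t => w₁ t - w₂ t)
      (fun t => u₁ t - u₂ t) where
  memLp_left := h₁.memLp_left.sub h₂.memLp_left
  memLp_right := h₁.memLp_right.sub h₂.memLp_right
  integral_eq t ht z := by
    have h0 : (0 : ℝ) ∈ Icc 0 T := ⟨le_rfl, ht.1.trans ht.2⟩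
    have i1 := intervalIntegrable_of_timeMeasure
      ((h₁.integrable_right hpq).apply_continuousLinearMap z) h0 ht
    have i2 := intervalIntegrable_of_timeMeasure
      ((h₂.integrable_right hpq).apply_continuousLinearMap z) h0 ht
    simp only [sub_apply]
    rw [intervalIntegral.integral_sub i1 i2, h₁.integral_eq t ht z, h₂.integral_eq t ht z,
      ← inner_sub_left]
    congr 1
    abel
  norm_le t ht := (norm_sub_le _ _).trans (add_le_add (h₁.norm_le t ht) (h₂.norm_le t ht))
  ae_eq := by
    filter_upwards [h₁.ae_eq, h₂.ae_eq] with t h1 h2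
    rw [map_sub, h1, h2]

theorem integrable_norm_rpow {E : Type*} [NormedAddCommGroup E] {T p : ℝ} (hp : 0 < p)
    {v : ℝ → E} (hv : MemLp v (ENNReal.ofReal p) (timeMeasure T)) :
    Integrable (fun t => ‖v t‖ ^ p) (timeMeasure T) := by
  have := hv.integrable_norm_rpow (by simpa using hp) ENNReal.ofReal_ne_top
  simpa [ENNReal.toReal_ofReal hp.le] using this

namespace IsEvolutionOperator

variable {T α β δ K : ℝ} {f g : ℝ → ℝ} {ρ η : V → ℝ} {A : ℝ → V → StrongDual ℝ V}

theorem holderConjugate (hA : IsEvolutionOperator ι T α β δ K f g ρ η A) :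
    α.HolderConjugate (α / (α - 1)) :=
  Real.HolderConjugate.conjExponent hA.one_lt

/-- Since (α-1)q = α, the L^q norm of ‖v‖^(α-1) is a power of the L^α norm of v; the H-bound takes
care of the other factor. -/
theorem eLpNorm_le (hA : IsEvolutionOperator ι T α β δ K f g ρ η A) {v : ℝ → V} {R : ℝ}
    (hv : AEStronglyMeasurable v (timeMeasure T)) (hR : ∀ᵐ t ∂timeMeasure T, ‖ι (v t)‖ ≤ R) :
    eLpNorm (fun t => A t (v t)) (ENNReal.ofReal (α / (α - 1))) (timeMeasure T) ≤
      ENNReal.ofReal (1 + R ^ β) * (eLpNorm g (ENNReal.ofReal (α / (α - 1))) (timeMeasure T) +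
        ENNReal.ofReal K * eLpNorm v (ENNReal.ofReal α) (timeMeasure T) ^ (α - 1)) := by
  set q := α / (α - 1) with hq
  have hα := hA.one_lt
  have hα1 : 0 < α - 1 := by linarith
  have hq1 : 1 ≤ q := hA.holderConjugate.symm.lt.le
  have e1 : eLpNorm (fun t => ‖v t‖ ^ (α - 1)) (ENNReal.ofReal q) (timeMeasure T) =
      eLpNorm v (ENNReal.ofReal α) (timeMeasure T) ^ (α - 1) := by
    rw [eLpNorm_norm_rpow _ hα1, ← ENNReal.ofReal_mul (by linarith)]
    congr 3
    rw [hq]; field_simp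
  set F : ℝ → ℝ := fun t => g t + K * ‖v t‖ ^ (α - 1) with hF
  have hFle : eLpNorm F (ENNReal.ofReal q) (timeMeasure T) ≤
      eLpNorm g (ENNReal.ofReal q) (timeMeasure T) +
        ENNReal.ofReal K * eLpNorm v (ENNReal.ofReal α) (timeMeasure T) ^ (α - 1) := by
    have hm : AEStronglyMeasurable (fun t => K * ‖v t‖ ^ (α - 1)) (timeMeasure T) :=
      ((hv.norm.aemeasurable.pow_const _).const_mul K).aestronglyMeasurable
    refine (eLpNorm_add_le hA.memLp.1 hm (by simpa using hq1)).trans (add_le_add le_rfl ?_)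
    rw [← e1]
    have := eLpNorm_const_smul (p := ENNReal.ofReal q) (μ := timeMeasure T) K
      (fun t => ‖v t‖ ^ (α - 1))
    rw [Real.enorm_eq_ofReal hA.nonneg] at this
    exact this.le
  have hle : eLpNorm (fun t => A t (v t)) (ENNReal.ofReal q) (timeMeasure T) ≤
      eLpNorm ((1 + R ^ β) • F) (ENNReal.ofReal q) (timeMeasure T) := by
    refine eLpNorm_mono_ae ?_
    have hmem : ∀ᵐ t ∂timeMeasure T, t ∈ Icc 0 T := ae_restrict_mem measurableSet_Icc
    filter_upwards [hR, hmem] with t ht htm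
    refine (hA.growth t htm (v t)).trans ?_
    have hpow : ‖ι (v t)‖ ^ β ≤ R ^ β :=
      Real.rpow_le_rpow (norm_nonneg _) ht hA.nonneg_exponent
    have hb0 : 0 ≤ ‖ι (v t)‖ ^ β := by positivity
    calc (g t + K * ‖v t‖ ^ (α - 1)) * (1 + ‖ι (v t)‖ ^ β)
        ≤ |F t| * (1 + R ^ β) := by
          apply mul_le_mul (le_abs_self _) (by linarith) (by linarith) (abs_nonneg _)
      _ ≤ ‖((1 + R ^ β) • F) t‖ := by
          rw [Pi.smul_apply, smul_eq_mul, norm_mul, mul_comm, Real.norm_eq_abs, Real.norm_eq_abs]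
          gcongr
          exact le_abs_self _
  refine hle.trans ?_
  rw [eLpNorm_const_smul]
  rcases le_or_gt 0 (1 + R ^ β) with h0 | h0
  · rw [Real.enorm_eq_ofReal h0]
    gcongr
  -- A negative 1 + R^β forces R < 0, which `hR` allows only for the zero measure.
  · by_cases hne : timeMeasure T = 0
    · simp [hne]
    · exfalso
      have := ae_neBot.2 hne
      obtain ⟨t, ht⟩ := hR.exists
      have := Real.rpow_nonneg ((norm_nonneg _).trans ht) β
      linarith

theorem aestronglyMeasurable (hA : IsEvolutionOperator ι T α β δ K f g ρ η A) {v : ℝ → V}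
    (hv : MemLp v (ENNReal.ofReal α) (timeMeasure T)) :
    AEStronglyMeasurable (fun t => A t (v t)) (timeMeasure T) :=
  hA.measurable v (memLp_one_iff_integrable.2 (integrable_of_eLpNorm_le hA.one_lt.le hv))

theorem memLp_apply (hA : IsEvolutionOperator ι T α β δ K f g ρ η A) {v : ℝ → V} {R : ℝ}
    (hv : MemLp v (ENNReal.ofReal α) (timeMeasure T))
    (hR : ∀ᵐ t ∂timeMeasure T, ‖ι (v t)‖ ≤ R) :
    MemLp (fun t => A t (v t)) (ENNReal.ofReal (α / (α - 1))) (timeMeasure T) := by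
  refine ⟨hA.aestronglyMeasurable hv, (hA.eLpNorm_le hv.1 hR).trans_lt ?_⟩
  refine ENNReal.mul_lt_top ENNReal.ofReal_lt_top (ENNReal.add_lt_top.2 ⟨hA.memLp.2, ?_⟩)
  exact ENNReal.mul_lt_top ENNReal.ofReal_lt_top
    (ENNReal.rpow_lt_top_of_nonneg (by linarith [hA.one_lt]) hv.2.ne)

/-- A solution of the equation is a weak primitive of its right-hand side. -/
theorem exists_isWeakPrimitive (hA : IsEvolutionOperator ι T α β δ K f g ρ η A) (hT : 0 < T)
    {u : ℝ → H} {v : ℝ → V} (hv : MemLp v (ENNReal.ofReal α) (timeMeasure T))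
    (hu : ContinuousOn u (Icc 0 T)) (hae : ∀ᵐ t ∂timeMeasure T, ι (v t) = u t)
    (heq : HasGeneralizedDeriv T (fun t => toDual ι (u t)) fun t => A t (v t)) :
    ∃ R, IsWeakPrimitive ι α (α / (α - 1)) T R v (fun t => A t (v t)) u := by
  obtain ⟨R, hR⟩ := isCompact_Icc.exists_bound_of_continuousOn hu
  have hmem : ∀ᵐ t ∂timeMeasure T, t ∈ Icc 0 T := ae_restrict_mem measurableSet_Icc
  have hRae : ∀ᵐ t ∂timeMeasure T, ‖ι (v t)‖ ≤ R := by
    filter_upwards [hae, hmem] with t ht htm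
    rw [ht]; exact hR t htm
  have hw := hA.memLp_apply hv hRae
  have hwi := integrable_of_eLpNorm_le hA.holderConjugate.symm.lt.le hw
  refine ⟨R, hv, hw, fun t ht z => ?_, hR, hae⟩
  have h1 := heq.eq_add_integral hT
    (((toDualCLM ι).continuous.comp_continuousOn hu).congr fun t _ => rfl) t ht
  have h2 := congrArg (fun l : StrongDual ℝ V => l z) h1
  simp only [add_apply, toDual_apply] at h2
  have h0 : (0 : ℝ) ∈ Icc 0 T := ⟨le_rfl, hT.le⟩
  rw [ContinuousLinearMap.intervalIntegral_apply (intervalIntegrable_of_timeMeasure hwi h0 ht)]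
    at h2
  rw [inner_sub_left]
  linarith

variable [BorelSpace V] [CompleteSpace V]

/-- The energy equality for the difference and local monotonicity give a Grönwall inequality with
kernel 2(K + ρ(v₁) + η(v₂)). The bound on ρ + η makes the kernel integrable, because solutions are
bounded in H and lie in L^α(V). -/
theorem unique (hA : IsEvolutionOperator ι T α β δ K f g ρ η A) (hT : 0 < T)
    (hι : IsGelfandTriple ι) {C' γ : ℝ} (hγ : 0 ≤ γ)
    (hbound : ∀ z : V, ρ z + η z ≤ C' * (1 + ‖z‖ ^ α) * (1 + ‖ι z‖ ^ γ)) {R₁ R₂ : ℝ}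
    {u₁ u₂ : ℝ → H} {v₁ v₂ : ℝ → V}
    (h₁ : IsWeakPrimitive ι α (α / (α - 1)) T R₁ v₁ (fun t => A t (v₁ t)) u₁)
    (h₂ : IsWeakPrimitive ι α (α / (α - 1)) T R₂ v₂ (fun t => A t (v₂ t)) u₂)
    (h0 : u₁ 0 = u₂ 0) :
    EqOn u₁ u₂ (Icc 0 T) ∧ ∀ᵐ t ∂timeMeasure T, v₁ t = v₂ t := by
  have hpq := hA.holderConjugate
  have hα0 := hpq.pos
  have h := h₁.sub h₂ hpq
  have hmem : ∀ᵐ t ∂timeMeasure T, t ∈ Icc 0 T := ae_restrict_mem measurableSet_Icc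
  have hweight : ∀ (σ : V → ℝ), IsAdmissibleWeight σ → (∀ z, σ z ≤ ρ z + η z) →
      ∀ (R : ℝ) (u : ℝ → H) (v : ℝ → V) (w : ℝ → StrongDual ℝ V),
        IsWeakPrimitive ι α (α / (α - 1)) T R v w u →
        Integrable (fun t => σ (v t)) (timeMeasure T) := by
    intro σ hσ hσle R u v w hp
    have hdom : Integrable (fun t => |C'| * (1 + ‖v t‖ ^ α) * (1 + R ^ γ)) (timeMeasure T) :=
      (((integrable_const 1).add (integrable_norm_rpow hα0 hp.memLp_left)).const_mul _).mul_const _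
    refine hdom.mono' (hσ.measurable.comp_aemeasurable
      hp.memLp_left.1.aemeasurable).aestronglyMeasurable ?_
    filter_upwards [hp.ae_eq, hmem] with t ht htm
    rw [Real.norm_eq_abs, abs_of_nonneg (hσ.nonneg _)]
    refine (hσle _).trans ((hbound _).trans ?_)
    have e1 : ‖ι (v t)‖ ^ γ ≤ R ^ γ := by
      refine Real.rpow_le_rpow (norm_nonneg _) ?_ hγ
      rw [ht]; exact hp.norm_le t htm
    have e2 : 0 ≤ ‖ι (v t)‖ ^ γ := by positivity
    have e3 : 0 ≤ ‖v t‖ ^ α := by positivity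
    refine mul_le_mul (mul_le_mul_of_nonneg_right (le_abs_self _) (by linarith)) (by linarith)
      (by linarith) (by positivity)
  have hρi := hweight ρ hA.weight_left
    (fun z => le_add_of_nonneg_right (hA.weight_right.nonneg z)) _ _ _ _ h₁
  have hηi := hweight η hA.weight_right
    (fun z => le_add_of_nonneg_left (hA.weight_left.nonneg z)) _ _ _ _ h₂
  set κ : ℝ → ℝ := fun t => 2 * (K + ρ (v₁ t) + η (v₂ t)) with hκdef
  have hκ : Integrable κ (timeMeasure T) :=
    (((integrable_const K).add hρi).add hηi).const_mul 2
  have hκ0 : ∀ t, 0 ≤ κ t := fun t => by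
    have a1 := hA.nonneg
    have a2 := hA.weight_left.nonneg (v₁ t)
    have a3 := hA.weight_right.nonneg (v₂ t)
    positivity
  have hc := h.continuousOn hpq hι.denseRange
  have hy : ContinuousOn (fun t => ‖u₁ t - u₂ t‖ ^ 2) (Icc 0 T) := hc.norm.pow 2
  have hκy : Integrable (fun t => κ t * ‖u₁ t - u₂ t‖ ^ 2) (timeMeasure T) := by
    have hκI : IntegrableOn κ (Icc 0 T) := hκ
    exact hκI.mul_continuousOn hy isCompact_Icc
  have hzero := eq_zero_of_le_integral_mul hy (fun t _ => by positivity) hκ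
    (Eventually.of_forall hκ0) fun t ht => by
      have ht0 : (0 : ℝ) ∈ Icc 0 T := ⟨le_rfl, hT.le⟩
      have e := h.energy_eq hpq hι.denseRange ht
      simp only [h0, sub_self, norm_zero] at e
      rw [e, ← intervalIntegral.integral_const_mul]
      simp only [ne_eq, OfNat.ofNat_ne_zero, not_false_eq_true, zero_pow, zero_add]
      have hle' : volume.restrict (Icc 0 t) ≤ timeMeasure T := timeMeasure_mono ht.2
      refine intervalIntegral.integral_mono_ae_restrict ht.1
        ((intervalIntegrable_of_timeMeasure (h.integrable_apply hpq) ht0 ht).const_mul 2)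
        (intervalIntegrable_of_timeMeasure hκy ht0 ht) ?_
      filter_upwards [ae_mono hle' h.ae_eq, ae_mono hle' hmem] with s hs hsm
      have := hA.monotone s hsm (v₁ s) (v₂ s)
      rw [hs] at this
      simp only [hκdef]
      linarith
  have hEq : EqOn u₁ u₂ (Icc 0 T) := fun t ht => by
    have := hzero t ht
    simpa [sub_eq_zero] using this
  refine ⟨hEq, ?_⟩
  filter_upwards [h₁.ae_eq, h₂.ae_eq, hmem] with t ht1 ht2 htm
  exact hι.injective (by rw [ht1, ht2, hEq htm])

end IsEvolutionOperator

end LocallyMonotone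

/-! ### Explicit Euler–Galerkin approximations -/

namespace LocallyMonotone

section Euler

variable {V H : Type*} [NormedAddCommGroup V] [NormedSpace ℝ V]
  [NormedAddCommGroup H] [InnerProductSpace ℝ H] {ι : V →L[ℝ] H}

/-- The explicit Euler scheme with step `τ` for the Galerkin equation `y' = P A(t,y)`. -/
noncomputable def eulerSeq (P : StrongDual ℝ V →L[ℝ] V) (A : ℝ → V → StrongDual ℝ V) (τ : ℝ)
    (y₀ : V) : ℕ → V
  | 0 => y₀
  | k + 1 => eulerSeq P A τ y₀ k +
      P (∫ s in (k * τ : ℝ)..((k + 1 : ℕ) * τ : ℝ), A s (eulerSeq P A τ y₀ k))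

/-- The element P(toDual u₀) is the H-orthogonal projection of u₀ onto S. -/
theorem norm_galerkin_initial_le {S : Submodule ℝ V} {P : StrongDual ℝ V →L[ℝ] V}
    (hPS : ∀ w, P w ∈ S) (hP : ∀ w, ∀ z ∈ S, inner ℝ (ι (P w)) (ι z) = w z) (u₀ : H) :
    ‖ι (P (toDual ι u₀))‖ ≤ ‖u₀‖ := by
  have h := hP (toDual ι u₀) _ (hPS (toDual ι u₀))
  rw [real_inner_self_eq_norm_sq, toDual_apply] at h
  have h2 := real_inner_le_norm u₀ (ι (P (toDual ι u₀)))
  by_contra hlt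
  rw [not_le] at hlt
  nlinarith [norm_nonneg u₀]

variable [MeasurableSpace V] {T α β δ K : ℝ} {f g : ℝ → ℝ} {ρ η : V → ℝ}
  {A : ℝ → V → StrongDual ℝ V}

/-- The data of an explicit Euler–Galerkin scheme whose step is small compared to `θ`. -/
structure IsEulerScheme (ι : V →L[ℝ] H) (T R : ℝ) (A : ℝ → V → StrongDual ℝ V)
    (S : Submodule ℝ V) (P : StrongDual ℝ V →L[ℝ] V) (c θ : ℝ) (m : ℝ → ℝ) (N : ℕ) (τ : ℝ) :
    Prop where
  time_pos : 0 < T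
  step_pos : 0 < τ
  steps : N * τ = T
  mem : ∀ w, P w ∈ S
  inner_eq : ∀ w, ∀ z ∈ S, inner ℝ (ι (P w)) (ι z) = w z
  one_le : 1 ≤ c
  norm_le : ∀ w, ‖ι (P w)‖ ≤ c * ‖w‖
  integrable : Integrable m (timeMeasure T)
  bound : ∀ t ∈ Icc 0 T, ∀ z ∈ S, ‖ι z‖ ≤ R → ‖A t z‖ ≤ m t
  small : ∀ s ∈ Icc 0 T, ∀ t ∈ Icc 0 T, |t - s| ≤ τ → c * ∫ x in s..t, m x ≤ θ
  theta_pos : 0 < θ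
  nonneg : ∀ t, 0 ≤ m t

namespace IsEulerScheme

variable {R c θ τ : ℝ} {S : Submodule ℝ V} {P : StrongDual ℝ V →L[ℝ] V} {m : ℝ → ℝ} {N : ℕ}

omit [MeasurableSpace V] in
theorem node_mem (hE : IsEulerScheme ι T R A S P c θ m N τ) {k : ℕ} (hk : k ≤ N) :
    (k * τ : ℝ) ∈ Icc 0 T := by
  have hτ := hE.step_pos
  refine ⟨by positivity, ?_⟩
  rw [← hE.steps]
  gcongr

omit [MeasurableSpace V] in
theorem node_le (hE : IsEulerScheme ι T R A S P c θ m N τ) (k : ℕ) :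
    (k * τ : ℝ) ≤ ((k + 1 : ℕ) * τ : ℝ) := by
  have hτ := hE.step_pos
  gcongr
  simp

omit [MeasurableSpace V] in
theorem integral_split (hE : IsEulerScheme ι T R A S P c θ m N τ) {G : Type*}
    [NormedAddCommGroup G] [NormedSpace ℝ G] {φ : ℝ → G} (hφ : Integrable φ (timeMeasure T))
    {k : ℕ} (hk : k + 1 ≤ N) :
    ∫ s in (0 : ℝ)..((k + 1 : ℕ) * τ : ℝ), φ s =
      (∫ s in (0 : ℝ)..(k * τ : ℝ), φ s) + ∫ s in (k * τ : ℝ)..((k + 1 : ℕ) * τ : ℝ), φ s := by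
  have h0 : (0 : ℝ) ∈ Icc 0 T := ⟨le_rfl, hE.time_pos.le⟩
  exact (intervalIntegral.integral_add_adjacent_intervals
    (intervalIntegrable_of_timeMeasure hφ h0 (hE.node_mem (by omega)))
    (intervalIntegrable_of_timeMeasure hφ (hE.node_mem (by omega)) (hE.node_mem hk))).symm

omit [MeasurableSpace V] in
theorem mem_submodule (hE : IsEulerScheme ι T R A S P c θ m N τ) (u₀ : H) (k : ℕ) :
    eulerSeq P A τ (P (toDual ι u₀)) k ∈ S := by
  induction k with
  | zero => exact hE.mem _
  | succ k ih => exact S.add_mem ih (hE.mem _)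

theorem integrable_const (hE : IsEulerScheme ι T R A S P c θ m N τ)
    (hA : IsEvolutionOperator ι T α β δ K f g ρ η A) {z : V} (hz : z ∈ S) (hR : ‖ι z‖ ≤ R) :
    Integrable (fun t => A t z) (timeMeasure T) := by
  refine hE.integrable.mono' (hA.measurable (fun _ => z) (memLp_const z)) ?_
  exact (ae_restrict_mem measurableSet_Icc).mono fun t ht => hE.bound t ht z hz hR

/-- One step of the scheme: the square of the increment is small, and the cross term is the
integral of the duality product. -/
theorem step (hE : IsEulerScheme ι T R A S P c θ m N τ)
    (hA : IsEvolutionOperator ι T α β δ K f g ρ η A) {k : ℕ} (hk : k + 1 ≤ N) {z : V} (hz : z ∈ S)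
    (hR : ‖ι z‖ ≤ R) :
    ‖ι (z + P (∫ s in (k * τ : ℝ)..((k + 1 : ℕ) * τ : ℝ), A s z))‖ ^ 2 ≤ ‖ι z‖ ^ 2 +
      2 * (∫ s in (k * τ : ℝ)..((k + 1 : ℕ) * τ : ℝ), A s z z) +
      θ * (c * ∫ s in (k * τ : ℝ)..((k + 1 : ℕ) * τ : ℝ), m s) := by
  have ha := hE.node_mem (show k ≤ N by omega)
  have hb := hE.node_mem hk
  have hi := intervalIntegrable_of_timeMeasure (hE.integrable_const hA hz hR) ha hb
  have hmi := intervalIntegrable_of_timeMeasure hE.integrable ha hb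
  set w := ∫ s in (k * τ : ℝ)..((k + 1 : ℕ) * τ : ℝ), A s z with hw
  have h1 : inner ℝ (ι (P w)) (ι z) = ∫ s in (k * τ : ℝ)..((k + 1 : ℕ) * τ : ℝ), A s z z := by
    rw [hE.inner_eq _ _ hz, hw, ContinuousLinearMap.intervalIntegral_apply hi]
  have h2 : ‖w‖ ≤ ∫ s in (k * τ : ℝ)..((k + 1 : ℕ) * τ : ℝ), m s := by
    refine intervalIntegral.norm_integral_le_of_norm_le (hE.node_le k) ?_ hmi
    refine Eventually.of_forall fun t ht => hE.bound t ⟨ha.1.trans ht.1.le, ht.2.trans hb.2⟩ z hz hR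
  have hc : 0 ≤ c := zero_le_one.trans hE.one_le
  have h3 : ‖ι (P w)‖ ≤ c * ∫ s in (k * τ : ℝ)..((k + 1 : ℕ) * τ : ℝ), m s :=
    (hE.norm_le w).trans (by gcongr)
  have h4 := hE.small _ ha _ hb (by
    rw [abs_of_nonneg (sub_nonneg.2 (hE.node_le k))]; push_cast; linarith)
  -- The squared increment is at most (c ∫ m)²: one factor is bounded by θ, the other is kept
  -- because it sums over the steps to an integral over [0,T].
  rw [map_add, norm_add_sq_real, real_inner_comm, h1]
  nlinarith [norm_nonneg (ι (P w))]

/-- A discrete Grönwall argument with 1 + Kτ ≤ exp(Kτ). The bound m on A is available only in the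
H-ball of radius R, so the induction must also keep the iterates in it; this is why R² is the
right-hand side. The summand 1 pays for all squared increments. -/
theorem discrete_bound (hE : IsEulerScheme ι T R A S P c θ m N τ)
    (hA : IsEvolutionOperator ι T α β δ K f g ρ η A) {u₀ : H}
    (hR : R = √(Real.exp (K * T) * (‖u₀‖ ^ 2 + (∫ t in (0 : ℝ)..T, |f t|) + 1)))
    (hsum : θ * (c * ∫ t in (0 : ℝ)..T, m t) ≤ 1) {k : ℕ} (hk : k ≤ N) :
    ‖ι (eulerSeq P A τ (P (toDual ι u₀)) k)‖ ^ 2 +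
      δ * (τ * ∑ j ∈ Finset.range k, ‖eulerSeq P A τ (P (toDual ι u₀)) j‖ ^ α) ≤
      Real.exp (K * T) * (‖u₀‖ ^ 2 + (∫ t in (0 : ℝ)..T, |f t|) + 1) := by
  set y := eulerSeq P A τ (P (toDual ι u₀)) with hy
  have hK := hA.nonneg
  have hδ := hA.pos
  have hτ := hE.step_pos
  have hc : 0 ≤ c := zero_le_one.trans hE.one_le
  have hθ := hE.theta_pos
  have h0 : (0 : ℝ) ∈ Icc 0 T := ⟨le_rfl, hE.time_pos.le⟩
  have hTT : T ∈ Icc 0 T := ⟨hE.time_pos.le, le_rfl⟩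
  have hfi : Integrable (fun t => |f t|) (timeMeasure T) := hA.integrable.abs
  have hle : ∀ k ≤ N, Real.exp (K * (k * τ)) * (‖u₀‖ ^ 2 + (∫ t in (0 : ℝ)..(k * τ : ℝ), |f t|) +
      θ * (c * ∫ t in (0 : ℝ)..(k * τ : ℝ), m t)) ≤
      Real.exp (K * T) * (‖u₀‖ ^ 2 + (∫ t in (0 : ℝ)..T, |f t|) + 1) := by
    intro k hk
    have hkm := hE.node_mem hk
    have e1 : ∫ t in (0 : ℝ)..(k * τ : ℝ), |f t| ≤ ∫ t in (0 : ℝ)..T, |f t| :=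
      intervalIntegral.integral_mono_interval le_rfl hkm.1 hkm.2
        (Eventually.of_forall fun t => abs_nonneg _) (intervalIntegrable_of_timeMeasure hfi h0 hTT)
    have e2 : ∫ t in (0 : ℝ)..(k * τ : ℝ), m t ≤ ∫ t in (0 : ℝ)..T, m t :=
      intervalIntegral.integral_mono_interval le_rfl hkm.1 hkm.2
        (Eventually.of_forall hE.nonneg)
        (intervalIntegrable_of_timeMeasure hE.integrable h0 hTT)
    have e3 : θ * (c * ∫ t in (0 : ℝ)..(k * τ : ℝ), m t) ≤ 1 := le_trans (by gcongr) hsum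
    have e4 : 0 ≤ ∫ t in (0 : ℝ)..T, |f t| :=
      intervalIntegral.integral_nonneg hE.time_pos.le fun t _ => abs_nonneg _
    have e5 : 0 ≤ ‖u₀‖ ^ 2 := by positivity
    have e6 : Real.exp (K * (k * τ)) ≤ Real.exp (K * T) :=
      Real.exp_le_exp.2 (mul_le_mul_of_nonneg_left hkm.2 hK)
    calc _ ≤ Real.exp (K * (k * τ)) * (‖u₀‖ ^ 2 + (∫ t in (0 : ℝ)..T, |f t|) + 1) :=
          mul_le_mul_of_nonneg_left (by linarith) (Real.exp_nonneg _)
      _ ≤ _ := mul_le_mul_of_nonneg_right e6 (by linarith)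
  -- The induction runs on the sharper right-hand side at time kτ, which has the multiplicative form
  -- that one step reproduces.
  refine le_trans ?_ (hle k hk)
  induction k with
  | zero =>
    have := norm_galerkin_initial_le hE.mem hE.inner_eq u₀
    simp only [hy, eulerSeq, Finset.range_zero, Finset.sum_empty, Nat.cast_zero, zero_mul,
      intervalIntegral.integral_same, mul_zero, add_zero, Real.exp_zero, one_mul]
    exact pow_le_pow_left₀ (norm_nonneg _) this 2
  | succ k ih =>
    have hk' : k ≤ N := by omega
    have ih' := ih hk'
    have hsum0 : 0 ≤ δ * (τ * ∑ j ∈ Finset.range k, ‖y j‖ ^ α) := by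
      have : 0 ≤ ∑ j ∈ Finset.range k, ‖y j‖ ^ α := Finset.sum_nonneg fun j _ => by positivity
      positivity
    have hkR : ‖ι (y k)‖ ≤ R := by
      rw [hR]
      exact Real.le_sqrt_of_sq_le (by linarith [hle k hk'])
    have hkS : y k ∈ S := hE.mem_submodule u₀ k
    have hstep := hE.step hA hk hkS hkR
    have ha := hE.node_mem hk'
    have hb := hE.node_mem hk
    have hiA := intervalIntegrable_of_timeMeasure
      ((hE.integrable_const hA hkS hkR).apply_continuousLinearMap (y k)) ha hb
    have hif := intervalIntegrable_of_timeMeasure hfi ha hb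
    have hcoer : 2 * ∫ s in (k * τ : ℝ)..((k + 1 : ℕ) * τ : ℝ), A s (y k) (y k) ≤
        τ * (-δ * ‖y k‖ ^ α + K * ‖ι (y k)‖ ^ 2) +
          ∫ s in (k * τ : ℝ)..((k + 1 : ℕ) * τ : ℝ), |f s| := by
      have e : ∫ s in (k * τ : ℝ)..((k + 1 : ℕ) * τ : ℝ),
          ((-δ * ‖y k‖ ^ α + K * ‖ι (y k)‖ ^ 2) + |f s|) =
          τ * (-δ * ‖y k‖ ^ α + K * ‖ι (y k)‖ ^ 2) +
            ∫ s in (k * τ : ℝ)..((k + 1 : ℕ) * τ : ℝ), |f s| := by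
        rw [intervalIntegral.integral_add intervalIntegrable_const hif,
          intervalIntegral.integral_const, smul_eq_mul]
        push_cast
        ring
      rw [← e, ← intervalIntegral.integral_const_mul]
      refine intervalIntegral.integral_mono_on (hE.node_le k) (hiA.const_mul 2)
        (intervalIntegrable_const.add hif) fun s hs => ?_
      have := hA.coercive s ⟨ha.1.trans hs.1, hs.2.trans hb.2⟩ (y k)
      linarith [le_abs_self (f s)]
    have hyk : y (k + 1) = y k +
      P (∫ s in (k * τ : ℝ)..((k + 1 : ℕ) * τ : ℝ), A s (y k)) := rfl
    rw [← hyk] at hstep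
    rw [Finset.sum_range_succ, hE.integral_split hfi hk, hE.integral_split hE.integrable hk]
    set a := ‖ι (y k)‖ ^ 2
    set σk := ∑ j ∈ Finset.range k, ‖y j‖ ^ α
    set F := ∫ t in (0 : ℝ)..(k * τ : ℝ), |f t|
    set F' := ∫ s in (k * τ : ℝ)..((k + 1 : ℕ) * τ : ℝ), |f s| with hF'
    set I := ∫ t in (0 : ℝ)..(k * τ : ℝ), m t
    set I' := ∫ s in (k * τ : ℝ)..((k + 1 : ℕ) * τ : ℝ), m s with hI'
    have hF'0 : 0 ≤ F' := intervalIntegral.integral_nonneg (hE.node_le k) fun t _ => abs_nonneg _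
    have hI'0 : 0 ≤ I' := intervalIntegral.integral_nonneg (hE.node_le k) fun t _ => hE.nonneg t
    have hexp : Real.exp (K * ((k + 1 : ℕ) * τ)) = Real.exp (K * τ) * Real.exp (K * (k * τ)) := by
      rw [← Real.exp_add]; congr 1; push_cast; ring
    have hexp1 : 1 + K * τ ≤ Real.exp (K * τ) := by
      have := Real.add_one_le_exp (K * τ); linarith
    have hexp2 : 1 ≤ Real.exp (K * ((k + 1 : ℕ) * τ)) := Real.one_le_exp (by positivity)
    have ha0 : 0 ≤ a := by positivity
    have hD : 0 ≤ F' + θ * (c * I') := by positivity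
    have e1 : (1 + K * τ) * (a + δ * (τ * σk)) ≤ Real.exp (K * τ) * (Real.exp (K * (k * τ)) *
        (‖u₀‖ ^ 2 + F + θ * (c * I))) :=
      mul_le_mul hexp1 ih' (by positivity) (Real.exp_nonneg _)
    have e2 : F' + θ * (c * I') ≤ Real.exp (K * ((k + 1 : ℕ) * τ)) * (F' + θ * (c * I')) :=
      le_mul_of_one_le_left hD hexp2
    have e3 : 0 ≤ K * τ * (δ * (τ * σk)) := by positivity
    calc ‖ι (y (k + 1))‖ ^ 2 + δ * (τ * (σk + ‖y k‖ ^ α))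
        ≤ (1 + K * τ) * (a + δ * (τ * σk)) + (F' + θ * (c * I')) := by linarith
      _ ≤ Real.exp (K * τ) * (Real.exp (K * (k * τ)) * (‖u₀‖ ^ 2 + F + θ * (c * I))) +
          Real.exp (K * ((k + 1 : ℕ) * τ)) * (F' + θ * (c * I')) := add_le_add e1 e2
      _ = _ := by rw [hexp]; ring

omit [MeasurableSpace V] in
theorem floor_eq (hE : IsEulerScheme ι T R A S P c θ m N τ) {k : ℕ} {t : ℝ}
    (h1 : (k * τ : ℝ) ≤ t) (h2 : t < ((k + 1 : ℕ) * τ : ℝ)) : ⌊t / τ⌋₊ = k := by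
  have hτ := hE.step_pos
  have ht : 0 ≤ t := le_trans (by positivity) h1
  rw [Nat.floor_eq_iff (by positivity), le_div_iff₀ hτ, div_lt_iff₀ hτ]
  exact ⟨h1, by push_cast at h2; exact h2⟩

omit [MeasurableSpace V] in
theorem floor_spec (hE : IsEulerScheme ι T R A S P c θ m N τ) {t : ℝ} (ht : t ∈ Icc 0 T) :
    ⌊t / τ⌋₊ ≤ N ∧ (⌊t / τ⌋₊ * τ : ℝ) ≤ t ∧ t ≤ ⌊t / τ⌋₊ * τ + τ := by
  have hτ := hE.step_pos
  have h0 : 0 ≤ t / τ := div_nonneg ht.1 hτ.le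
  refine ⟨?_, ?_, ?_⟩
  · have : t / τ ≤ N := by rw [div_le_iff₀ hτ, hE.steps]; exact ht.2
    exact_mod_cast (Nat.floor_le h0).trans this
  · rw [← le_div_iff₀ hτ]; exact Nat.floor_le h0
  · have := (Nat.lt_floor_add_one (t / τ)).le
    rw [div_le_iff₀ hτ] at this
    linarith

omit [MeasurableSpace V] in
theorem integral_step (hE : IsEulerScheme ι T R A S P c θ m N τ) {G : Type*}
    [NormedAddCommGroup G] [NormedSpace ℝ G] (y : ℕ → V) (φ : ℝ → V → G) (k : ℕ) :
    ∫ s in (k * τ : ℝ)..((k + 1 : ℕ) * τ : ℝ), φ s (y ⌊s / τ⌋₊) =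
      ∫ s in (k * τ : ℝ)..((k + 1 : ℕ) * τ : ℝ), φ s (y k) := by
  refine intervalIntegral.integral_congr_Ioo_of_le (hE.node_le k) fun s hs => ?_
  simp only [hE.floor_eq hs.1.le hs.2]

omit [NormedSpace ℝ V] [MeasurableSpace V] in
theorem stronglyMeasurable_step (y : ℕ → V) (τ : ℝ) :
    StronglyMeasurable fun t : ℝ => y ⌊t / τ⌋₊ := by
  have h1 : Measurable fun t : ℝ => ⌊t / τ⌋₊ := Nat.measurable_floor.comp (measurable_id.div_const τ)
  exact (StronglyMeasurable.of_discrete (f := y)).comp_measurable h1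

/-- For the piecewise constant interpolation, the integrals of A(s,x(s)) are exactly the increments
that the scheme adds. The projected equation is thus exact at the nodes, and between nodes the error
is the integral over a part of one step, at most θ‖z‖. -/
theorem exists_step_function (hE : IsEulerScheme ι T R A S P c θ m N τ)
    (hA : IsEvolutionOperator ι T α β δ K f g ρ η A) {u₀ : H}
    (hR : R = √(Real.exp (K * T) * (‖u₀‖ ^ 2 + (∫ t in (0 : ℝ)..T, |f t|) + 1)))
    (hsum : θ * (c * ∫ t in (0 : ℝ)..T, m t) ≤ 1) :
    ∃ x : ℝ → V, StronglyMeasurable x ∧ (∃ B, ∀ t ∈ Icc 0 T, ‖x t‖ ≤ B) ∧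
      (∀ t ∈ Icc 0 T, ‖ι (x t)‖ ≤ R) ∧
      (∫ t in (0 : ℝ)..T, ‖x t‖ ^ α ≤
        Real.exp (K * T) * (‖u₀‖ ^ 2 + (∫ t in (0 : ℝ)..T, |f t|) + 1) / δ) ∧
      (∀ t ∈ Icc 0 T, ∀ z ∈ S,
        |inner ℝ (ι (x t) - u₀) (ι z) - ∫ s in (0 : ℝ)..t, A s (x s) z| ≤ θ * ‖z‖) ∧
      ‖ι (x T)‖ ^ 2 ≤ ‖u₀‖ ^ 2 + 2 * (∫ s in (0 : ℝ)..T, A s (x s) (x s)) +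
        θ * (c * ∫ t in (0 : ℝ)..T, m t) := by
  have hτ := hE.step_pos
  have hα0 : 0 < α := hA.holderConjugate.pos
  have hc : 0 ≤ c := zero_le_one.trans hE.one_le
  have h0 : (0 : ℝ) ∈ Icc 0 T := ⟨le_rfl, hE.time_pos.le⟩
  have hTT : T ∈ Icc 0 T := ⟨hE.time_pos.le, le_rfl⟩
  have hmem : ∀ᵐ t ∂timeMeasure T, t ∈ Icc 0 T := ae_restrict_mem measurableSet_Icc
  have hdisc := fun k hk => hE.discrete_bound hA hR hsum (k := k) hk
  set y := eulerSeq P A τ (P (toDual ι u₀)) with hy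
  set Q := Real.exp (K * T) * (‖u₀‖ ^ 2 + (∫ t in (0 : ℝ)..T, |f t|) + 1) with hQ
  have hyS : ∀ k, y k ∈ S := hE.mem_submodule u₀
  have hyR : ∀ k ≤ N, ‖ι (y k)‖ ≤ R := fun k hk => by
    rw [hR]
    refine Real.le_sqrt_of_sq_le ((le_add_of_nonneg_right ?_).trans (hdisc k hk))
    have h1 := hA.pos
    have h2 : 0 ≤ ∑ j ∈ Finset.range k, ‖y j‖ ^ α := Finset.sum_nonneg fun j _ => by positivity
    positivity
  set x : ℝ → V := fun t => y ⌊t / τ⌋₊ with hx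
  have hxm : StronglyMeasurable x := stronglyMeasurable_step y τ
  have hxR : ∀ t ∈ Icc 0 T, ‖ι (x t)‖ ≤ R := fun t ht => hyR _ (hE.floor_spec ht).1
  have hxS : ∀ t, x t ∈ S := fun t => hyS _
  have hxB : ∀ t ∈ Icc 0 T, ‖x t‖ ≤ ∑ k ∈ Finset.range (N + 1), ‖y k‖ := fun t ht =>
    Finset.single_le_sum (f := fun k => ‖y k‖) (fun k _ => norm_nonneg _)
      (Finset.mem_range.2 (Nat.lt_succ_of_le (hE.floor_spec ht).1))
  have hxp : MemLp x (ENNReal.ofReal α) (timeMeasure T) :=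
    MemLp.of_bound hxm.aestronglyMeasurable _ (hmem.mono hxB)
  have hwi : Integrable (fun s => A s (x s)) (timeMeasure T) :=
    hE.integrable.mono' (hA.aestronglyMeasurable hxp)
      (hmem.mono fun t ht => hE.bound t ht _ (hxS t) (hxR t ht))
  have hwxi : Integrable (fun s => A s (x s) (x s)) (timeMeasure T) := by
    refine (hE.integrable.mul_const (∑ k ∈ Finset.range (N + 1), ‖y k‖)).mono'
      ((ContinuousLinearMap.id ℝ (StrongDual ℝ V)).aestronglyMeasurable_comp₂ hwi.1
        hxm.aestronglyMeasurable) (hmem.mono fun t ht => ?_)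
    exact ((A t (x t)).le_opNorm _).trans (mul_le_mul (hE.bound t ht _ (hxS t) (hxR t ht))
      (hxB t ht) (norm_nonneg _) (hE.nonneg t))
  have hxi := integrable_norm_rpow hα0 hxp
  have hprim : ∀ k ≤ N, y k = y 0 + P (∫ s in (0 : ℝ)..(k * τ : ℝ), A s (x s)) := by
    intro k
    induction k with
    | zero => simp
    | succ k ih =>
      intro hk
      rw [hE.integral_split hwi hk, map_add, ← add_assoc, ← ih (by omega),
        hE.integral_step y A k]
      rfl
  have henergy : ∀ k ≤ N, ‖ι (y k)‖ ^ 2 ≤ ‖u₀‖ ^ 2 +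
      2 * (∫ s in (0 : ℝ)..(k * τ : ℝ), A s (x s) (x s)) +
        θ * (c * ∫ s in (0 : ℝ)..(k * τ : ℝ), m s) := by
    intro k
    induction k with
    | zero =>
      intro _
      have := norm_galerkin_initial_le hE.mem hE.inner_eq u₀
      simp only [hy, eulerSeq, Nat.cast_zero, zero_mul, intervalIntegral.integral_same, mul_zero,
        add_zero]
      exact pow_le_pow_left₀ (norm_nonneg _) this 2
    | succ k ih =>
      intro hk
      have h1 := ih (by omega)
      have h2 := hE.step hA hk (hyS k) (hyR k (by omega))
      rw [hE.integral_split hwxi hk, hE.integral_split hE.integrable hk,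
        hE.integral_step y (fun s v => A s v v) k]
      have h3 : y (k + 1) = y k +
        P (∫ s in (k * τ : ℝ)..((k + 1 : ℕ) * τ : ℝ), A s (y k)) := rfl
      rw [← h3] at h2
      linarith
  have hpow : ∀ k ≤ N, ∫ s in (0 : ℝ)..(k * τ : ℝ), ‖x s‖ ^ α =
      τ * ∑ j ∈ Finset.range k, ‖y j‖ ^ α := by
    intro k
    induction k with
    | zero => simp
    | succ k ih =>
      intro hk
      rw [hE.integral_split hxi hk, ih (by omega),
        hE.integral_step y (fun _ v => ‖v‖ ^ α) k, intervalIntegral.integral_const,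
        Finset.sum_range_succ, smul_eq_mul]
      push_cast
      ring
  -- At t = T the floor is exactly N, so the step function ends at the last iterate, to which the
  -- energy estimate applies.
  have hxT : x T = y N := by
    have : T / τ = N := by rw [div_eq_iff hτ.ne', hE.steps]
    simp [hx, this]
  refine ⟨x, hxm, ⟨_, hxB⟩, hxR, ?_, ?_, ?_⟩
  · have h1 := hpow N le_rfl
    rw [hE.steps] at h1
    rw [h1, le_div_iff₀ hA.pos, mul_comm]
    refine le_trans (le_add_of_nonneg_left (by positivity)) (hdisc N le_rfl)
  · intro t ht z hz
    obtain ⟨hk, hkt, htk⟩ := hE.floor_spec ht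
    have hkm := hE.node_mem hk
    have hi1 := intervalIntegrable_of_timeMeasure hwi h0 hkm
    have hiz := hwi.apply_continuousLinearMap z
    have e1 : inner ℝ (ι (x t) - u₀) (ι z) =
        ∫ s in (0 : ℝ)..(⌊t / τ⌋₊ * τ : ℝ), A s (x s) z := by
      have e2 : x t = y 0 + P (∫ s in (0 : ℝ)..(⌊t / τ⌋₊ * τ : ℝ), A s (x s)) := hprim _ hk
      have e3 : inner ℝ (ι (y 0)) (ι z) = inner ℝ u₀ (ι z) := hE.inner_eq _ z hz
      rw [e2, map_add, inner_sub_left, inner_add_left, e3, hE.inner_eq _ z hz,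
        ContinuousLinearMap.intervalIntegral_apply hi1]
      ring
    have e4 := intervalIntegral.integral_add_adjacent_intervals
      (intervalIntegrable_of_timeMeasure hiz h0 hkm) (intervalIntegrable_of_timeMeasure hiz hkm ht)
    have e5 : |∫ s in (⌊t / τ⌋₊ * τ : ℝ)..t, A s (x s) z| ≤
        ∫ s in (⌊t / τ⌋₊ * τ : ℝ)..t, m s * ‖z‖ := by
      rw [← Real.norm_eq_abs]
      refine intervalIntegral.norm_integral_le_of_norm_le hkt ?_
        ((intervalIntegrable_of_timeMeasure hE.integrable hkm ht).mul_const _)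
      refine Eventually.of_forall fun s hs => ?_
      have hs' : s ∈ Icc 0 T := ⟨hkm.1.trans hs.1.le, hs.2.trans ht.2⟩
      exact (A s (x s)).le_of_opNorm_le (hE.bound s hs' _ (hxS s) (hxR s hs')) z
    have e6 := hE.small _ hkm t ht (by rw [abs_of_nonneg (sub_nonneg.2 hkt)]; linarith)
    have e7 : 0 ≤ ∫ s in (⌊t / τ⌋₊ * τ : ℝ)..t, m s :=
      intervalIntegral.integral_nonneg hkt fun s _ => hE.nonneg s
    rw [intervalIntegral.integral_mul_const] at e5
    rw [e1, ← e4, sub_add_cancel_left, abs_neg]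
    refine e5.trans (mul_le_mul_of_nonneg_right (le_trans ?_ e6) (norm_nonneg _))
    exact le_mul_of_one_le_left e7 hE.one_le
  · have := henergy N le_rfl
    rwa [hE.steps, ← hxT] at this

end IsEulerScheme

/-- Approximate solutions with values in a finite-dimensional subspace. -/
theorem IsEvolutionOperator.exists_galerkin_approx
    (hA : IsEvolutionOperator ι T α β δ K f g ρ η A) (hT : 0 < T)
    (hinj : Function.Injective ι) (S : Submodule ℝ V) [FiniteDimensional ℝ S] (u₀ : H) {ε : ℝ}
    (hε : 0 < ε) :
    ∃ x : ℝ → V, StronglyMeasurable x ∧ (∃ B, ∀ t ∈ Icc 0 T, ‖x t‖ ≤ B) ∧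
      (∀ t ∈ Icc 0 T, ‖ι (x t)‖ ≤
        √(Real.exp (K * T) * (‖u₀‖ ^ 2 + (∫ t in (0 : ℝ)..T, |f t|) + 1))) ∧
      (∫ t in (0 : ℝ)..T, ‖x t‖ ^ α ≤
        Real.exp (K * T) * (‖u₀‖ ^ 2 + (∫ t in (0 : ℝ)..T, |f t|) + 1) / δ) ∧
      (∀ t ∈ Icc 0 T, ∀ z ∈ S,
        |inner ℝ (ι (x t) - u₀) (ι z) - ∫ s in (0 : ℝ)..t, A s (x s) z| ≤ ε * ‖z‖) ∧
      ‖ι (x T)‖ ^ 2 ≤ ‖u₀‖ ^ 2 + 2 * (∫ s in (0 : ℝ)..T, A s (x s) (x s)) + ε := by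
  obtain ⟨P, hPS, hP⟩ := exists_galerkin_projection hinj S
  set R := √(Real.exp (K * T) * (‖u₀‖ ^ 2 + (∫ t in (0 : ℝ)..T, |f t|) + 1)) with hR
  have hR0 : 0 ≤ R := Real.sqrt_nonneg _
  have hα1 : 0 < α - 1 := by linarith [hA.one_lt]
  -- P ∘ toDual ∘ ι is the identity on S, so d bounds the V-norm by the H-norm there.
  set d := ‖P‖ * ‖toDualCLM ι‖ with hd
  have hd0 : 0 ≤ d := by positivity
  have hSnorm : ∀ z ∈ S, ‖z‖ ≤ d * ‖ι z‖ := by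
    intro z hz
    have h1 : P (toDualCLM ι (ι z)) = z := by
      have h2 : P (toDualCLM ι (ι z)) - z ∈ S := S.sub_mem (hPS _) hz
      have h3 : ι (P (toDualCLM ι (ι z)) - z) = 0 := by
        rw [← inner_self_eq_zero (𝕜 := ℝ)]
        conv_lhs => rw [map_sub, inner_sub_left, ← map_sub]
        rw [hP _ _ h2, toDualCLM_apply, toDual_apply, sub_self]
      exact sub_eq_zero.1 (hinj (h3.trans (map_zero ι).symm))
    calc ‖z‖ = ‖P (toDualCLM ι (ι z))‖ := by rw [h1]
      _ ≤ ‖P‖ * (‖toDualCLM ι‖ * ‖ι z‖) := P.le_opNorm_of_le ((toDualCLM ι).le_opNorm _)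
      _ = d * ‖ι z‖ := by ring
  set c := ‖ι‖ * ‖P‖ + 1 with hc
  have hc0 : 0 < c := by positivity
  -- An integrable majorant of ‖A(t,z)‖ for z in S with ‖ι z‖ ≤ R. It depends on S, but the final
  -- estimates do not.
  set m : ℝ → ℝ := fun t => (|g t| + K * (d * R) ^ (α - 1)) * (1 + R ^ β) with hm
  have hmi : Integrable m (timeMeasure T) := by
    have hg := integrable_of_eLpNorm_le hA.holderConjugate.symm.lt.le hA.memLp
    exact (hg.abs.add (integrable_const _)).mul_const _
  have hK := hA.nonneg
  have hm0 : ∀ t, 0 ≤ m t := fun t => by positivity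
  set L := c * ∫ t in (0 : ℝ)..T, m t with hL
  have hL0 : 0 ≤ L := mul_nonneg hc0.le (intervalIntegral.integral_nonneg hT.le fun t _ => hm0 t)
  -- This gives θ ≤ ε for the equation, θL ≤ ε for the energy, and θL ≤ 1 for the discrete bound.
  set θ := min ε 1 / (L + 1) with hθ
  have hθ0 : 0 < θ := by positivity
  have hθL : θ * L ≤ min ε 1 := by
    rw [hθ, div_mul_eq_mul_div, div_le_iff₀ (by linarith)]
    have : 0 < min ε 1 := by positivity
    nlinarith
  have hθε : θ ≤ ε := by
    rw [hθ, div_le_iff₀ (by linarith)]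
    nlinarith [min_le_left ε 1]
  obtain ⟨κ, hκ, hsmall⟩ := exists_pos_forall_integral_lt hmi (show 0 < θ / c by positivity)
  obtain ⟨N, hN⟩ := exists_nat_gt (T / κ)
  have hN0 : (0 : ℝ) < N := lt_trans (by positivity) hN
  have hE : IsEulerScheme ι T R A S P c θ m N (T / N) :=
    { time_pos := hT
      step_pos := by positivity
      steps := by field_simp
      mem := hPS
      inner_eq := hP
      one_le := by have : 0 ≤ ‖ι‖ * ‖P‖ := by positivity
                   linarith
      norm_le := fun w => by
        calc ‖ι (P w)‖ ≤ ‖ι‖ * (‖P‖ * ‖w‖) := ι.le_opNorm_of_le (P.le_opNorm w)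
          _ ≤ c * ‖w‖ := by rw [hc, add_mul, one_mul]; nlinarith [norm_nonneg w]
      integrable := hmi
      bound := fun t ht z hz hzR => by
        refine (hA.growth t ht z).trans ?_
        have h1 : ‖z‖ ^ (α - 1) ≤ (d * R) ^ (α - 1) :=
          Real.rpow_le_rpow (norm_nonneg _) ((hSnorm z hz).trans (by gcongr)) hα1.le
        have h2 : ‖ι z‖ ^ β ≤ R ^ β := Real.rpow_le_rpow (norm_nonneg _) hzR hA.nonneg_exponent
        have h3 := le_abs_self (g t)
        refine mul_le_mul (by gcongr) (by linarith) (by positivity) (by positivity)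
      small := fun s hs t ht hst => by
        have h1 : |t - s| < κ := by
          refine hst.trans_lt ?_
          rw [div_lt_iff₀ hN0]
          rw [div_lt_iff₀ hκ] at hN
          linarith
        have h2 := (abs_lt.1 (hsmall s hs t ht h1)).2.le
        rw [le_div_iff₀ hc0] at h2
        linarith
      theta_pos := hθ0
      nonneg := hm0 }
  obtain ⟨x, hx1, hx2, hx3, hx4, hx5, hx6⟩ := hE.exists_step_function hA hR
    (hθL.trans (min_le_right _ _))
  refine ⟨x, hx1, hx2, hx3, hx4, fun t ht z hz => (hx5 t ht z hz).trans (by gcongr), ?_⟩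
  exact hx6.trans (by linarith [min_le_left ε 1])

end Euler

end LocallyMonotone

/-! ### Compactness of the approximations -/

/-- A pointwise bounded equicontinuous sequence of functions on a separable space has a pointwise
convergent subsequence. -/
theorem exists_subseq_tendsto_of_equicontinuous {X : Type*} [TopologicalSpace X]
    [TopologicalSpace.SeparableSpace X] {F : ℕ → X → ℝ} (hF : ∀ x, ∃ B, ∀ n, |F n x| ≤ B)
    (hequi : ∀ x, ∃ b : X → ℝ, Tendsto b (𝓝 x) (𝓝 0) ∧ ∀ n y, |F n x - F n y| ≤ b y) :
    ∃ φ : ℕ → ℕ, StrictMono φ ∧ ∀ x, ∃ l, Tendsto (fun n => F (φ n) x) atTop (𝓝 l) := by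
  rcases isEmpty_or_nonempty X with hX | hX
  · exact ⟨id, strictMono_id, fun x => (hX.false x).elim⟩
  choose B hB using hF
  set d := TopologicalSpace.denseSeq X
  -- Sequential compactness of a countable product of intervals plays the role of the diagonal
  -- extraction.
  obtain ⟨a, -, φ, hφ, ha⟩ := (isCompact_univ_pi (fun i : ℕ =>
    isCompact_Icc (a := -B (d i)) (b := B (d i)))).tendsto_subseq (x := fun n i => F n (d i))
      (fun n i _ => abs_le.1 (hB (d i) n))
  rw [tendsto_pi_nhds] at ha
  refine ⟨φ, hφ, fun x => cauchySeq_tendsto_of_complete ?_⟩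
  rw [Metric.cauchySeq_iff]
  intro ε hε
  obtain ⟨b, hb, hFb⟩ := hequi x
  obtain ⟨i, hi⟩ : ∃ i, b (d i) < ε / 4 := by
    have hev := hb.eventually (gt_mem_nhds (show (0 : ℝ) < ε / 4 by linarith))
    obtain ⟨y, ⟨i, rfl⟩, hy⟩ :=
      (TopologicalSpace.denseRange_denseSeq X).inter_nhds_nonempty hev
    exact ⟨i, hy⟩
  obtain ⟨N, hN⟩ := Metric.cauchySeq_iff.1 (ha i).cauchySeq (ε / 4) (by linarith)
  refine ⟨N, fun m hm n hn => ?_⟩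
  have h1 := hN m hm n hn
  simp only [Function.comp_apply] at h1
  rw [Real.dist_eq] at h1 ⊢
  have h2 := abs_le.1 (hFb (φ m) (d i))
  have h3 := abs_le.1 (hFb (φ n) (d i))
  have h4 := abs_lt.1 h1
  rw [abs_lt]
  constructor <;> linarith [h2.1, h2.2, h3.1, h3.2, h4.1, h4.2]

namespace LocallyMonotone

variable {V H : Type*} [NormedAddCommGroup V] [NormedSpace ℝ V]
  [NormedAddCommGroup H] [InnerProductSpace ℝ H] {ι : V →L[ℝ] H}

/-- The primitives are equicontinuous on the separable space [0,T] × V, hence one subsequence serves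
all t and z. No weak limit in L^q(V*) is needed. -/
theorem exists_subseq_tendsto_integral [TopologicalSpace.SeparableSpace V] {p q T : ℝ}
    (hpq : p.HolderConjugate q) {w : ℕ → ℝ → StrongDual ℝ V} {M : ℝ≥0∞} (hMtop : M ≠ ⊤)
    (hw : ∀ n, AEStronglyMeasurable (w n) (timeMeasure T))
    (hM : ∀ n, eLpNorm (w n) (ENNReal.ofReal q) (timeMeasure T) ≤ M) :
    ∃ φ : ℕ → ℕ, StrictMono φ ∧ ∀ t ∈ Icc 0 T, ∀ z, ∃ l,
      Tendsto (fun n => ∫ s in (0 : ℝ)..t, w (φ n) s z) atTop (𝓝 l) := by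
  have hi : ∀ n z, Integrable (fun s => w n s z) (timeMeasure T) := fun n z =>
    (integrable_of_eLpNorm_le hpq.symm.lt.le ⟨hw n, (hM n).trans_lt hMtop.lt_top⟩
      ).apply_continuousLinearMap z
  have key := exists_subseq_tendsto_of_equicontinuous (X := Icc (0 : ℝ) T × V)
    (F := fun n y => ∫ s in (0 : ℝ)..(y.1 : ℝ), w n s y.2) ?_ ?_
  · obtain ⟨φ, hφ, h⟩ := key
    exact ⟨φ, hφ, fun t ht z => h (⟨t, ht⟩, z)⟩
  · rintro ⟨⟨t, ht⟩, z⟩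
    exact ⟨_, fun n => norm_integral_apply_le hpq (hw n) hMtop (hM n) le_rfl ht.1 ht.2 z⟩
  · rintro ⟨⟨t, ht⟩, z⟩
    refine ⟨fun y => ‖z - y.2‖ * (M.toReal * (T - 0) ^ (1 / p)) +
      ‖z‖ * (M.toReal * |(y.1 : ℝ) - t| ^ (1 / p)), ?_, ?_⟩
    · have h1 : Tendsto (fun y : Icc (0 : ℝ) T × V => ‖z‖ * (M.toReal * |(y.1 : ℝ) - t| ^ (1 / p)))
          (𝓝 (⟨t, ht⟩, z)) (𝓝 0) := by
        refine (tendsto_holder_modulus hpq.pos ‖z‖ M.toReal t).comp ?_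
        exact (continuous_subtype_val.comp continuous_fst).tendsto' _ _ rfl
      have h2 : Tendsto (fun y : Icc (0 : ℝ) T × V => ‖z - y.2‖ * (M.toReal * (T - 0) ^ (1 / p)))
          (𝓝 (⟨t, ht⟩, z)) (𝓝 0) := by
        refine Continuous.tendsto' (by fun_prop) _ _ (by simp)
      simpa using h2.add h1
    · rintro n ⟨⟨t', ht'⟩, z'⟩
      have h0 : (0 : ℝ) ∈ Icc 0 T := ⟨le_rfl, ht.1.trans ht.2⟩
      have e1 : (∫ s in (0 : ℝ)..t, w n s z) - ∫ s in (0 : ℝ)..t', w n s z' =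
          (∫ s in (0 : ℝ)..t', w n s (z - z')) - ∫ s in t..t', w n s z := by
        simp only [map_sub]
        rw [intervalIntegral.integral_sub (intervalIntegrable_of_timeMeasure (hi n z) h0 ht')
          (intervalIntegrable_of_timeMeasure (hi n z') h0 ht'),
          ← intervalIntegral.integral_add_adjacent_intervals
            (intervalIntegrable_of_timeMeasure (hi n z) h0 ht)
            (intervalIntegrable_of_timeMeasure (hi n z) ht ht')]
        ring
      have e2 := norm_integral_apply_le hpq (hw n) hMtop (hM n) le_rfl ht'.1 ht'.2 (z - z')
      have e3 : |∫ s in t..t', w n s z| ≤ ‖z‖ * (M.toReal * |t' - t| ^ (1 / p)) := by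
        rcases le_total t t' with htt | htt
        · rw [abs_of_nonneg (sub_nonneg.2 htt)]
          exact norm_integral_apply_le hpq (hw n) hMtop (hM n) ht.1 htt ht'.2 z
        · rw [intervalIntegral.integral_symm, abs_neg, abs_sub_comm t' t,
            abs_of_nonneg (sub_nonneg.2 htt)]
          exact norm_integral_apply_le hpq (hw n) hMtop (hM n) ht'.1 htt ht.2 z
      have e4 : (t' - 0) ^ (1 / p) ≤ (T - 0) ^ (1 / p) :=
        Real.rpow_le_rpow (by linarith [ht'.1]) (by linarith [ht'.2])
          (by have := hpq.pos; positivity)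
      simp only
      rw [e1]
      refine (abs_sub _ _).trans (add_le_add (e2.trans ?_) e3)
      gcongr

/-- A bounded family of almost solutions, and its weak limit. -/
structure IsGalerkinLimit (ι : V →L[ℝ] H) (T α R : ℝ) (M : ℝ≥0∞) (A : ℝ → V → StrongDual ℝ V)
    (u₀ : H) (x : ℕ → ℝ → V) (u : ℝ → H) (v : ℝ → V) : Prop where
  ne_top : M ≠ ⊤
  memLp : ∀ n, MemLp (x n) (ENNReal.ofReal α) (timeMeasure T)
  norm_le : ∀ n, ∀ t ∈ Icc 0 T, ‖ι (x n t)‖ ≤ R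
  norm_limit_le : ∀ t ∈ Icc 0 T, ‖u t‖ ≤ R
  weak : ∀ t ∈ Icc 0 T, ∀ h,
    Tendsto (fun n => inner ℝ (ι (x n t)) h) atTop (𝓝 (inner ℝ (u t) h))
  eLpNorm_le : ∀ n, eLpNorm (fun t => A t (x n t)) (ENNReal.ofReal (α / (α - 1)))
    (timeMeasure T) ≤ M
  integral : ∀ t ∈ Icc 0 T, ∀ z, Tendsto (fun n => ∫ s in (0 : ℝ)..t, A s (x n s) z) atTop
    (𝓝 (inner ℝ (u t - u 0) (ι z)))
  initial : u 0 = u₀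
  energy : ∀ ε > 0, ∀ᶠ n in atTop,
    ‖ι (x n T)‖ ^ 2 ≤ ‖u₀‖ ^ 2 + 2 * (∫ s in (0 : ℝ)..T, A s (x n s) (x n s)) + ε
  memLp_limit : MemLp v (ENNReal.ofReal α) (timeMeasure T)
  ae_eq : ∀ᵐ t ∂timeMeasure T, ι (v t) = u t

variable [MeasurableSpace V] [BorelSpace V]

/-- Weak pointwise limits in `H` of sequences bounded in `L^p(0,T;V)` belong to `L^p(0,T;V)`. -/
theorem exists_memLp_of_weak_limit [CompleteSpace V] [TopologicalSpace.SeparableSpace H]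
    (hι : IsGelfandTriple ι) {p T : ℝ} (hp : 0 < p) {x : ℕ → ℝ → V} {u : ℝ → H}
    (hx : ∀ n, StronglyMeasurable (x n)) {M : ℝ≥0∞} (hMtop : M ≠ ⊤)
    (hM : ∀ n, ∫⁻ t, ‖x n t‖ₑ ^ p ∂timeMeasure T ≤ M)
    (hweak : ∀ t ∈ Icc 0 T, ∀ h,
      Tendsto (fun n => inner ℝ (ι (x n t)) h) atTop (𝓝 (inner ℝ (u t) h))) :
    ∃ v : ℝ → V, MemLp v (ENNReal.ofReal p) (timeMeasure T) ∧
      ∀ᵐ t ∂timeMeasure T, ι (v t) = u t := by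
  have hsep := hι.separableSpace
  have hsc : SecondCountableTopology V := UniformSpace.secondCountable_of_separable V
  have hmem : ∀ᵐ t ∂timeMeasure T, t ∈ Icc 0 T := ae_restrict_mem measurableSet_Icc
  -- Fatou makes L finite almost everywhere. At such t a V-bounded subsequence exists, depending on
  -- t, and its weak limit in V must lie over u t.
  set L : ℝ → ℝ≥0∞ := fun t => liminf (fun n => ‖x n t‖ₑ ^ p) atTop with hL
  have hLm : Measurable L :=
    Measurable.liminf fun n => ((hx n).measurable.enorm.pow_const p)
  have hfatou : ∫⁻ t, L t ∂timeMeasure T ≤ M := by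
    refine (lintegral_liminf_le fun n => ((hx n).measurable.enorm.pow_const p)).trans ?_
    exact liminf_le_of_frequently_le' (Eventually.of_forall hM).frequently
  have hLfin : ∀ᵐ t ∂timeMeasure T, L t < ⊤ :=
    ae_lt_top hLm (ne_top_of_le_ne_top hMtop hfatou)
  have hlift : ∀ t ∈ Icc 0 T, ∀ c : ℝ≥0∞, c ≠ ⊤ → L t < c →
      ∃ z, ι z = u t ∧ ‖z‖ₑ ^ p ≤ c := by
    intro t ht c hc hLc
    obtain ⟨ψ, hψ, hψc⟩ := extraction_of_frequently_atTop (frequently_lt_of_liminf_lt (by isBoundedDefault) hLc)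
    have hc' : c ^ (1 / p) ≠ ⊤ := ENNReal.rpow_ne_top_of_nonneg (by positivity) hc
    have hb : ∀ n, ‖x (ψ n) t‖ ≤ (c ^ (1 / p)).toReal := by
      intro n
      have h1 : ‖x (ψ n) t‖ₑ ≤ c ^ (1 / p) := by
        rw [one_div, ENNReal.le_rpow_inv_iff hp]; exact (hψc n).le
      have := ENNReal.toReal_mono hc' h1
      rwa [toReal_enorm] at this
    obtain ⟨z, hz, hzb, -⟩ := hι.exists_weak_limit hb (y := u t)
      (fun h => (hweak t ht h).comp hψ.tendsto_atTop)
    refine ⟨z, hz, ?_⟩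
    rw [← ENNReal.le_rpow_inv_iff hp, ← one_div, ← ofReal_norm]
    exact ENNReal.ofReal_le_of_le_toReal hzb
  classical
  set v : ℝ → V := fun t => if h : ∃ z, ι z = u t then h.choose else 0 with hv
  have hvspec : ∀ t z, ι z = u t → v t = z := by
    intro t z hz
    have h : ∃ z, ι z = u t := ⟨z, hz⟩
    refine hι.injective ?_
    simp only [hv, dif_pos h]
    rw [h.choose_spec, hz]
  have hae : ∀ᵐ t ∂timeMeasure T, ι (v t) = u t := by
    filter_upwards [hLfin, hmem] with t ht htm
    obtain ⟨c, hc1, hc2⟩ := ENNReal.lt_iff_exists_nnreal_btwn.1 ht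
    obtain ⟨z, hz, -⟩ := hlift t htm c ENNReal.coe_ne_top hc1
    rw [hvspec t z hz, hz]
  have hvL : ∀ᵐ t ∂timeMeasure T, ‖v t‖ₑ ^ p ≤ L t := by
    filter_upwards [hmem] with t htm
    refine le_of_forall_gt fun c hc => ?_
    obtain ⟨c', hc1, hc2⟩ := ENNReal.lt_iff_exists_nnreal_btwn.1 hc
    obtain ⟨z, hz, hzc⟩ := hlift t htm c' ENNReal.coe_ne_top hc1
    rw [hvspec t z hz]
    exact hzc.trans_lt hc2
  have hvm : AEMeasurable v (timeMeasure T) := by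
    set d := TopologicalSpace.denseSeq H
    -- By Lusin–Souslin, a continuous injection of the Polish space V is a measurable embedding, so
    -- measurability of v reduces to that of countably many scalar products.
    have hemb : MeasurableEmbedding fun (z : V) (i : ℕ) => (inner ℝ (ι z) (d i) : ℝ) := by
      refine Continuous.measurableEmbedding (by fun_prop) fun z z' hzz => hι.injective ?_
      have h1 : (fun h => inner ℝ (ι z) h) = fun h => inner ℝ (ι z') h := by
        refine Continuous.ext_on (TopologicalSpace.denseRange_denseSeq H) (by fun_prop)
          (by fun_prop) ?_
        rintro _ ⟨i, rfl⟩
        exact congrFun hzz i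
      exact ext_inner_right ℝ fun h => congrFun h1 h
    rw [← hemb.aemeasurable_comp_iff]
    refine aemeasurable_pi_lambda _ fun i => ?_
    refine aemeasurable_of_tendsto_metrizable_ae atTop
      (f := fun n t => (inner ℝ (ι (x n t)) (d i) : ℝ)) (fun n => ?_) ?_
    · have : Measurable fun z : V => (inner ℝ (ι z) (d i) : ℝ) := by
        apply Continuous.measurable; fun_prop
      exact (this.comp (hx n).measurable).aemeasurable
    · filter_upwards [hae, hmem] with t ht htm
      simp only [Function.comp_apply, ht]
      exact hweak t htm (d i)
  refine ⟨v, ⟨hvm.aestronglyMeasurable, ?_⟩, hae⟩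
  rw [eLpNorm_ofReal_eq_lintegral hp]
  refine ENNReal.rpow_lt_top_of_nonneg (by positivity) (ne_top_of_le_ne_top hMtop ?_)
  exact (lintegral_mono_ae hvL).trans hfatou

variable [CompleteSpace V] [CompleteSpace H] [TopologicalSpace.SeparableSpace H]
  {T α β δ K : ℝ} {f g : ℝ → ℝ} {ρ η : V → ℝ} {A : ℝ → V → StrongDual ℝ V}

theorem lintegral_enorm_rpow_eq {E : Type*} [NormedAddCommGroup E] {p : ℝ} (hp : 0 < p)
    (hT : 0 ≤ T) {x : ℝ → E} (hx : MemLp x (ENNReal.ofReal p) (timeMeasure T)) :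
    ∫⁻ t, ‖x t‖ₑ ^ p ∂timeMeasure T = ENNReal.ofReal (∫ t in (0 : ℝ)..T, ‖x t‖ ^ p) := by
  rw [← integral_timeMeasure hT, ofReal_integral_eq_lintegral_ofReal (integrable_norm_rpow hp hx)
    (Eventually.of_forall fun t => by positivity)]
  refine lintegral_congr fun t => ?_
  rw [← ENNReal.ofReal_rpow_of_nonneg (norm_nonneg _) hp.le, ofReal_norm]

/-- Convergence of the primitives comes first; the Galerkin identity, with error 1/(n+1), then
forces x_n(t) to converge weakly in H at every t, which defines u. The limit of the primitives is
thereby expressed through u. -/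
theorem IsEvolutionOperator.exists_galerkin_limit
    (hA : IsEvolutionOperator ι T α β δ K f g ρ η A) (hT : 0 < T) (hι : IsGelfandTriple ι)
    (u₀ : H) : ∃ R M x u v, IsGalerkinLimit ι T α R M A u₀ x u v := by
  have hsep := hι.separableSpace
  have hpq := hA.holderConjugate
  have hα0 := hpq.pos
  have h0 : (0 : ℝ) ∈ Icc 0 T := ⟨le_rfl, hT.le⟩
  have hmem : ∀ᵐ t ∂timeMeasure T, t ∈ Icc 0 T := ae_restrict_mem measurableSet_Icc
  set d := TopologicalSpace.denseSeq V with hd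
  have hdd : DenseRange d := TopologicalSpace.denseRange_denseSeq V
  set S : ℕ → Submodule ℝ V := fun n => Submodule.span ℝ (d '' Iic n) with hS
  have hfin : ∀ n, FiniteDimensional ℝ (S n) := fun n =>
    FiniteDimensional.span_of_finite ℝ ((finite_Iic n).image d)
  have hdS : ∀ i n, i ≤ n → d i ∈ S n := fun i n hin =>
    Submodule.subset_span (mem_image_of_mem d hin)
  set R := √(Real.exp (K * T) * (‖u₀‖ ^ 2 + (∫ t in (0 : ℝ)..T, |f t|) + 1)) with hR
  set M₀ := Real.exp (K * T) * (‖u₀‖ ^ 2 + (∫ t in (0 : ℝ)..T, |f t|) + 1) / δ with hM₀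
  choose x' hx1 hx2 hx3 hx4 hx5 hx6 using fun n : ℕ =>
    hA.exists_galerkin_approx hT hι.injective (S n) u₀ (ε := 1 / ((n : ℝ) + 1)) (by positivity)
  have hxp : ∀ n, MemLp (x' n) (ENNReal.ofReal α) (timeMeasure T) := fun n => by
    obtain ⟨B, hB⟩ := hx2 n
    exact MemLp.of_bound (hx1 n).aestronglyMeasurable B (hmem.mono hB)
  have hxM : ∀ n, ∫⁻ t, ‖x' n t‖ₑ ^ α ∂timeMeasure T ≤ ENNReal.ofReal M₀ := fun n => by
    rw [lintegral_enorm_rpow_eq hα0 hT.le (hxp n)]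
    exact ENNReal.ofReal_le_ofReal (hx4 n)
  set M : ℝ≥0∞ := ENNReal.ofReal (1 + R ^ β) *
    (eLpNorm g (ENNReal.ofReal (α / (α - 1))) (timeMeasure T) +
        ENNReal.ofReal K * ((ENNReal.ofReal M₀) ^ (1 / α)) ^ (α - 1)) with hM
  have hα1 : 0 ≤ α - 1 := by linarith [hA.one_lt]
  have hMtop : M ≠ ⊤ := by
    refine ENNReal.mul_ne_top ENNReal.ofReal_ne_top (ENNReal.add_ne_top.2 ⟨hA.memLp.2.ne, ?_⟩)
    exact ENNReal.mul_ne_top ENNReal.ofReal_ne_top (ENNReal.rpow_ne_top_of_nonneg hα1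
      (ENNReal.rpow_ne_top_of_nonneg (by positivity) ENNReal.ofReal_ne_top))
  have hwM : ∀ n, eLpNorm (fun t => A t (x' n t)) (ENNReal.ofReal (α / (α - 1)))
      (timeMeasure T) ≤ M := fun n => by
    refine (hA.eLpNorm_le (hxp n).1 (hmem.mono (hx3 n))).trans ?_
    rw [eLpNorm_ofReal_eq_lintegral hα0, hM]
    gcongr
    exact hxM n
  have hwm : ∀ n, AEStronglyMeasurable (fun t => A t (x' n t)) (timeMeasure T) := fun n =>
    hA.aestronglyMeasurable (hxp n)
  obtain ⟨φ, hφ, hconv⟩ := exists_subseq_tendsto_integral hpq hMtop hwm hwM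
  have hφt := hφ.tendsto_atTop
  have hgal : ∀ t ∈ Icc 0 T, ∀ i, Tendsto (fun n => inner ℝ (ι (x' (φ n) t) - u₀) (ι (d i)) -
      ∫ s in (0 : ℝ)..t, A s (x' (φ n) s) (d i)) atTop (𝓝 0) := by
    intro t ht i
    have h1 : Tendsto (fun n : ℕ => 1 / ((φ n : ℝ) + 1) * ‖d i‖) atTop (𝓝 0) := by
      have := (tendsto_one_div_add_atTop_nhds_zero_nat (𝕜 := ℝ)).comp hφt
      simpa using this.mul_const ‖d i‖
    -- The vector d_i is an admissible test vector only once it lies in the subspace, that is, for n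
    -- ≥ i.
    refine squeeze_zero_norm' ?_ h1
    filter_upwards [hφt.eventually_ge_atTop i] with n hn
    exact hx5 (φ n) t ht (d i) (hdS i _ hn)
  have hιd : Dense (range fun i => ι (d i)) := hι.denseRange.comp hdd ι.continuous
  have hlimH : ∀ t ∈ Icc 0 T, ∃ y : H, ‖y‖ ≤ R ∧
      ∀ h, Tendsto (fun n => inner ℝ (ι (x' (φ n) t)) h) atTop (𝓝 (inner ℝ y h)) := by
    intro t ht
    obtain ⟨Λ, hΛ, hlim⟩ := StrongDual.exists_tendsto_of_dense
      (ℓ := fun n => innerSL ℝ (ι (x' (φ n) t))) (R := R)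
      (fun n => by rw [innerSL_apply_norm]; exact hx3 (φ n) t ht) hιd (by
        rintro _ ⟨i, rfl⟩
        obtain ⟨l, hl⟩ := hconv t ht (d i)
        refine ⟨0 + l + inner ℝ u₀ (ι (d i)), ?_⟩
        refine (((hgal t ht i).add hl).add_const (inner ℝ u₀ (ι (d i)))).congr fun n => ?_
        rw [sub_add_cancel, inner_sub_left, sub_add_cancel, innerSL_apply_apply])
    refine ⟨(InnerProductSpace.toDual ℝ H).symm Λ, ?_, fun h => ?_⟩
    · rwa [LinearIsometryEquiv.norm_map]
    · rw [InnerProductSpace.toDual_symm_apply]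
      exact hlim h
  choose! u huR huw using hlimH
  have hint : ∀ t ∈ Icc 0 T, ∀ z, Tendsto (fun n => ∫ s in (0 : ℝ)..t, A s (x' (φ n) s) z) atTop
      (𝓝 (inner ℝ (u t - u₀) (ι z))) := by
    intro t ht z
    have hii : ∀ n, IntervalIntegrable (fun s => A s (x' (φ n) s)) volume 0 t := fun n =>
      intervalIntegrable_of_timeMeasure (integrable_of_eLpNorm_le hpq.symm.lt.le
        ⟨hwm (φ n), (hwM (φ n)).trans_lt hMtop.lt_top⟩) h0 ht
    have hbd : ∀ n, ‖∫ s in (0 : ℝ)..t, A s (x' (φ n) s)‖ ≤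
        M.toReal * (t - 0) ^ (1 / α) := fun n => by
      have ht0 : 0 ≤ t - 0 := by linarith [ht.1]
      refine ContinuousLinearMap.opNorm_le_bound _ (by positivity) fun z => ?_
      rw [ContinuousLinearMap.intervalIntegral_apply (hii n), mul_comm]
      exact norm_integral_apply_le hpq (hwm (φ n)) hMtop (hwM (φ n)) le_rfl ht.1 ht.2 z
    have hdlim : ∀ i, Tendsto (fun n => ∫ s in (0 : ℝ)..t, A s (x' (φ n) s) (d i)) atTop
        (𝓝 (inner ℝ (u t - u₀) (ι (d i)))) := by
      intro i
      have h1 := ((huw t ht (ι (d i))).sub_const (inner ℝ u₀ (ι (d i)))).sub (hgal t ht i)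
      rw [sub_zero, ← inner_sub_left] at h1
      refine h1.congr fun n => ?_
      rw [inner_sub_left]; ring
    obtain ⟨Λ, -, hΛ⟩ := StrongDual.exists_tendsto_of_dense hbd hdd (by
      rintro _ ⟨i, rfl⟩
      refine ⟨_, (hdlim i).congr fun n => ?_⟩
      rw [ContinuousLinearMap.intervalIntegral_apply (hii n)])
    have hΛeq : (Λ : V → ℝ) = toDual ι (u t - u₀) := by
      refine Continuous.ext_on hdd Λ.continuous (toDual ι (u t - u₀)).continuous ?_
      rintro _ ⟨i, rfl⟩
      refine tendsto_nhds_unique (hΛ (d i)) ((hdlim i).congr fun n => ?_)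
      rw [ContinuousLinearMap.intervalIntegral_apply (hii n)]
    have h1 := hΛ z
    rw [hΛeq] at h1
    refine h1.congr fun n => ?_
    rw [ContinuousLinearMap.intervalIntegral_apply (hii n)]
  -- At t = 0 the integrals vanish, so u 0 - u₀ is orthogonal to the dense image of V.
  have hu0 : u 0 = u₀ := by
    rw [← sub_eq_zero]
    refine hι.denseRange.eq_zero_of_inner_left ℝ fun z => ?_
    have h1 := hint 0 h0 z
    simp only [intervalIntegral.integral_same] at h1
    exact tendsto_nhds_unique h1 tendsto_const_nhds
  obtain ⟨v, hv, hvu⟩ := exists_memLp_of_weak_limit hι hα0 (fun n => hx1 (φ n))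
    ENNReal.ofReal_ne_top (fun n => hxM (φ n)) huw
  refine ⟨R, M, fun n => x' (φ n), u, v, ?_⟩
  exact
    { ne_top := hMtop
      memLp := fun n => hxp (φ n)
      norm_le := fun n => hx3 (φ n)
      norm_limit_le := huR
      weak := huw
      eLpNorm_le := fun n => hwM (φ n)
      integral := fun t ht z => by rw [hu0]; exact hint t ht z
      initial := hu0
      energy := fun ε hε => by
        have h1 := (tendsto_one_div_add_atTop_nhds_zero_nat (𝕜 := ℝ)).comp hφt
        filter_upwards [h1.eventually (gt_mem_nhds hε)] with n hn
        have := hx6 (φ n)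
        simp only [Function.comp_apply] at hn
        linarith
      memLp_limit := hv
      ae_eq := hvu }

end LocallyMonotone

/-! ### Pseudomonotonicity and identification of the limit -/

namespace LocallyMonotone

variable {V H : Type*} [NormedAddCommGroup V] [NormedSpace ℝ V] [MeasurableSpace V]
  [NormedAddCommGroup H] [InnerProductSpace ℝ H] {ι : V →L[ℝ] H}
  {T α β δ K : ℝ} {f g : ℝ → ℝ} {ρ η : V → ℝ} {A : ℝ → V → StrongDual ℝ V}

/-- Dominated convergence with a bound that is only asymptotically integrable. -/
theorem tendsto_integral_abs_of_dominated_add {Ω : Type*} [MeasurableSpace Ω] {μ : Measure Ω}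
    {φ e : ℕ → Ω → ℝ} {B : Ω → ℝ} (hφ : ∀ n, AEStronglyMeasurable (φ n) μ)
    (he : ∀ n, Integrable (e n) μ) (he0 : ∀ n x, 0 ≤ e n x) (hB : Integrable B μ)
    (hB0 : ∀ x, 0 ≤ B x) (hle : ∀ n, ∀ᵐ x ∂μ, |φ n x| ≤ B x + e n x)
    (hlim : ∀ᵐ x ∂μ, Tendsto (fun n => φ n x) atTop (𝓝 0))
    (helim : Tendsto (fun n => ∫ x, e n x ∂μ) atTop (𝓝 0)) :
    Tendsto (fun n => ∫ x, |φ n x| ∂μ) atTop (𝓝 0) := by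
  -- The part of |φ_n| below B is treated by dominated convergence; what exceeds B is at most e_n.
  have hmin : ∀ n, AEStronglyMeasurable (fun x => min |φ n x| (B x)) μ := fun n =>
    ((hφ n).norm.aemeasurable.min hB.1.aemeasurable).aestronglyMeasurable
  have hminb : ∀ n, ∀ᵐ x ∂μ, ‖min |φ n x| (B x)‖ ≤ B x := fun n =>
    Eventually.of_forall fun x => by
      rw [Real.norm_eq_abs, abs_of_nonneg (le_min (abs_nonneg _) (hB0 x))]
      exact min_le_right _ _
  have h1 : Tendsto (fun n => ∫ x, min |φ n x| (B x) ∂μ) atTop (𝓝 (∫ _, (0 : ℝ) ∂μ)) := by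
    refine tendsto_integral_of_dominated_convergence B hmin hB hminb ?_
    filter_upwards [hlim] with x hx
    refine squeeze_zero (fun n => le_min (abs_nonneg _) (hB0 x)) (fun n => min_le_left _ _) ?_
    simpa using hx.abs
  rw [integral_zero] at h1
  have h2 := h1.add helim
  rw [add_zero] at h2
  refine squeeze_zero (fun n => integral_nonneg fun x => abs_nonneg _) (fun n => ?_) h2
  have hmi : Integrable (fun x => min |φ n x| (B x)) μ := hB.mono' (hmin n) (hminb n)
  rw [← integral_add hmi (he n)]
  refine integral_mono_of_nonneg (Eventually.of_forall fun x => abs_nonneg _) (hmi.add (he n)) ?_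
  filter_upwards [hle n] with x hx
  change |φ n x| ≤ min |φ n x| (B x) + e n x
  rcases le_total |φ n x| (B x) with h | h
  · rw [min_eq_left h]; linarith [he0 n x]
  · rw [min_eq_right h]; exact hx

namespace IsEvolutionOperator

/-- Coercivity and growth bound the energy pairing from above. -/
theorem exists_integrable_bound (hA : IsEvolutionOperator ι T α β δ K f g ρ η A) {R : ℝ}
    (hR : 0 ≤ R) {v : ℝ → V} (hv : MemLp v (ENNReal.ofReal α) (timeMeasure T)) :
    ∃ h : ℝ → ℝ, Integrable h (timeMeasure T) ∧ (∀ t, 0 ≤ h t) ∧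
      ∀ t ∈ Icc 0 T, ∀ x : V, ‖ι x‖ ≤ R →
        A t x (x - v t) + δ / 4 * ‖x‖ ^ α ≤ h t := by
  have hpq := hA.holderConjugate
  have hK := hA.nonneg
  have hα1 : 0 < α - 1 := by linarith [hA.one_lt]
  set q := α / (α - 1) with hq
  set b := 1 + R ^ β with hb
  have hb0 : 0 ≤ b := by positivity
  -- Coercivity yields δ/2 ‖x‖^α; Young spends δ/4 of it on the growth term paired with v, and δ/4
  -- remains in the conclusion.
  obtain ⟨c₁, hc₁, hy₁⟩ := exists_young hpq.symm (show (0 : ℝ) < δ / 4 by linarith [hA.pos])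
  obtain ⟨c₂, hc₂, hy₂⟩ := exists_young hpq.symm one_pos
  have hvi : ∀ k : ℝ, 0 ≤ k → Integrable (fun t => (k * ‖v t‖) ^ α) (timeMeasure T) := by
    intro k hk
    simp_rw [Real.mul_rpow hk (norm_nonneg _)]
    exact (integrable_norm_rpow hpq.pos hv).const_mul _
  refine ⟨fun t => (K * R ^ 2 + |f t|) / 2 + (|g t| ^ q + c₂ * (b * ‖v t‖) ^ α) +
    c₁ * ((K * b) * ‖v t‖) ^ α, ?_, fun t => by positivity, fun t ht x hx => ?_⟩
  · have h1 : Integrable (fun t => |g t| ^ q) (timeMeasure T) :=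
      integrable_norm_rpow hpq.symm.pos hA.memLp
    have h2 : Integrable (fun t => (K * R ^ 2 + |f t|) / 2) (timeMeasure T) :=
      ((integrable_const _).add hA.integrable.abs).div_const 2
    exact (h2.add (h1.add ((hvi b hb0).const_mul c₂))).add
      ((hvi (K * b) (by positivity)).const_mul c₁)
  · have h1 := hA.coercive t ht x
    have h2 : K * ‖ι x‖ ^ 2 ≤ K * R ^ 2 := by gcongr
    have h3 : -(A t x (v t)) ≤ (|g t| + K * ‖x‖ ^ (α - 1)) * b * ‖v t‖ := by
      refine (neg_le_abs _).trans (((A t x).le_opNorm _).trans ?_)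
      refine mul_le_mul_of_nonneg_right ((hA.growth t ht x).trans ?_) (norm_nonneg _)
      have h4 : ‖ι x‖ ^ β ≤ R ^ β := Real.rpow_le_rpow (norm_nonneg _) hx hA.nonneg_exponent
      have h5 := le_abs_self (g t)
      exact mul_le_mul (by linarith) (by linarith) (by positivity) (by positivity)
    have h4 := hy₂ |g t| (b * ‖v t‖) (abs_nonneg _) (by positivity)
    have h5 := hy₁ (‖x‖ ^ (α - 1)) (K * b * ‖v t‖) (by positivity) (by positivity)
    have h6 : (‖x‖ ^ (α - 1)) ^ q = ‖x‖ ^ α := by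
      rw [← Real.rpow_mul (norm_nonneg _)]
      congr 1
      rw [hq]; field_simp
    rw [h6] at h5
    have h7 := le_abs_self (f t)
    rw [map_sub]
    linarith

/-- Half of pseudomonotonicity: the energy pairing is asymptotically nonpositive. -/
theorem eventually_apply_sub_le (hA : IsEvolutionOperator ι T α β δ K f g ρ η A)
    (hι : IsGelfandTriple ι) (hcompact : IsCompactOperator ι) {t : ℝ} (ht : t ∈ Icc 0 T)
    {y : ℕ → V} {B : ℝ} (hB : ∀ n, ‖y n‖ ≤ B) {z : V}
    (hweak : ∀ h, Tendsto (fun n => inner ℝ (ι (y n)) h) atTop (𝓝 (inner ℝ (ι z) h))) {ε : ℝ}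
    (hε : 0 < ε) : ∀ᶠ n in atTop, A t (y n) (y n - z) ≤ ε := by
  obtain ⟨z', hz', -, hlim⟩ := hι.exists_weak_limit hB hweak
  obtain rfl := hι.injective hz'
  have hstrong := tendsto_of_compact hcompact hB hweak
  obtain ⟨Mρ, hMρ⟩ := hA.weight_left.locallyBounded B
  -- This majorant comes from local monotonicity. Its first term vanishes by strong convergence in
  -- H, ρ(y_n) being bounded, and its second by weak convergence in V.
  have h1 : Tendsto (fun n => (K + Mρ + η z') * ‖ι (y n - z')‖ ^ 2 + A t z' (y n - z')) atTop
      (𝓝 0) := by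
    have e1 : Tendsto (fun n => ‖ι (y n - z')‖) atTop (𝓝 0) := by
      have := (tendsto_iff_norm_sub_tendsto_zero.1 hstrong)
      simpa only [map_sub] using this
    have e2 : Tendsto (fun n => A t z' (y n - z')) atTop (𝓝 0) := by
      have := (hlim (A t z')).sub_const (A t z' z')
      simpa only [map_sub, sub_self] using this
    simpa using ((e1.pow 2).const_mul (K + Mρ + η z')).add e2
  filter_upwards [h1.eventually (gt_mem_nhds hε)] with n hn
  have h2 := hA.monotone t ht (y n) z'
  have h3 : (K + ρ (y n) + η z') * ‖ι (y n - z')‖ ^ 2 ≤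
      (K + Mρ + η z') * ‖ι (y n - z')‖ ^ 2 := by
    gcongr
    exact hMρ _ (hB n)
  rw [sub_apply] at h2
  linarith

/-- Minty's argument: if the energy pairing vanishes asymptotically, then `A(t,·)` is weakly
continuous along the sequence. -/
theorem tendsto_apply_of_tendsto_apply_sub (hA : IsEvolutionOperator ι T α β δ K f g ρ η A)
    (hι : IsGelfandTriple ι) (hcompact : IsCompactOperator ι) {t : ℝ} (ht : t ∈ Icc 0 T)
    {y : ℕ → V} {B : ℝ} (hB : ∀ n, ‖y n‖ ≤ B) {z : V}
    (hweak : ∀ h, Tendsto (fun n => inner ℝ (ι (y n)) h) atTop (𝓝 (inner ℝ (ι z) h)))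
    (hzero : Tendsto (fun n => A t (y n) (y n - z)) atTop (𝓝 0)) (x : V) :
    Tendsto (fun n => A t (y n) x) atTop (𝓝 (A t z x)) := by
  obtain ⟨z', hz', -, hlim⟩ := hι.exists_weak_limit hB hweak
  obtain rfl := hι.injective hz'
  have hstrong := tendsto_of_compact hcompact hB hweak
  -- The one-sided estimate for all x suffices: applied to -x it gives the lower bound.
  have hupper : ∀ x : V, ∀ ε > 0, ∀ᶠ n in atTop, A t (y n) x ≤ A t z' x + ε := by
    intro x ε hε
    obtain ⟨Mρ, hMρ⟩ := hA.weight_left.locallyBounded B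
    -- This radius contains all comparison points z' - s x with 0 < s < 1, so L does not depend on
    -- s.
    obtain ⟨Mη, hMη⟩ := hA.weight_right.locallyBounded (‖z'‖ + ‖x‖)
    set L := K + Mρ + Mη with hL
    have hcont : Tendsto (fun s : ℝ => A t (z' + s • (-x)) x + s * (L * ‖ι x‖ ^ 2)) (𝓝[>] 0)
        (𝓝 (A t z' x)) := by
      have e1 := (hA.hemicontinuous t ht z' (-x) x).tendsto 0
      have e2 : Tendsto (fun s : ℝ => s * (L * ‖ι x‖ ^ 2)) (𝓝 0) (𝓝 0) :=
        Continuous.tendsto' (by fun_prop) _ _ (by simp)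
      have e3 := (e1.add e2).mono_left (nhdsWithin_le_nhds (s := Ioi 0))
      simpa using e3
    have hev := hcont.eventually (gt_mem_nhds (show A t z' x < A t z' x + ε / 2 by linarith))
    -- Hemicontinuity fixes s. Monotonicity between y_n and z' - s x, divided by s, then leaves an
    -- error s L ‖ι x‖² because the locally monotone term is quadratic in s.
    obtain ⟨s, hs, hs0, hs1⟩ := (hev.and (Ioo_mem_nhdsGT (show (0 : ℝ) < 1 by norm_num))).exists
    set x' := z' + s • (-x) with hx'
    have hyx : ∀ n, y n - x' = (y n - z') + s • x := fun n => by rw [hx', smul_neg]; abel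
    have e1 : Tendsto (fun n => ‖ι (y n - x')‖ ^ 2) atTop (𝓝 (s ^ 2 * ‖ι x‖ ^ 2)) := by
      have := ((hstrong.sub_const (ι x')).norm).pow 2
      have e : ‖ι z' - ι x'‖ ^ 2 = s ^ 2 * ‖ι x‖ ^ 2 := by
        rw [← map_sub, show z' - x' = s • x by rw [hx', smul_neg]; abel, map_smul, norm_smul,
          mul_pow, Real.norm_eq_abs, sq_abs]
      rw [e] at this
      simpa only [map_sub] using this
    have e2 : Tendsto (fun n => A t x' (y n - x')) atTop (𝓝 (s * A t x' x)) := by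
      have := (hlim (A t x')).sub_const (A t x' x')
      rw [← map_sub, show z' - x' = s • x by rw [hx', smul_neg]; abel, map_smul,
        smul_eq_mul] at this
      simpa only [map_sub] using this
    have e3 : Tendsto (fun n => s⁻¹ * (L * ‖ι (y n - x')‖ ^ 2 + A t x' (y n - x') -
        A t (y n) (y n - z'))) atTop (𝓝 (s⁻¹ * (L * (s ^ 2 * ‖ι x‖ ^ 2) + s * A t x' x - 0))) :=
      (((e1.const_mul L).add e2).sub hzero).const_mul s⁻¹
    have e4 : s⁻¹ * (L * (s ^ 2 * ‖ι x‖ ^ 2) + s * A t x' x - 0) =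
        A t x' x + s * (L * ‖ι x‖ ^ 2) := by
      field_simp; ring
    rw [e4] at e3
    filter_upwards [e3.eventually (gt_mem_nhds (hs.trans (by linarith :
      A t z' x + ε / 2 < A t z' x + ε)))] with n hn
    refine le_trans ?_ hn.le
    rw [← sub_nonneg, ← mul_nonneg_iff_of_pos_left hs0, mul_sub, mul_inv_cancel_left₀ hs0.ne']
    have h2 := hA.monotone t ht (y n) x'
    have h3 : (K + ρ (y n) + η x') * ‖ι (y n - x')‖ ^ 2 ≤ L * ‖ι (y n - x')‖ ^ 2 := by
      refine mul_le_mul_of_nonneg_right ?_ (by positivity)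
      have hx : ‖x'‖ ≤ ‖z'‖ + ‖x‖ := by
        refine (norm_add_le _ _).trans ?_
        rw [norm_smul, norm_neg, Real.norm_eq_abs, abs_of_pos hs0]
        have := mul_le_of_le_one_left (norm_nonneg x) hs1.le
        linarith
      linarith [hMρ _ (hB n), hMη _ hx]
    have h4 : A t (y n) (y n - x') = A t (y n) (y n - z') + s * A t (y n) x := by
      rw [hyx, map_add, map_smul, smul_eq_mul]
    rw [sub_apply, h4] at h2
    linarith
  rw [Metric.tendsto_nhds]
  intro ε hε
  filter_upwards [hupper x (ε / 2) (by linarith), hupper (-x) (ε / 2) (by linarith)] with n h1 h2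
  rw [map_neg, map_neg] at h2
  rw [Real.dist_eq, abs_lt]
  constructor <;> linarith

variable {R : ℝ} {M : ℝ≥0∞} {u₀ : H} {x : ℕ → ℝ → V} {u : ℝ → H} {v : ℝ → V}

theorem integrable_pairing (hA : IsEvolutionOperator ι T α β δ K f g ρ η A)
    (hG : IsGalerkinLimit ι T α R M A u₀ x u v) {z : ℝ → V}
    (hz : MemLp z (ENNReal.ofReal α) (timeMeasure T)) (n : ℕ) :
    Integrable (fun t => A t (x n t) (z t)) (timeMeasure T) :=
  integrable_apply_of_memLp hA.holderConjugate
    ⟨hA.aestronglyMeasurable (hG.memLp n), (hG.eLpNorm_le n).trans_lt hG.ne_top.lt_top⟩ hz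

variable [CompleteSpace V]

/-- The approximate energy inequality bounds ∫⟨A(x_n),x_n⟩ from below by ‖x_n(T)‖², weak convergence
at T bounds that by ‖u(T)‖², and the energy inequality for the limit bounds ∫⟨A(x_n),v⟩ from above.
-/
theorem eventually_neg_le_integral (hA : IsEvolutionOperator ι T α β δ K f g ρ η A) (hT : 0 < T)
    (hι : IsGelfandTriple ι) (hG : IsGalerkinLimit ι T α R M A u₀ x u v) {ε : ℝ} (hε : 0 < ε) :
    ∀ᶠ n in atTop, -ε ≤ ∫ t, A t (x n t) (x n t - v t) ∂timeMeasure T := by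
  have hTT : T ∈ Icc 0 T := ⟨hT.le, le_rfl⟩
  have h1 := eventually_integral_apply_le hA.holderConjugate hT hG.memLp_limit hG.ne_top
    (fun n => hA.aestronglyMeasurable (hG.memLp n)) hG.eLpNorm_le hG.integral hG.norm_limit_le
    hG.ae_eq hι.denseRange (show 0 < ε / 4 by linarith)
  have h2 := (hG.weak T hTT (u T)).eventually
    (lt_mem_nhds (show inner ℝ (u T) (u T) - ε / 4 < inner ℝ (u T) (u T) by linarith))
  filter_upwards [h1, h2, hG.energy (ε / 2) (by linarith)] with n h1 h2 h3
  rw [hG.initial] at h1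
  have h4 := norm_sub_sq_real (ι (x n T)) (u T)
  have h5 := sq_nonneg ‖ι (x n T) - u T‖
  rw [real_inner_self_eq_norm_sq] at h2
  rw [← integral_timeMeasure hT.le] at h3
  simp only [map_sub]
  rw [integral_sub (integrable_pairing hA hG (hG.memLp n) n)
    (integrable_pairing hA hG hG.memLp_limit n)]
  linarith

/-- If ξ_n(t) > ε for infinitely many n, coercivity bounds x_n(t) in V along them, against
half-pseudomonotonicity. So the positive parts, dominated by h, vanish in L¹, and |ξ| = 2ξ⁺ - ξ with
liminf ∫ξ_n ≥ 0 does the rest. -/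
theorem tendsto_integral_abs_pairing (hA : IsEvolutionOperator ι T α β δ K f g ρ η A) (hT : 0 < T)
    (hι : IsGelfandTriple ι) (hcompact : IsCompactOperator ι)
    (hG : IsGalerkinLimit ι T α R M A u₀ x u v) :
    Tendsto (fun n => ∫ t, |A t (x n t) (x n t - v t)| ∂timeMeasure T) atTop (𝓝 0) := by
  have h0 : (0 : ℝ) ∈ Icc 0 T := ⟨le_rfl, hT.le⟩
  have hR : 0 ≤ R := (norm_nonneg _).trans (hG.norm_le 0 0 h0)
  have hδ := hA.pos
  have hα0 := hA.holderConjugate.pos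
  have hmem : ∀ᵐ t ∂timeMeasure T, t ∈ Icc 0 T := ae_restrict_mem measurableSet_Icc
  obtain ⟨h, hh, hh0, hbound⟩ := hA.exists_integrable_bound hR hG.memLp_limit
  set ξ : ℕ → ℝ → ℝ := fun n t => A t (x n t) (x n t - v t) with hξ
  have hξi : ∀ n, Integrable (ξ n) (timeMeasure T) := fun n =>
    integrable_pairing hA hG ((hG.memLp n).sub hG.memLp_limit) n
  have hξle : ∀ n, ∀ t ∈ Icc 0 T, ξ n t + δ / 4 * ‖x n t‖ ^ α ≤ h t := fun n t ht =>
    hbound t ht _ (hG.norm_le n t ht)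
  have hlimsup : ∀ᵐ t ∂timeMeasure T, ∀ ε > 0, ∀ᶠ n in atTop, ξ n t ≤ ε := by
    filter_upwards [hmem, hG.ae_eq] with t ht htv ε hε
    by_contra hcon
    rw [not_eventually] at hcon
    obtain ⟨ψ, hψ, hψε⟩ := extraction_of_frequently_atTop hcon
    have hb : ∀ n, ‖x (ψ n) t‖ ≤ (h t / (δ / 4)) ^ (1 / α) := by
      intro n
      rw [one_div, Real.le_rpow_inv_iff_of_pos (norm_nonneg _) (by have := hh0 t; positivity) hα0,
        le_div_iff₀ (by linarith)]
      have := hξle (ψ n) t ht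
      have h2 := not_le.1 (hψε n)
      linarith
    have hev := hA.eventually_apply_sub_le hι hcompact ht hb (z := v t)
      (fun k => by rw [htv]; exact (hG.weak t ht k).comp hψ.tendsto_atTop) hε
    obtain ⟨n, hn⟩ := hev.exists
    exact hψε n hn
  have hpos : Tendsto (fun n => ∫ t, max (ξ n t) 0 ∂timeMeasure T) atTop (𝓝 0) := by
    have := tendsto_integral_of_dominated_convergence (μ := timeMeasure T)
      (F := fun n t => max (ξ n t) 0) (f := fun _ => (0 : ℝ)) h
      (fun n => (hξi n).pos_part.1) hh ?_ ?_
    · simpa using this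
    · intro n
      filter_upwards [hmem] with t ht
      rw [Real.norm_eq_abs, abs_of_nonneg (le_max_right _ _)]
      refine max_le ?_ (hh0 t)
      have h1 := hξle n t ht
      have h2 : 0 ≤ δ / 4 * ‖x n t‖ ^ α := by positivity
      linarith
    · filter_upwards [hlimsup] with t ht
      rw [Metric.tendsto_nhds]
      intro ε hε
      filter_upwards [ht (ε / 2) (by linarith)] with n hn
      rw [Real.dist_eq, sub_zero, abs_of_nonneg (le_max_right _ _)]
      exact max_lt (by linarith) hε
  rw [Metric.tendsto_nhds]
  intro ε hε
  filter_upwards [hpos.eventually (gt_mem_nhds (show (0 : ℝ) < ε / 4 by linarith)),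
    hA.eventually_neg_le_integral hT hι hG (show 0 < ε / 4 by linarith)] with n h1 h2
  have e : ∫ t, |ξ n t| ∂timeMeasure T =
      2 * (∫ t, max (ξ n t) 0 ∂timeMeasure T) - ∫ t, ξ n t ∂timeMeasure T := by
    rw [← integral_const_mul, ← integral_sub ((hξi n).pos_part.const_mul 2) (hξi n)]
    refine integral_congr_ae (Eventually.of_forall fun t => ?_)
    simp only
    rcases le_total (ξ n t) 0 with hs | hs
    · rw [abs_of_nonpos hs, max_eq_right hs]; ring
    · rw [abs_of_nonneg hs, max_eq_left hs]; ring
  rw [Real.dist_eq, sub_zero, abs_of_nonneg (integral_nonneg fun t => abs_nonneg _), e]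
  linarith

/-- The Galerkin limit solves the equation in integrated form. -/
theorem isWeakPrimitive_of_galerkinLimit (hA : IsEvolutionOperator ι T α β δ K f g ρ η A)
    (hT : 0 < T) (hι : IsGelfandTriple ι) (hcompact : IsCompactOperator ι)
    (hG : IsGalerkinLimit ι T α R M A u₀ x u v) :
    IsWeakPrimitive ι α (α / (α - 1)) T R v (fun t => A t (v t)) u := by
  have h0 : (0 : ℝ) ∈ Icc 0 T := ⟨le_rfl, hT.le⟩
  have hR : 0 ≤ R := (norm_nonneg _).trans (hG.norm_le 0 0 h0)
  have hδ := hA.pos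
  have hK := hA.nonneg
  have hpq := hA.holderConjugate
  have hα0 := hpq.pos
  have hα1 : 0 < α - 1 := by linarith [hA.one_lt]
  have hmem : ∀ᵐ t ∂timeMeasure T, t ∈ Icc 0 T := ae_restrict_mem measurableSet_Icc
  obtain ⟨h, hh, hh0, hbound⟩ := hA.exists_integrable_bound hR hG.memLp_limit
  have hvR : ∀ᵐ t ∂timeMeasure T, ‖ι (v t)‖ ≤ R := by
    filter_upwards [hG.ae_eq, hmem] with t ht htm
    rw [ht]; exact hG.norm_limit_le t htm
  have hAv := hA.memLp_apply hG.memLp_limit hvR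
  have hAvi := integrable_of_eLpNorm_le hpq.symm.lt.le hAv
  set ξ : ℕ → ℝ → ℝ := fun n t => A t (x n t) (x n t - v t) with hξ
  have hξi : ∀ n, Integrable (ξ n) (timeMeasure T) := fun n =>
    integrable_pairing hA hG ((hG.memLp n).sub hG.memLp_limit) n
  have hξle : ∀ n, ∀ t ∈ Icc 0 T, ξ n t + δ / 4 * ‖x n t‖ ^ α ≤ h t := fun n t ht =>
    hbound t ht _ (hG.norm_le n t ht)
  have hL1 := hA.tendsto_integral_abs_pairing hT hι hcompact hG
  obtain ⟨ψ, hψ, hψae⟩ : ∃ ψ : ℕ → ℕ, StrictMono ψ ∧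
      ∀ᵐ t ∂timeMeasure T, Tendsto (fun n => ξ (ψ n) t) atTop (𝓝 0) := by
    have hm : TendstoInMeasure (timeMeasure T) ξ atTop (fun _ => (0 : ℝ)) := by
      refine tendstoInMeasure_of_tendsto_eLpNorm one_ne_zero (fun n => (hξi n).1)
        aestronglyMeasurable_const ?_
      have e : ∀ n, eLpNorm (ξ n - fun _ => (0 : ℝ)) 1 (timeMeasure T) =
          ENNReal.ofReal (∫ t, |ξ n t| ∂timeMeasure T) := by
        intro n
        rw [eLpNorm_one_eq_lintegral_enorm]
        have := ofReal_integral_norm_eq_lintegral_enorm (hξi n)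
        simp only [Real.norm_eq_abs] at this
        rw [this]
        simp
      simp_rw [e]
      have hcomp := (ENNReal.continuous_ofReal.tendsto 0).comp hL1
      rw [ENNReal.ofReal_zero] at hcomp
      exact hcomp
    exact hm.exists_seq_tendsto_ae
  have hptw : ∀ᵐ t ∂timeMeasure T, ∀ z, Tendsto (fun n => A t (x (ψ n) t) z) atTop
      (𝓝 (A t (v t) z)) := by
    filter_upwards [hψae, hmem, hG.ae_eq] with t hlim ht htv z
    -- A convergent sequence ξ_n(t) is bounded, and coercivity turns this into a V-bound for x_n(t),
    -- as Minty's argument requires.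
    obtain ⟨C, hC⟩ := hlim.abs.bddAbove_range
    have hb : ∀ n, ‖x (ψ n) t‖ ≤ ((h t + C) / (δ / 4)) ^ (1 / α) := by
      intro n
      have h1 := hξle (ψ n) t ht
      have h2 : |ξ (ψ n) t| ≤ C := hC (mem_range_self n)
      have h3 := neg_abs_le (ξ (ψ n) t)
      have h4 := hh0 t
      have h5 : 0 ≤ C := (abs_nonneg _).trans h2
      rw [one_div, Real.le_rpow_inv_iff_of_pos (norm_nonneg _) (by positivity) hα0,
        le_div_iff₀ (by linarith)]
      linarith
    exact hA.tendsto_apply_of_tendsto_apply_sub hι hcompact ht hb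
      (fun k => by rw [htv]; exact (hG.weak t ht k).comp hψ.tendsto_atTop) hlim z
  set b := 1 + R ^ β with hb
  have hb0 : 0 ≤ b := by positivity
  -- The V-norms have no integrable majorant common to all n. Coercivity controls them by h + |ξ_n|,
  -- and the second part tends to 0 in L¹.
  have hgrow : ∀ n, ∀ t ∈ Icc 0 T, ‖A t (x n t)‖ ≤
      b * (|g t| + K * (1 + 4 / δ * h t)) + b * (K * (4 / δ)) * |ξ n t| := by
    intro n t ht
    have h1 := hξle n t ht
    have h2 : ‖x n t‖ ^ (α - 1) ≤ 1 + ‖x n t‖ ^ α := by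
      rcases le_total ‖x n t‖ 1 with hs | hs
      · have := Real.rpow_le_one (norm_nonneg _) hs hα1.le
        have : 0 ≤ ‖x n t‖ ^ α := by positivity
        linarith
      · have := Real.rpow_le_rpow_of_exponent_le hs (show α - 1 ≤ α by linarith)
        linarith
    have h3 : ‖x n t‖ ^ α ≤ 4 / δ * (h t + |ξ n t|) := by
      have := neg_abs_le (ξ n t)
      rw [div_mul_eq_mul_div, le_div_iff₀ hδ]
      linarith
    have h4 : ‖ι (x n t)‖ ^ β ≤ R ^ β :=
      Real.rpow_le_rpow (norm_nonneg _) (hG.norm_le n t ht) hA.nonneg_exponent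
    have h5 := le_abs_self (g t)
    have h6 : K * ‖x n t‖ ^ (α - 1) ≤ K * (1 + 4 / δ * (h t + |ξ n t|)) := by
      gcongr; linarith
    calc ‖A t (x n t)‖ ≤ (g t + K * ‖x n t‖ ^ (α - 1)) * (1 + ‖ι (x n t)‖ ^ β) :=
          hA.growth t ht _
      _ ≤ (|g t| + K * (1 + 4 / δ * (h t + |ξ n t|))) * b := by
          have := hh0 t
          exact mul_le_mul (by linarith) (by linarith) (by positivity) (by positivity)
      _ = _ := by ring
  refine ⟨hG.memLp_limit, hAv, fun t ht z => ?_, hG.norm_limit_le, hG.ae_eq⟩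
  have hAxz : ∀ n, Integrable (fun s => A s (x n s) z) (timeMeasure T) := fun n =>
    integrable_pairing hA hG (memLp_const z) n
  have hAvz : Integrable (fun s => A s (v s) z) (timeMeasure T) :=
    hAvi.apply_continuousLinearMap z
  have hlim : Tendsto (fun n => ∫ s, |A s (x (ψ n) s) z - A s (v s) z| ∂timeMeasure T) atTop
      (𝓝 0) := by
    refine tendsto_integral_abs_of_dominated_add
      (e := fun n s => (b * (K * (4 / δ)) * ‖z‖) * |ξ (ψ n) s|)
      (B := fun s => b * (|g s| + K * (1 + 4 / δ * h s)) * ‖z‖ + ‖A s (v s)‖ * ‖z‖)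
      (fun n => ((hAxz (ψ n)).sub hAvz).1) (fun n => (hξi (ψ n)).abs.const_mul _)
      (fun n s => by positivity) ?_ (fun s => ?_) (fun n => ?_) ?_ ?_
    · have hg := integrable_of_eLpNorm_le hpq.symm.lt.le hA.memLp
      have h1 : Integrable (fun s => b * (|g s| + K * (1 + 4 / δ * h s)) * ‖z‖)
          (timeMeasure T) :=
        ((hg.abs.add (((integrable_const (1 : ℝ)).add (hh.const_mul (4 / δ))).const_mul
          K)).const_mul b).mul_const _
      exact h1.add (hAvi.norm.mul_const _)
    · have := hh0 s
      positivity
    · filter_upwards [hmem] with s hs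
      have h1 := (A s (x (ψ n) s)).le_of_opNorm_le (hgrow (ψ n) s hs) z
      have h2 := (A s (v s)).le_opNorm z
      refine (abs_sub _ _).trans ?_
      rw [Real.norm_eq_abs] at h1 h2
      linarith
    · filter_upwards [hptw] with s hs
      have := (hs z).sub_const (A s (v s) z)
      rwa [sub_self] at this
    · simp_rw [integral_const_mul]
      have hmul := (hL1.comp hψ.tendsto_atTop).const_mul (b * (K * (4 / δ)) * ‖z‖)
      rw [mul_zero] at hmul
      exact hmul
  have h1 : Tendsto (fun n => ∫ s in (0 : ℝ)..t, A s (x (ψ n) s) z) atTop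
      (𝓝 (∫ s in (0 : ℝ)..t, A s (v s) z)) := by
    rw [tendsto_iff_norm_sub_tendsto_zero]
    refine squeeze_zero (fun n => norm_nonneg _) (fun n => ?_) hlim
    rw [← intervalIntegral.integral_sub (intervalIntegrable_of_timeMeasure (hAxz (ψ n)) h0 ht)
      (intervalIntegrable_of_timeMeasure hAvz h0 ht), ← integral_timeMeasure ht.1]
    refine (norm_integral_le_integral_norm _).trans ?_
    exact integral_mono_measure (timeMeasure_mono ht.2)
      (Eventually.of_forall fun s => norm_nonneg _) ((hAxz (ψ n)).sub hAvz).norm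
  exact tendsto_nhds_unique h1 ((hG.integral t ht z).comp hψ.tendsto_atTop)

end IsEvolutionOperator

end LocallyMonotone

/-! ### The forcing term and the main theorem -/

namespace LocallyMonotone

/-- A forcing term can be absorbed into the operator. -/
theorem exists_isEvolutionOperator_add {V H : Type*} [NormedAddCommGroup V] [NormedSpace ℝ V]
    [MeasurableSpace V] [NormedAddCommGroup H] [InnerProductSpace ℝ H] {ι : V →L[ℝ] H}
    {T α β δ C : ℝ} (hα : 1 < α) (hβ : 0 ≤ β) (hδ : 0 < δ) {f : ℝ → ℝ}
    (hf : ∀ t ∈ Icc 0 T, 0 ≤ f t) (hf_int : Integrable f (timeMeasure T)) {ρ η : V → ℝ}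
    (hρ : IsAdmissibleWeight ρ) (hη : IsAdmissibleWeight η) {A : ℝ → V → StrongDual ℝ V}
    (hA : IsMeasurableOperator T A) (hhemi : Hemicontinuous T A)
    (hmono : LocalMonotonicity ι T C ρ η A) (hcoer : Coercivity ι T α δ C f A)
    (hgrow : Growth ι T α β C f A) {b : ℝ → StrongDual ℝ V}
    (hb : MemLp b (ENNReal.ofReal (α / (α - 1))) (timeMeasure T)) :
    ∃ f' g' : ℝ → ℝ,
      IsEvolutionOperator ι T α β (δ / 2) |C| f' g' ρ η (fun t v => A t v + b t) := by
  have hpq : α.HolderConjugate (α / (α - 1)) := .conjExponent hα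
  have hα0 : 0 < α := by linarith
  have hα1 : 0 < α - 1 := by linarith
  -- The term 2⟨b,v⟩ costs δ/2 ‖v‖^α, which halves the coercivity constant.
  obtain ⟨c, hc, hy⟩ := exists_young hpq (show (0 : ℝ) < δ / 4 by linarith)
  have hmem : ∀ᵐ t ∂timeMeasure T, t ∈ Icc 0 T := ae_restrict_mem measurableSet_Icc
  have hfp : MemLp (fun t => f t ^ ((α - 1) / α)) (ENNReal.ofReal (α / (α - 1)))
      (timeMeasure T) := by
    have h := (memLp_one_iff_integrable.2 hf_int).norm_rpow_div
      (ENNReal.ofReal ((α - 1) / α))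
    rw [ENNReal.toReal_ofReal (by positivity), ← ENNReal.ofReal_one,
      ← ENNReal.ofReal_div_of_pos (by positivity), one_div_div] at h
    refine h.ae_eq ?_
    filter_upwards [hmem] with t ht
    rw [Real.norm_of_nonneg (hf t ht)]
  -- The function in the growth bound need no longer be the power (α-1)/α of the one in the
  -- coercivity bound; this is why the two are separate data, with g only required to lie in L^q.
  refine ⟨fun t => f t + 2 * c * ‖b t‖ ^ (α / (α - 1)), fun t => f t ^ ((α - 1) / α) + ‖b t‖,
    hα, hβ, by linarith, abs_nonneg C,
    hf_int.add ((integrable_norm_rpow hpq.symm.pos hb).const_mul _), hfp.add hb.norm, hρ, hη,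
    fun u hu => (hA u hu).add hb.1, fun t ht v₁ v₂ v => ?_, fun t ht v₁ v₂ => ?_,
    fun t ht v => ?_, fun t ht v => ?_⟩
  · exact (hhemi t ht v₁ v₂ v).add_const (b t v)
  · rw [add_sub_add_right_eq_sub]
    refine (hmono t ht v₁ v₂).trans (mul_le_mul_of_nonneg_right ?_ (by positivity))
    linarith [le_abs_self C]
  · have h1 := hcoer t ht v
    have h2 := hy ‖v‖ ‖b t‖ (norm_nonneg _) (norm_nonneg _)
    have h3 := (le_abs_self _).trans ((b t).le_opNorm v)
    have h4 := mul_le_mul_of_nonneg_right (le_abs_self C) (sq_nonneg ‖ι v‖)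
    have h5 : (A t v + b t) v = A t v v + b t v := rfl
    rw [h5]
    linarith [mul_comm ‖v‖ ‖b t‖]
  · have h1 := hgrow t ht v
    have h2 : (1 : ℝ) ≤ 1 + ‖ι v‖ ^ β := le_add_of_nonneg_right (by positivity)
    have h3 := mul_le_mul_of_nonneg_right (le_abs_self C)
      (show 0 ≤ ‖v‖ ^ (α - 1) by positivity)
    calc ‖A t v + b t‖ ≤ ‖A t v‖ + ‖b t‖ := norm_add_le _ _
      _ ≤ (f t ^ ((α - 1) / α) + C * ‖v‖ ^ (α - 1)) * (1 + ‖ι v‖ ^ β) +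
          ‖b t‖ * (1 + ‖ι v‖ ^ β) :=
        add_le_add h1 (le_mul_of_one_le_right (norm_nonneg _) h2)
      _ = (f t ^ ((α - 1) / α) + ‖b t‖ + C * ‖v‖ ^ (α - 1)) * (1 + ‖ι v‖ ^ β) := by ring
      _ ≤ _ := mul_le_mul_of_nonneg_right (by linarith) (by linarith)

theorem IsWeakPrimitive.hasGeneralizedDeriv {V H : Type*} [NormedAddCommGroup V]
    [NormedSpace ℝ V] [NormedAddCommGroup H] [InnerProductSpace ℝ H] {ι : V →L[ℝ] H}
    {p q T R : ℝ} {v : ℝ → V} {w : ℝ → StrongDual ℝ V} {u : ℝ → H}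
    (h : IsWeakPrimitive ι p q T R v w u) (hT : 0 < T) (hw : Integrable w (timeMeasure T)) :
    HasGeneralizedDeriv T (fun t => toDual ι (u t)) w := by
  refine hasGeneralizedDeriv_of_integral_eq hT hw fun t ht => ?_
  ext z
  have hi := intervalIntegrable_of_timeMeasure hw (left_mem_Icc.2 hT.le) ht
  rw [add_apply, ContinuousLinearMap.intervalIntegral_apply hi, h.integral_eq t ht z,
    toDual_apply, toDual_apply, inner_sub_left]
  ring

end LocallyMonotone

theorem theorem1p1
    {V H : Type*} [NormedAddCommGroup V] [NormedSpace ℝ V] [CompleteSpace V]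
    [MeasurableSpace V] [BorelSpace V]
    [NormedAddCommGroup H] [InnerProductSpace ℝ H] [CompleteSpace H]
    [TopologicalSpace.SeparableSpace H]
    (ι : V →L[ℝ] H) (hι : LocallyMonotone.IsGelfandTriple ι)
    (hcompact : IsCompactOperator ι)
    (T : ℝ) (hT : 0 < T) (α β δ C : ℝ) (hα : 1 < α) (hβ : 0 ≤ β) (hδ : 0 < δ)
    (f : ℝ → ℝ) (hf : ∀ t ∈ Set.Icc 0 T, 0 ≤ f t)
    (hf_int : MeasureTheory.IntegrableOn f (Set.Icc 0 T))
    (ρ η : V → ℝ) (hρ : LocallyMonotone.IsAdmissibleWeight ρ)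
    (hη : LocallyMonotone.IsAdmissibleWeight η)
    (A : ℝ → V → StrongDual ℝ V)
    (hA : LocallyMonotone.IsMeasurableOperator T A)
    (h1 : LocallyMonotone.Hemicontinuous T A)
    (h2 : LocallyMonotone.LocalMonotonicity ι T C ρ η A)
    (h3 : LocallyMonotone.Coercivity ι T α δ C f A)
    (h4 : LocallyMonotone.Growth ι T α β C f A)
    (u₀ : H) (b : ℝ → StrongDual ℝ V)
    (hb : MeasureTheory.MemLp b (ENNReal.ofReal (α / (α - 1)))
      (LocallyMonotone.timeMeasure T)) :
    (∃ (u : ℝ → H) (v : ℝ → V) (u' : ℝ → StrongDual ℝ V),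
      LocallyMonotone.IsSolution ι T α A b u₀ u v ∧
      LocallyMonotone.HasGeneralizedDeriv T (fun t => LocallyMonotone.toDual ι (u t)) u' ∧
      MeasureTheory.MemLp u' (ENNReal.ofReal (α / (α - 1))) (LocallyMonotone.timeMeasure T) ∧
      ∀ t ∈ Set.Icc 0 T, ∀ z : V,
        IntervalIntegrable (fun s => (A s (v s) + b s) z) MeasureTheory.volume 0 t ∧
        inner ℝ (u t) (ι z) = inner ℝ u₀ (ι z) + ∫ s in (0 : ℝ)..t, (A s (v s) + b s) z) ∧
    ((∃ C' γ : ℝ, 0 ≤ γ ∧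
        ∀ z : V, ρ z + η z ≤ C' * (1 + ‖z‖ ^ α) * (1 + ‖ι z‖ ^ γ)) →
      ∀ (u₁ u₂ : ℝ → H) (v₁ v₂ : ℝ → V),
        LocallyMonotone.IsSolution ι T α A b u₀ u₁ v₁ →
        LocallyMonotone.IsSolution ι T α A b u₀ u₂ v₂ →
        Set.EqOn u₁ u₂ (Set.Icc 0 T) ∧
          ∀ᵐ t ∂(LocallyMonotone.timeMeasure T), v₁ t = v₂ t) := by
  have hpq : α.HolderConjugate (α / (α - 1)) := .conjExponent hα
  obtain ⟨f', g', hE⟩ := LocallyMonotone.exists_isEvolutionOperator_add hα hβ hδ hf hf_int hρ hη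
    hA h1 h2 h3 h4 hb
  constructor
  · obtain ⟨R, M, x, u, v, hG⟩ := hE.exists_galerkin_limit hT hι u₀
    have hW := hE.isWeakPrimitive_of_galerkinLimit hT hι hcompact hG
    have hw := LocallyMonotone.integrable_of_eLpNorm_le hpq.symm.lt.le hW.memLp_right
    have hD := hW.hasGeneralizedDeriv hT hw
    refine ⟨u, v, fun t => A t (v t) + b t,
      ⟨hW.memLp_left, hW.continuousOn hpq hι.denseRange, hW.ae_eq, hD, hG.initial⟩,
      hD, hW.memLp_right, fun t ht z => ⟨?_, ?_⟩⟩
    · exact LocallyMonotone.intervalIntegrable_of_timeMeasure (hw.apply_continuousLinearMap z)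
        (Set.left_mem_Icc.2 hT.le) ht
    · rw [hW.integral_eq t ht z, hG.initial, inner_sub_left]
      ring
  · rintro ⟨C', γ, hγ, hbound⟩ u₁ u₂ v₁ v₂ hs₁ hs₂
    obtain ⟨R₁, hW₁⟩ := hE.exists_isWeakPrimitive hT hs₁.memLp hs₁.continuousOn hs₁.ae_eq
      hs₁.equation
    obtain ⟨R₂, hW₂⟩ := hE.exists_isWeakPrimitive hT hs₂.memLp hs₂.continuousOn hs₂.ae_eq
      hs₂.equation
    exact hE.unique hT hι hγ hbound hW₁ hW₂ (hs₁.initial.trans hs₂.initial.symm)
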